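/- A \emph{FIFO automaton} is a tuple $\mathcal A=(L,M,I,A,\delta,l_0)$ with finite sets $L$ of control states, $M$ of messages, $I$ of buffer identifiers, $A\subseteq I\times\{!,?\}\times M$ of actions, a transition relation $\delta\subseteq L\times A\times L$ and an initial state $l_0\in L$; its size is $|L|+|\delta|$. A \emph{system} is a finite family $\mathcal S=(\mathcal A_p)_{p\in P}$ of FIFO automata with pairwise disjoint action sets $A_p$ (buffers may otherwise be shared arbitrarily; peer-to-peer and mailbox systems are special cases). Write $I=\bigcup_p I_p$, $M=\bigcup_p M_p$, and let $n=\sum_p(|L_p|+|\delta_p|)$ be the size of $\mathcal S$. A configuration consists of one control state per process and one word over $M$ per buffer; initially every process is in its initial state and all buffers are empty. In a step one process takes a transition; its action $i!m$ appends $m$ at the end of buffer $i$, and its action $i?m$ removes $m$ from the front of buffer $i$. An \emph{execution of $\mathcal S$} is a finite sequence of actions labelling a run from the initial configuration. In a sequence of actions $e=a_1\cdots a_N$, positions $j,j'$ form a \emph{matching pair} if for some $i,m,r$: $a_j=i!m$ is the $r$-th send on $i$ in $e$ and $a_{j'}=i?m$ is the $r$-th receive on $i$ in $e$. Two actions \emph{commute}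 if they belong to different processes and are not two actions of the same type ($!$ or $?$) on the same buffer. The \emph{action graph} of $e$ has vertices $1,\dots,N$, vertex $j$ being labelled by $a_j$, and an edge from $j$ to $j'$ if $j<j'$ and either $a_j,a_{j'}$ do not commute or $\{j,j'\}$ is a matching pair. Two sequences are \emph{causally equivalent} if their labelled action graphs are isomorphic. A sequence is \emph{greedy} if in each matching pair the receive is at the position immediately following that of the send. The system $\mathcal S$ is \emph{greedy} if each execution of $\mathcal S$ is causally equivalent to a greedy sequence. \textbf{Theorem.} Whether a given system $\mathcal S$ is greedy is decidable in time $$O\big(|I|^5\,|M|^4\,2^{|I|}\,n^{|P|+2}\big).$$ More precisely, there are a single program of a random access machine (unit cost; registers and memory cells hold natural numbers; the instructions are constants, addition, truncated subtraction, indirect load and store, zero tests and loops) and a constant $C$ such that for every system $\mathcal S$ whose processes, buffers, messages and control states are numbered from $0$, the program, started on any word of natural numbers listing the components of $\mathcal S$, halts within $C\cdot\max\big(1,|I|^5|M|^4 2^{|I|}n^{|P|+2}\big)$ steps, with output $1$ if $\mathcal S$ is greedy and output $0$ otherwise. -/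

import Mathlib

/-! ### FIFO automata and FIFO systems -/

namespace FIFO

/-- The two kinds of actions: `send` is written `!`, `recv` is written `?`. -/
inductive Dir where
  | send
  | recv
deriving DecidableEq

/-- The action `(i, send, m)` is `i!m` and the action `(i, recv, m)` is `i?m`. -/
abbrev Action (ι μ : Type) : Type := ι × Dir × μ

/-- A FIFO automaton with buffer identifiers in `ι` and messages in `μ`.
Its control states are `0, …, numStates - 1`. -/
structure Automaton (ι μ : Type) where
  numStates : ℕ
  messages : Finset μ
  buffers : Finset ι
  actions : Finset (Action ι μ)
  actions_sub : ∀ a ∈ actions, a.1 ∈ buffers ∧ a.2.2 ∈ messages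
  trans : Finset (Fin numStates × Action ι μ × Fin numStates)
  trans_sub : ∀ t ∈ trans, t.2.1 ∈ actions
  init : Fin numStates

/-- The size of an automaton: number of control states plus number of transitions. -/
def Automaton.size {ι μ : Type} (A : Automaton ι μ) : ℕ := A.numStates + A.trans.card

/-- A FIFO system: a family of FIFO automata indexed by the processes, with pairwise disjoint
sets of actions. Any process may enqueue in, and dequeue from, any buffer. The types `ι` and `μ`
are exactly the union of the buffer sets and the union of the message sets. -/
structure System (π ι μ : Type) where
  aut : π → Automaton ι μ
  disjoint : ∀ p q, p ≠ q → Disjoint (aut p).actions (aut q).actions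
  buffers_cover : ∀ i, ∃ p, i ∈ (aut p).buffers
  messages_cover : ∀ m, ∃ p, m ∈ (aut p).messages

namespace System

variable {π ι μ : Type}

/-- The size of a system: the sum of the sizes of its automata. -/
def size [Fintype π] (S : System π ι μ) : ℕ := ∑ p, (S.aut p).size

/-- A configuration: a control state for each process and a word for each buffer. -/
structure Config (S : System π ι μ) where
  state : (p : π) → Fin (S.aut p).numStates
  buf : ι → List μ

/-- The initial configuration: initial control states and empty buffers. -/
def initConfig (S : System π ι μ) : S.Config where
  state := fun p => (S.aut p).init
  buf := fun _ => []

/-- The effect of an action on the buffers: sending enqueues on the right,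
receiving dequeues on the left, all other buffers are unchanged. -/
def BufStep (b : ι → List μ) (a : Action ι μ) (c : ι → List μ) : Prop :=
  (match a with
    | (i, Dir.send, m) => c i = b i ++ [m]
    | (i, Dir.recv, m) => b i = m :: c i) ∧
  ∀ j, j ≠ a.1 → c j = b j

/-- One step of the (asynchronous product of the) system: one process takes a transition. -/
def Step (S : System π ι μ) (x : S.Config) (a : Action ι μ) (y : S.Config) : Prop :=
  (∃ p, (x.state p, a, y.state p) ∈ (S.aut p).trans ∧ ∀ q, q ≠ p → y.state q = x.state q) ∧
  BufStep x.buf a y.buf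

/-- `S.Run x e y`: the sequence of actions `e` leads from `x` to `y`. -/
inductive Run (S : System π ι μ) : S.Config → List (Action ι μ) → S.Config → Prop
  | nil (x : S.Config) : Run S x [] x
  | cons {x y z : S.Config} {a : Action ι μ} {e : List (Action ι μ)} :
      S.Step x a y → Run S y e z → Run S x (a :: e) z

/-- `e` is an execution of the system from its initial configuration. -/
def IsExecution (S : System π ι μ) (e : List (Action ι μ)) : Prop :=
  ∃ x, S.Run S.initConfig e x

/-- The two actions belong to the same process. -/
def SameOwner (S : System π ι μ) (a b : Action ι μ) : Prop :=
  ∃ p, a ∈ (S.aut p).actions ∧ b ∈ (S.aut p).actions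

/-- Two actions commute if they belong to different processes and are not two actions of
the same type on the same buffer. -/
def Commutes (S : System π ι μ) (a b : Action ι μ) : Prop :=
  ¬ S.SameOwner a b ∧ ¬ (a.1 = b.1 ∧ a.2.1 = b.2.1)

/-- The number of actions of type `d` on buffer `i` in `e`. -/
def countOn [DecidableEq ι] (d : Dir) (i : ι) (e : List (Action ι μ)) : ℕ :=
  e.countP (fun a => decide (a.1 = i ∧ a.2.1 = d))

/-- Position `j` of `e` carries a send action `i!m`, position `k` carries the receive action
`i?m`, and for some `r` the former is the `r`-th send on `i` and the latter is the `r`-th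
receive on `i` in `e`. -/
def IsMatch [DecidableEq ι] (e : List (Action ι μ)) (j k : ℕ) : Prop :=
  ∃ i m, e[j]? = some (i, Dir.send, m) ∧ e[k]? = some (i, Dir.recv, m) ∧
    countOn Dir.send i (e.take j) = countOn Dir.recv i (e.take k)

/-- The edges of the action graph of `e`. -/
def HappensBefore [DecidableEq ι] (S : System π ι μ) (e : List (Action ι μ))
    (j k : Fin e.length) : Prop :=
  j < k ∧ (¬ S.Commutes (e.get j) (e.get k) ∨ IsMatch e j k ∨ IsMatch e k j)

/-- Causal equivalence: the action graphs, with vertices labelled by the actions,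
are isomorphic. -/
def CausalEquiv [DecidableEq ι] (S : System π ι μ) (e f : List (Action ι μ)) : Prop :=
  ∃ σ : Fin e.length ≃ Fin f.length,
    (∀ j, f.get (σ j) = e.get j) ∧
    ∀ j k, S.HappensBefore e j k ↔ S.HappensBefore f (σ j) (σ k)

/-- A sequence of actions is greedy if each matched receive immediately follows its send. -/
def GreedyWord [DecidableEq ι] (e : List (Action ι μ)) : Prop :=
  ∀ j k, IsMatch e j k → k = j + 1

/-- A system is greedy if each of its executions is causally equivalent to a greedy one. -/
def Greedy [DecidableEq ι] (S : System π ι μ) : Prop :=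
  ∀ e, S.IsExecution e → ∃ f, GreedyWord f ∧ S.CausalEquiv e f

end System

/-! ### Input encoding -/

/-- `l` lists the elements of `s`, in any order and without repetition. -/
def Lists {α : Type} (l : List α) (s : Finset α) : Prop := l.Nodup ∧ ∀ a, a ∈ l ↔ a ∈ s

/-- Code of an action: buffer, type (`0` for send, `1` for receive), message. -/
def codeAction {b v : ℕ} (a : Action (Fin b) (Fin v)) : List ℕ :=
  [a.1.val, (match a.2.1 with | Dir.send => 0 | Dir.recv => 1), a.2.2.val]

/-- Code of a transition: source, action, target. -/
def codeTrans {n b v : ℕ} (t : Fin n × Action (Fin b) (Fin v) × Fin n) : List ℕ :=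
  [t.1.val] ++ codeAction t.2.1 ++ [t.2.2.val]

/-- `w` is a code of the automaton `A`: number of control states, initial state, and the lists
of messages, buffers, actions and transitions, each preceded by its length. -/
def CodesAutomaton {b v : ℕ} (A : Automaton (Fin b) (Fin v)) (w : List ℕ) : Prop :=
  ∃ lm lb la lt, Lists lm A.messages ∧ Lists lb A.buffers ∧ Lists la A.actions ∧
    Lists lt A.trans ∧
    w = [A.numStates, A.init.val]
      ++ [lm.length] ++ lm.map Fin.val
      ++ [lb.length] ++ lb.map Fin.val
      ++ [la.length] ++ la.flatMap codeAction
      ++ [lt.length] ++ lt.flatMap codeTrans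

/-- `w` is a code of the system `S`: the numbers of processes, buffers and messages, followed
by codes of the automata. -/
def CodesSystem {k b v : ℕ} (S : System (Fin k) (Fin b) (Fin v)) (w : List ℕ) : Prop :=
  ∃ c : Fin k → List ℕ, (∀ p, CodesAutomaton (S.aut p) (c p)) ∧
    w = [k, b, v] ++ (List.ofFn c).flatten

end FIFO

/-! ### Random access machines with unit cost -/

namespace RAM

/-- A machine state: registers and memory cells, each holding a natural number. -/
structure State where
  reg : ℕ → ℕ
  mem : ℕ → ℕ

/-- Programs of a random access machine. Registers are named by numerals, so a program uses only
finitely many of them; memory is accessed by indirect addressing. -/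
inductive Prog where
  /-- do nothing -/
  | skip
  /-- `r := n` -/
  | const (r n : ℕ)
  /-- `r := a + b` -/
  | add (r a b : ℕ)
  /-- `r := max (a - b) 0` -/
  | sub (r a b : ℕ)
  /-- `r := mem[a]` -/
  | load (r a : ℕ)
  /-- `mem[a] := r` -/
  | store (a r : ℕ)
  /-- first `c`, then `d` -/
  | seq (c d : Prog)
  /-- if `r ≠ 0` then `c` else `d` -/
  | cond (r : ℕ) (c d : Prog)
  /-- while `r ≠ 0` do `c` -/
  | loop (r : ℕ) (c : Prog)

/-- Assign a value to a register. -/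
def State.setReg (s : State) (r n : ℕ) : State := { s with reg := Function.update s.reg r n }

/-- Assign a value to a memory cell. -/
def State.setMem (s : State) (a n : ℕ) : State := { s with mem := Function.update s.mem a n }

/-- `Runs c s t u`: started in state `s`, the program `c` halts after exactly `t` steps in
state `u`. Each elementary instruction and each test of a register costs one step. -/
inductive Runs : Prog → State → ℕ → State → Prop
  | skip (s : State) : Runs Prog.skip s 1 s
  | const (s : State) (r n : ℕ) : Runs (Prog.const r n) s 1 (s.setReg r n)
  | add (s : State) (r a b : ℕ) : Runs (Prog.add r a b) s 1 (s.setReg r (s.reg a + s.reg b))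
  | sub (s : State) (r a b : ℕ) : Runs (Prog.sub r a b) s 1 (s.setReg r (s.reg a - s.reg b))
  | load (s : State) (r a : ℕ) : Runs (Prog.load r a) s 1 (s.setReg r (s.mem (s.reg a)))
  | store (s : State) (a r : ℕ) : Runs (Prog.store a r) s 1 (s.setMem (s.reg a) (s.reg r))
  | seq {c d : Prog} {s u v : State} {t₁ t₂ : ℕ} :
      Runs c s t₁ u → Runs d u t₂ v → Runs (Prog.seq c d) s (t₁ + t₂) v
  | cond_true {r : ℕ} {c d : Prog} {s u : State} {t : ℕ} :
      s.reg r ≠ 0 → Runs c s t u → Runs (Prog.cond r c d) s (t + 1) u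
  | cond_false {r : ℕ} {c d : Prog} {s u : State} {t : ℕ} :
      s.reg r = 0 → Runs d s t u → Runs (Prog.cond r c d) s (t + 1) u
  | loop_true {r : ℕ} {c : Prog} {s u v : State} {t₁ t₂ : ℕ} :
      s.reg r ≠ 0 → Runs c s t₁ u → Runs (Prog.loop r c) u t₂ v →
      Runs (Prog.loop r c) s (t₁ + t₂ + 1) v
  | loop_false {r : ℕ} {c : Prog} {s : State} :
      s.reg r = 0 → Runs (Prog.loop r c) s 1 s

/-- The initial state on input `w`: the word `w` is stored in the memory cells
`0, …, |w| - 1`, its length in register `0`, and everything else is `0`. -/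
def initState (w : List ℕ) : State where
  reg := fun r => if r = 0 then w.length else 0
  mem := fun a => w.getD a 0

/-- Machines are deterministic: final state and number of steps are determined by the input. -/
theorem Runs.unique {c : Prog} {s : State} {t₁ t₂ : ℕ} {u₁ u₂ : State}
    (h₁ : Runs c s t₁ u₁) (h₂ : Runs c s t₂ u₂) : t₁ = t₂ ∧ u₁ = u₂ := by
  induction h₁ generalizing t₂ u₂ with
  | skip | const | add | sub | load | store => cases h₂; exact ⟨rfl, rfl⟩
  | seq _ _ ih₁ ih₂ =>
    cases h₂ with
    | seq g₁ g₂ =>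
      obtain ⟨rfl, rfl⟩ := ih₁ g₁
      obtain ⟨rfl, rfl⟩ := ih₂ g₂
      exact ⟨rfl, rfl⟩
  | cond_true h _ ih =>
    cases h₂ with
    | cond_true _ g => obtain ⟨rfl, rfl⟩ := ih g; exact ⟨rfl, rfl⟩
    | cond_false g => exact absurd g h
  | cond_false h _ ih =>
    cases h₂ with
    | cond_true g => exact absurd h g
    | cond_false _ g => obtain ⟨rfl, rfl⟩ := ih g; exact ⟨rfl, rfl⟩
  | loop_true h _ _ ih₁ ih₂ =>
    cases h₂ with
    | loop_true _ g₁ g₂ =>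
      obtain ⟨rfl, rfl⟩ := ih₁ g₁
      obtain ⟨rfl, rfl⟩ := ih₂ g₂
      exact ⟨rfl, rfl⟩
    | loop_false g => exact absurd g h
  | loop_false h =>
    cases h₂ with
    | loop_true g => exact absurd h g
    | loop_false => exact ⟨rfl, rfl⟩

end RAM

/-! Call a block either a single send or an exchange, that is, a send to an empty buffer followed at
once by its receive. A run made of blocks is greedy (`BlockRun.greedyWord`). In such a run a lone
send fills its buffer for good, since exchanges need an empty buffer; of the buffer contents only
emptiness matters for the continuation.

Let a block run be followed by one more receive. It takes the message of some lone send `s`. The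
blocks after `s` that do not causally follow it, each block being treated as a unit, can be moved
before `s` (`BlockRun.advance`). If no remaining action belongs to the receiving process, the
receive can be moved back to `s` and the two form an exchange; by induction each execution is
causally equivalent to a block run (`exists_blockRun`). If a follower of `s` does belong to the
receiving process, then in a greedy equivalent it would have to come after `s`, before the receive,
and yet the receive is adjacent to `s`, which is absurd (`not_greedy_of_follows`). Hence the system
fails to be greedy exactly if some block run contains a lone send `s` to an empty buffer and a chain
of dependencies from `s` to an action of a process that can then receive the message of `s`
(`greedy_iff`).

Such a chain can be guessed one resource at a time, a resource being a process or an end of a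
buffer. So the search runs over nodes made of control states, the set of nonempty buffers, buffer
and message of `s`, and one mark. There are at most `(∏ |L_p|) * 2^|I| * (|I||M| + 1) * (2|P| + 2|I|
+ 2)` nodes (`card_node_le`).

The machine codes a node as a sum of powers of two, one exponent for each component of the node, and
a step of the search as a rule of five replacements of exponents (`rules_iff`). A breadth-first
search uses the codes as addresses (`search_spec`). There are `O(n^2)` rules, and each node costs
`O(n^2 |I| |M|)` steps. The factor `|P|` from the marks is absorbed by `card_mul_prod_le`, and the
total stays below the stated bound (`timeBound_le`). -/

set_option linter.unusedSimpArgs false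
set_option linter.unusedSectionVars false

/-! ### A calculus of time-bounded correctness statements -/

namespace RAM

@[simp] theorem State.setReg_mem (s : State) (r n : ℕ) : (s.setReg r n).mem = s.mem := rfl

theorem State.setReg_reg (s : State) (r n x : ℕ) :
    (s.setReg r n).reg x = if x = r then n else s.reg x := by
  simp [State.setReg, Function.update_apply]

@[simp] theorem State.setMem_reg (s : State) (a n : ℕ) : (s.setMem a n).reg = s.reg := rfl

theorem State.setMem_mem (s : State) (a n x : ℕ) :
    (s.setMem a n).mem x = if x = a then n else s.mem x := by
  simp [State.setMem, Function.update_apply]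

/-- Started in `s`, the program halts within `T` steps in a state satisfying `Q`. -/
def Tri (c : Prog) (s : State) (T : ℕ) (Q : State → Prop) : Prop :=
  ∃ t u, Runs c s t u ∧ t ≤ T ∧ Q u

theorem Tri.mono {c : Prog} {s : State} {T T' : ℕ} {Q Q' : State → Prop}
    (h : Tri c s T Q) (hT : T ≤ T') (hQ : ∀ u, Q u → Q' u) : Tri c s T' Q' := by
  obtain ⟨t, u, hr, ht, hu⟩ := h
  exact ⟨t, u, hr, ht.trans hT, hQ u hu⟩

theorem Tri.weaken {c : Prog} {s : State} {T : ℕ} {Q Q' : State → Prop}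
    (h : Tri c s T Q) (hQ : ∀ u, Q u → Q' u) : Tri c s T Q' := h.mono le_rfl hQ

/-- Nesting the second statement in the postcondition of the first lets a proof follow the program
instruction by instruction, without naming intermediate assertions. -/
theorem Tri.seq {c d : Prog} {s : State} {T₁ T₂ : ℕ} {Q : State → Prop}
    (h : Tri c s T₁ (fun u => Tri d u T₂ Q)) : Tri (Prog.seq c d) s (T₁ + T₂) Q := by
  obtain ⟨t, u, hr, ht, t', v, hr', ht', hv⟩ := h
  exact ⟨t + t', v, Runs.seq hr hr', by omega, hv⟩

theorem Tri.cond {r : ℕ} {c d : Prog} {s : State} {T : ℕ} {Q : State → Prop}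
    (h₁ : s.reg r ≠ 0 → Tri c s T Q) (h₂ : s.reg r = 0 → Tri d s T Q) :
    Tri (Prog.cond r c d) s (T + 1) Q := by
  by_cases h : s.reg r = 0
  · obtain ⟨t, u, hr, ht, hu⟩ := h₂ h
    exact ⟨t + 1, u, Runs.cond_false h hr, by omega, hu⟩
  · obtain ⟨t, u, hr, ht, hu⟩ := h₁ h
    exact ⟨t + 1, u, Runs.cond_true h hr, by omega, hu⟩

/-- Loop rule: each round costs at most `T` and decreases the index of the invariant. -/
theorem Tri.loop {r : ℕ} {c : Prog} {T : ℕ} {Q : State → Prop} (I : ℕ → State → Prop)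
    (hstep : ∀ n s, I n s → s.reg r ≠ 0 → Tri c s T (fun u => ∃ m, m < n ∧ I m u))
    (hend : ∀ n s, I n s → s.reg r = 0 → Q s) (n : ℕ) (s : State) (h : I n s) :
    Tri (Prog.loop r c) s (n * (T + 1) + 1) Q := by
  induction n using Nat.strong_induction_on generalizing s with
  | _ n ih =>
    by_cases h0 : s.reg r = 0
    · exact ⟨1, s, Runs.loop_false h0, by omega, hend n s h h0⟩
    · obtain ⟨t, u, hr, ht, m, hm, hu⟩ := hstep n s h h0
      obtain ⟨t', v, hr', ht', hv⟩ := ih m hm u hu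
      -- The `+ 1` within the product pays for the test of each round, the last `+ 1` for the test
      -- that ends the loop.
      refine ⟨t + t' + 1, v, Runs.loop_true h0 hr hr', ?_, hv⟩
      have : (m + 1) * (T + 1) ≤ n * (T + 1) := Nat.mul_le_mul_right _ hm
      nlinarith

/-- Loop rule for loops that traverse a list. -/
theorem Tri.loop_list {α : Type*} {r : ℕ} {c : Prog} {T : ℕ} {Q : State → Prop}
    (I : List α → State → Prop)
    (hpos : ∀ a l s, I (a :: l) s → s.reg r ≠ 0 ∧ Tri c s T (I l))
    (hnil : ∀ s, I [] s → s.reg r = 0 ∧ Q s) (l : List α) (s : State) (h : I l s) :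
    Tri (Prog.loop r c) s (l.length * (T + 1) + 1) Q := by
  refine Tri.loop (fun n s => ∃ l : List α, l.length = n ∧ I l s) ?_ ?_ _ s ⟨l, rfl, h⟩
  · rintro n s ⟨l, rfl, hI⟩ h0
    cases l with
    | nil => exact absurd (hnil s hI).1 h0
    | cons a l => exact (hpos a l s hI).2.weaken fun u hu => ⟨l.length, by simp, l, rfl, hu⟩
  · rintro n s ⟨l, rfl, hI⟩ h0
    cases l with
    | nil => exact (hnil s hI).2
    | cons a l => exact absurd h0 (hpos a l s hI).1

/-- Loop rule for a counting loop: the invariant index is the number of rounds left. -/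
theorem Tri.loop_count {r : ℕ} {c : Prog} {T : ℕ} {Q : State → Prop} (I : ℕ → State → Prop)
    (hpos : ∀ n s, I (n + 1) s → s.reg r ≠ 0 ∧ Tri c s T (I n))
    (hnil : ∀ s, I 0 s → s.reg r = 0 ∧ Q s) (n : ℕ) (s : State) (h : I n s) :
    Tri (Prog.loop r c) s (n * (T + 1) + 1) Q := by
  refine Tri.loop I ?_ ?_ n s h
  · intro n s hI h0
    cases n with
    | zero => exact absurd (hnil s hI).1 h0
    | succ n => exact (hpos n s hI).2.weaken fun u hu => ⟨n, by simp, hu⟩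
  · intro n s hI h0
    cases n with
    | zero => exact (hnil s hI).2
    | succ n => exact absurd h0 (hpos n s hI).1

/-! ### Loop-free programs: evaluation, cost, and untouched registers -/

namespace Prog

/-- Sequential composition of a list of programs. -/
def block : List Prog → Prog
  | [] => skip
  | c :: l => seq c (block l)

/-- The registers that a program may assign. -/
def writes : Prog → List ℕ
  | skip => []
  | const r _ => [r]
  | add r _ _ => [r]
  | sub r _ _ => [r]
  | load r _ => [r]
  | store _ _ => []
  | seq c d => c.writes ++ d.writes
  | cond _ c d => c.writes ++ d.writes
  | loop _ c => c.writes

/-- The program contains no loop. -/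
def loopFree : Prog → Bool
  | seq c d => c.loopFree && d.loopFree
  | cond _ c d => c.loopFree && d.loopFree
  | loop _ _ => false
  | _ => true

/-- The final state of a loop-free program. -/
def eval : Prog → State → State
  | skip, s => s
  | const r n, s => s.setReg r n
  | add r a b, s => s.setReg r (s.reg a + s.reg b)
  | sub r a b, s => s.setReg r (s.reg a - s.reg b)
  | load r a, s => s.setReg r (s.mem (s.reg a))
  | store a r, s => s.setMem (s.reg a) (s.reg r)
  | seq c d, s => d.eval (c.eval s)
  | cond r c d, s => if s.reg r = 0 then d.eval s else c.eval s
  | loop _ _, s => s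

/-- An upper bound for the running time of a loop-free program. -/
def cost : Prog → ℕ
  | seq c d => c.cost + d.cost
  | cond _ c d => max c.cost d.cost + 1
  | _ => 1

end Prog

theorem Runs.reg_eq_of_notMem_writes {c : Prog} {s u : State} {t : ℕ} (h : Runs c s t u) {r : ℕ}
    (hr : r ∉ c.writes) : u.reg r = s.reg r := by
  induction h with
  | skip | store => rfl
  | const | add | sub | load =>
    simp only [Prog.writes, List.mem_singleton] at hr
    simp [State.setReg_reg, hr]
  | seq _ _ ih₁ ih₂ =>
    simp only [Prog.writes, List.mem_append, not_or] at hr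
    rw [ih₂ hr.2, ih₁ hr.1]
  | cond_true _ _ ih =>
    simp only [Prog.writes, List.mem_append, not_or] at hr
    exact ih hr.1
  | cond_false _ _ ih =>
    simp only [Prog.writes, List.mem_append, not_or] at hr
    exact ih hr.2
  | loop_true _ _ _ ih₁ ih₂ => rw [ih₂ hr, ih₁ hr]
  | loop_false => rfl

/-- A syntactic frame rule: a specification needs to mention only what changes, and all other
registers are recovered from `writes`. -/
theorem Tri.frame {c : Prog} {s : State} {T : ℕ} {Q : State → Prop} (h : Tri c s T Q) :
    Tri c s T (fun u => Q u ∧ ∀ r, r ∉ c.writes → u.reg r = s.reg r) := by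
  obtain ⟨t, u, hr, ht, hu⟩ := h
  exact ⟨t, u, hr, ht, hu, fun r h => hr.reg_eq_of_notMem_writes h⟩

theorem runs_eval (c : Prog) (s : State) (h : c.loopFree = true) :
    ∃ t ≤ c.cost, Runs c s t (c.eval s) := by
  induction c generalizing s with
  | skip => exact ⟨1, le_rfl, Runs.skip s⟩
  | const r n => exact ⟨1, le_rfl, Runs.const s r n⟩
  | add r a b => exact ⟨1, le_rfl, Runs.add s r a b⟩
  | sub r a b => exact ⟨1, le_rfl, Runs.sub s r a b⟩
  | load r a => exact ⟨1, le_rfl, Runs.load s r a⟩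
  | store a r => exact ⟨1, le_rfl, Runs.store s a r⟩
  | seq c d ihc ihd =>
    simp only [Prog.loopFree, Bool.and_eq_true] at h
    obtain ⟨t, ht, hr⟩ := ihc s h.1
    obtain ⟨t', ht', hr'⟩ := ihd (c.eval s) h.2
    exact ⟨t + t', Nat.add_le_add ht ht', Runs.seq hr hr'⟩
  | cond r c d ihc ihd =>
    simp only [Prog.loopFree, Bool.and_eq_true] at h
    by_cases h0 : s.reg r = 0
    · obtain ⟨t, ht, hr⟩ := ihd s h.2
      refine ⟨t + 1, ?_, ?_⟩
      · simp only [Prog.cost]; omega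
      · simp only [Prog.eval, h0, if_true]; exact Runs.cond_false h0 hr
    · obtain ⟨t, ht, hr⟩ := ihc s h.1
      refine ⟨t + 1, ?_, ?_⟩
      · simp only [Prog.cost]; omega
      · simp only [Prog.eval, h0, if_false]; exact Runs.cond_true h0 hr
  | loop r c => simp [Prog.loopFree] at h

theorem eval_reg_of_notMem_writes (c : Prog) (s : State) {r : ℕ} (hr : r ∉ c.writes) :
    (c.eval s).reg r = s.reg r := by
  induction c generalizing s with
  | skip | store => rfl
  | const | add | sub | load =>
    simp only [Prog.writes, List.mem_singleton] at hr
    simp [Prog.eval, State.setReg_reg, hr]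
  | seq c d ihc ihd =>
    simp only [Prog.writes, List.mem_append, not_or] at hr
    rw [Prog.eval, ihd _ hr.2, ihc _ hr.1]
  | cond r c d ihc ihd =>
    simp only [Prog.writes, List.mem_append, not_or] at hr
    rw [Prog.eval]
    split_ifs
    · exact ihd _ hr.2
    · exact ihc _ hr.1
  | loop => rfl

/-- Straight-line code is verified by computation: `eval` gives the final state and `cost` the time.
-/
theorem Tri.of_eval {c : Prog} {s : State} {T : ℕ} {Q : State → Prop} (h : c.loopFree = true)
    (hT : c.cost ≤ T) (hQ : Q (c.eval s)) : Tri c s T Q := by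
  obtain ⟨t, ht, hr⟩ := runs_eval c s h
  exact ⟨t, _, hr, ht.trans hT, hQ⟩

/-- The memory holds the word `l` followed by zeros. -/
def State.Holds (s : State) (l : List ℕ) : Prop := ∀ a, s.mem a = l.getD a 0

theorem State.Holds.congr {s u : State} {l : List ℕ} (h : s.Holds l) (hm : u.mem = s.mem) :
    u.Holds l := fun a => by rw [hm]; exact h a

theorem State.Holds.push {s u : State} {l : List ℕ} {x : ℕ} (h : s.Holds l)
    (hm : ∀ a, u.mem a = if a = l.length then x else s.mem a) : u.Holds (l ++ [x]) := by
  intro a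
  rw [hm, h a]
  rcases lt_trichotomy a l.length with h1 | h1 | h1
  · rw [if_neg h1.ne, List.getD_append _ _ _ _ h1]
  · subst h1; simp
  · rw [if_neg h1.ne', List.getD_eq_default _ _ h1.le, List.getD_eq_default]
    simp; omega

end RAM

namespace RAM

-- Names of registers

notation "rZero" => 0
notation "rOne" => 1
notation "rTop" => 2
notation "rBufs" => 4
notation "rU" => 10
notation "rPow" => 11
notation "rBits" => 12
notation "rBase" => 13
notation "rTail" => 14
notation "rHead" => 15
notation "rCode" => 16
notation "rX" => 17
notation "rY" => 18
notation "rPtr" => 19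
notation "rRules" => 20
notation "rRulesEnd" => 21
notation "rD" => 22
notation "rE" => 23
notation "rBad" => 24

/-! ### Breadth-first search on sets of natural numbers

A finite set of natural numbers is represented by the number whose binary digits it marks. -/

/-- Replace the element `f` by the element `t`. -/
def swap (f t c : ℕ) : Option ℕ :=
  -- The target is tested after the source has been removed. So the pair `(f, f)` is a pure
  -- membership test, which the rules use both as a test and as padding.
  if c.testBit f then (if (c - 2 ^ f).testBit t then none else some (c - 2 ^ f + 2 ^ t)) else none

/-- A rule is a list of replacements, to be carried out one after the other. -/
abbrev Rule : Type := List (ℕ × ℕ)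

/-- The result of a rule, if it is applicable. -/
def Rule.apply : Rule → ℕ → Option ℕ
  | [], c => some c
  | p :: l, c => (swap p.1 p.2 c).bind (Rule.apply l)

/-- Append an element unless it is there. -/
def enqueue (Q : List ℕ) (c : ℕ) : List ℕ := if c ∈ Q then Q else Q ++ [c]

/-- Enqueue the result of a rule. -/
def visitRule (r : Rule) (c : ℕ) (Q : List ℕ) : List ℕ :=
  match r.apply c with
  | none => Q
  | some d => enqueue Q d

/-- Enqueue the results of all rules. -/
def visitAll (rs : List Rule) (c : ℕ) (Q : List ℕ) : List ℕ :=
  rs.foldl (fun Q r => visitRule r c Q) Q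

/-- The memory and the registers during the search: `l` is the static part of the memory,
followed by `U` digits and by the interleaved tables of visited codes and of the queue `Q`. -/
structure Core (l : List ℕ) (ps U : ℕ) (Q : List ℕ) (s : State) : Prop where
  low : ∀ a < l.length, s.mem a = l.getD a 0
  -- Both tables are potentially unbounded, and codes range up to `2 ^ U`. Interleaving gives each
  -- table infinite room, and since fresh memory is zero, neither has to be initialised.
  visited : ∀ d, s.mem (l.length + U + 2 * d) = if d ∈ Q then 1 else 0
  queue : ∀ j, s.mem (l.length + U + 2 * j + 1) = Q.getD j 0
  zero : s.reg rZero = 0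
  one : s.reg rOne = 1
  bitsReg : s.reg rBits = l.length
  baseReg : s.reg rBase = l.length + U
  tailReg : s.reg rTail = l.length + U + 2 * Q.length + 1
  powReg : s.reg rPow = ps

/-- Moreover, `c` is the current code, and its digits are stored. -/
structure Env (l : List ℕ) (ps U : ℕ) (c : ℕ) (Q : List ℕ) (s : State) : Prop
    extends Core l ps U Q s where
  bits : ∀ e < U, s.mem (l.length + e) = if c.testBit e then 1 else 0
  codeReg : s.reg rCode = c

/-- Changes of the auxiliary registers do not matter. -/
theorem Env.congr {l : List ℕ} {ps U c : ℕ} {Q : List ℕ} {s u : State} (h : Env l ps U c Q s)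
    (hm : u.mem = s.mem) (hr : ∀ r ≤ rCode, u.reg r = s.reg r) : Env l ps U c Q u where
  low a ha := by rw [hm, h.low a ha]
  bits e he := by rw [hm, h.bits e he]
  visited d := by rw [hm, h.visited]
  queue d := by rw [hm, h.queue]
  zero := by rw [hr _ (by simp), h.zero]
  one := by rw [hr _ (by simp), h.one]
  bitsReg := by rw [hr _ (by simp), h.bitsReg]
  baseReg := by rw [hr _ (by simp), h.baseReg]
  tailReg := by rw [hr _ (by simp), h.tailReg]
  codeReg := by rw [hr _ (by simp), h.codeReg]
  powReg := by rw [hr _ (by simp), h.powReg]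

open Prog

/-- Enqueue the current code unless it has been visited. -/
def visit : Prog :=
  block [.add rX rCode rCode, .add rX rX rBase, .load rY rX,
    .cond rY .skip (block [.store rX rOne, .store rTail rCode, .add rTail rTail rOne,
      .add rTail rTail rOne])]

theorem visit_spec {l : List ℕ} {ps U c : ℕ} {Q : List ℕ} {s : State} (h : Env l ps U c Q s) :
    Tri visit s 12 (Env l ps U c (enqueue Q c)) := by
  refine Tri.of_eval rfl (by decide) ?_
  have hv : s.mem (c + c + (l.length + U)) = if c ∈ Q then 1 else 0 := by
    rw [← h.visited c]; congr 1; ring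
  set u := visit.eval s with hu
  have hr : ∀ r, r ≠ rX → r ≠ rY → r ≠ rTail → u.reg r = s.reg r := by
    intro r h1 h2 h3
    exact eval_reg_of_notMem_writes _ _ (by simp [visit, block, writes, h1, h2, h3])
  by_cases hc : c ∈ Q
  · have hm : u.mem = s.mem := by
      simp [hu, visit, block, eval, State.setReg_reg, h.codeReg, h.baseReg, hv, hc]
    have ht : u.reg rTail = s.reg rTail := by
      simp [hu, visit, block, eval, State.setReg_reg, h.codeReg, h.baseReg, hv, hc]
    rw [enqueue, if_pos hc]
    clear_value u
    refine h.congr hm fun r hr' => ?_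
    by_cases h1 : r = rTail
    · rw [h1, ht]
    · exact hr r (by omega) (by omega) h1
  · have hm : ∀ a, u.mem a = if a = l.length + U + 2 * Q.length + 1 then c else
        if a = c + c + (l.length + U) then 1 else s.mem a := by
      intro a
      simp [hu, visit, block, eval, State.setReg_reg, State.setMem_mem, h.codeReg, h.baseReg, hv,
        hc, h.tailReg, h.one]
    have ht : u.reg rTail = l.length + U + 2 * Q.length + 1 + 1 + 1 := by
      simp [hu, visit, block, eval, State.setReg_reg, h.codeReg, h.baseReg, hv, hc, h.one,
        h.tailReg]
    rw [enqueue, if_neg hc]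
    clear_value u
    exact
    { low := fun a ha => by rw [hm, if_neg (by omega), if_neg (by omega), h.low a ha]
      bits := fun a ha => by rw [hm, if_neg (by omega), if_neg (by omega), h.bits a ha]
      visited := fun d => by
        rw [hm, if_neg (by omega), h.visited d]
        by_cases hd : d = c
        · subst hd; rw [if_pos (by ring)]; simp
        · rw [if_neg (by omega)]; simp [hd]
      queue := fun j => by
        rw [hm, if_neg (by omega : ¬ _ = c + c + _), h.queue j]
        rcases lt_trichotomy j Q.length with hj | hj | hj
        · rw [if_neg (by omega), List.getD_append _ _ _ _ hj]
        · subst hj; simp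
        · rw [if_neg (by omega), List.getD_eq_default _ _ hj.le, List.getD_eq_default]
          simp; omega
      zero := by rw [hr _ (by simp) (by simp) (by simp), h.zero]
      one := by rw [hr _ (by simp) (by simp) (by simp), h.one]
      bitsReg := by rw [hr _ (by simp) (by simp) (by simp), h.bitsReg]
      baseReg := by rw [hr _ (by simp) (by simp) (by simp), h.baseReg]
      tailReg := by rw [ht]; simp; omega
      codeReg := by rw [hr _ (by simp) (by simp) (by simp), h.codeReg]
      powReg := by rw [hr _ (by simp) (by simp) (by simp), h.powReg] }

/-- Replace the element in register `f` by the element in register `t`, run `body`, and undo the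
replacement. -/
def swapAround (f t : ℕ) (body : Prog) : Prog :=
  block [.add rX rBits f, .load rY rX,
    .cond rY (block [
      block [.store rX rZero, .add rX rPow f, .load rX rX, .sub rCode rCode rX, .add rX rBits t,
        .load rY rX],
      .cond rY .skip (block [
        block [.store rX rOne, .add rX rPow t, .load rX rX, .add rCode rCode rX],
        body,
        block [.add rX rPow t, .load rX rX, .sub rCode rCode rX, .add rX rBits t,
          .store rX rZero]]),
      -- Undoing a replacement takes constant time, whereas decoding the code afresh for each rule
      -- would cost about `U` steps.
      block [.add rX rBits f, .store rX rOne, .add rX rPow f, .load rX rX,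
        .add rCode rCode rX]]) .skip]

/-- Carry out the rule in the given registers, enqueue the result, and undo the rule. -/
def visitRuleProg : List (ℕ × ℕ) → Prog
  | [] => visit
  | p :: l => swapAround p.1 p.2 (visitRuleProg l)

theorem writes_visitRuleProg (l : List (ℕ × ℕ)) :
    ∀ r ∈ (visitRuleProg l).writes, r = rX ∨ r = rY ∨ r = rCode ∨ r = rTail := by
  induction l with
  | nil => simp [visitRuleProg, visit, block, writes]
  | cons p l ih =>
    intro r
    simp only [visitRuleProg, swapAround, block, writes, List.append_nil, List.nil_append,
      List.mem_append, List.mem_cons, List.not_mem_nil, or_false]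
    have := ih r
    tauto

/-- No carry occurs because the digit `t` of `c` is `0`; the induction halves `c`. -/
theorem testBit_add_two_pow {c t : ℕ} (h : c.testBit t = false) (e : ℕ) :
    (c + 2 ^ t).testBit e = (c.testBit e || decide (e = t)) := by
  induction t generalizing c e with
  | zero =>
    simp only [Nat.testBit_zero, decide_eq_false_iff_not] at h
    cases e with
    | zero => simp [Nat.testBit_zero]; omega
    | succ e => rw [Nat.testBit_add_one, Nat.testBit_add_one, show (c + 2 ^ 0) / 2 = c / 2 by omega]; simp
  | succ t ih =>
    rw [Nat.testBit_add_one] at h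
    cases e with
    | zero => simp [Nat.testBit_zero, pow_succ, Nat.add_mod]
    | succ e =>
      rw [Nat.testBit_add_one, Nat.testBit_add_one, show (c + 2 ^ (t + 1)) / 2 = c / 2 + 2 ^ t by
        rw [pow_succ]; omega, ih h]
      simp

theorem add_two_pow_eq_xor {c t : ℕ} (h : c.testBit t = false) : c + 2 ^ t = c ^^^ 2 ^ t := by
  apply Nat.eq_of_testBit_eq
  intro i
  rw [testBit_add_two_pow h, Nat.testBit_xor, Nat.testBit_two_pow]
  by_cases hi : t = i
  · subst hi; simp [h]
  · simp [hi, Ne.symm hi]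

/-- Flipping the digit `f` and then adding `2 ^ f` gives `c` back, so the subtraction is an
exclusive or and borrows nothing. -/
theorem testBit_sub_two_pow {c f : ℕ} (h : c.testBit f) (e : ℕ) :
    (c - 2 ^ f).testBit e = (c.testBit e && decide (e ≠ f)) := by
  have h1 : (c ^^^ 2 ^ f).testBit f = false := by simp [Nat.testBit_xor, h]
  have h2 : c - 2 ^ f = c ^^^ 2 ^ f := by
    have := add_two_pow_eq_xor h1
    rw [Nat.xor_assoc, Nat.xor_self, Nat.xor_zero] at this
    omega
  rw [h2, Nat.testBit_xor, Nat.testBit_two_pow]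
  by_cases hi : f = e
  · subst hi; simp [h]
  · simp [hi, Ne.symm hi]

theorem two_pow_le_of_testBit {c f : ℕ} (h : c.testBit f) : 2 ^ f ≤ c := Nat.ge_two_pow_of_testBit h

/-- Clear the digit `f`. -/
theorem Env.clear {l : List ℕ} {ps U c f : ℕ} {Q : List ℕ} {s u : State} (h : Env l ps U c Q s)
    (hf : f < U) (hc : c.testBit f)
    (hm : ∀ a, u.mem a = if a = l.length + f then 0 else s.mem a)
    (hr : ∀ r, r ≠ rCode → r ≠ rX → r ≠ rY → u.reg r = s.reg r)
    (hcode : u.reg rCode = c - 2 ^ f) : Env l ps U (c - 2 ^ f) Q u where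
  low a ha := by rw [hm, if_neg (by omega), h.low a ha]
  bits e he := by
    rw [hm, testBit_sub_two_pow hc, h.bits e he]
    by_cases hef : e = f <;> simp [hef]
  visited d := by rw [hm, if_neg (by omega), h.visited]
  queue d := by rw [hm, if_neg (by omega), h.queue]
  zero := by rw [hr _ (by simp) (by simp) (by simp), h.zero]
  one := by rw [hr _ (by simp) (by simp) (by simp), h.one]
  bitsReg := by rw [hr _ (by simp) (by simp) (by simp), h.bitsReg]
  baseReg := by rw [hr _ (by simp) (by simp) (by simp), h.baseReg]
  tailReg := by rw [hr _ (by simp) (by simp) (by simp), h.tailReg]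
  codeReg := hcode
  powReg := by rw [hr _ (by simp) (by simp) (by simp), h.powReg]

/-- Set the digit `t`. -/
theorem Env.set {l : List ℕ} {ps U c t : ℕ} {Q : List ℕ} {s u : State} (h : Env l ps U c Q s)
    (hf : t < U) (hc : c.testBit t = false)
    (hm : ∀ a, u.mem a = if a = l.length + t then 1 else s.mem a)
    (hr : ∀ r, r ≠ rCode → r ≠ rX → r ≠ rY → u.reg r = s.reg r)
    (hcode : u.reg rCode = c + 2 ^ t) : Env l ps U (c + 2 ^ t) Q u where
  low a ha := by rw [hm, if_neg (by omega), h.low a ha]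
  bits e he := by
    rw [hm, testBit_add_two_pow hc, h.bits e he]
    by_cases hef : e = t <;> simp [hef]
  visited d := by rw [hm, if_neg (by omega), h.visited]
  queue d := by rw [hm, if_neg (by omega), h.queue]
  zero := by rw [hr _ (by simp) (by simp) (by simp), h.zero]
  one := by rw [hr _ (by simp) (by simp) (by simp), h.one]
  bitsReg := by rw [hr _ (by simp) (by simp) (by simp), h.bitsReg]
  baseReg := by rw [hr _ (by simp) (by simp) (by simp), h.baseReg]
  tailReg := by rw [hr _ (by simp) (by simp) (by simp), h.tailReg]
  codeReg := hcode
  powReg := by rw [hr _ (by simp) (by simp) (by simp), h.powReg]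

/-- The static memory contains the table of the powers of two. -/
def PowTable (l : List ℕ) (ps U : ℕ) : Prop :=
  ps + U ≤ l.length ∧ ∀ e < U, l.getD (ps + e) 0 = 2 ^ e

/-- Here `g d` is the queue that `body` leaves when run at the code `d`. The code `c` and its digits
are restored afterwards, so nested replacements compose and only the queue changes for good. The
condition `hw` protects the registers `f` and `t` from `body`. -/
theorem swapAround_spec {l : List ℕ} {ps U c f t fv tv T : ℕ} {Q : List ℕ} {s : State}
    {body : Prog} {g : ℕ → List ℕ}
    (hp : PowTable l ps U) (h : Env l ps U c Q s) (hf : 30 ≤ f) (ht : 30 ≤ t)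
    (hfv : s.reg f = fv) (htv : s.reg t = tv) (hfU : fv < U) (htU : tv < U)
    (hw : ∀ r ∈ body.writes, r = rX ∨ r = rY ∨ r = rCode ∨ r = rTail)
    (hbody : ∀ u d, Env l ps U d Q u → (∀ r, 30 ≤ r → u.reg r = s.reg r) →
      Tri body u T (Env l ps U d (g d))) :
    Tri (swapAround f t body) s (T + 40)
      (Env l ps U c (match swap fv tv c with | none => Q | some d => g d)) := by
  have pow : ∀ (u : State) (d e : ℕ) (Q' : List ℕ), Env l ps U d Q' u → e < U →
      u.mem (ps + e) = 2 ^ e := by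
    intro u d e Q' hu he
    rw [hu.low _ (by have := hp.1; omega), hp.2 e he]
  unfold swapAround
  rw [block, block]
  refine (Tri.seq (T₁ := 1) (T₂ := T + 38) (Tri.of_eval rfl (by simp [cost]) ?_)).mono
    (by omega) fun _ hu => hu
  refine (Tri.seq (T₁ := 1) (T₂ := T + 37) (Tri.of_eval rfl (by simp [cost]) ?_)).mono
    (by omega) fun _ hu => hu
  set s₁ := (Prog.load rY rX).eval ((Prog.add rX rBits f).eval s) with hs₁
  have hY : s₁.reg rY = if c.testBit fv then 1 else 0 := by
    simp [hs₁, eval, State.setReg_reg, h.bitsReg, hfv, h.bits fv hfU]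
  have hX : s₁.reg rX = l.length + fv := by
    simp [hs₁, eval, State.setReg_reg, h.bitsReg, hfv]
  have hr₁ : ∀ r, r ≠ rX → r ≠ rY → s₁.reg r = s.reg r := by
    intro r h1 h2
    simp [hs₁, eval, State.setReg_reg, h1, h2]
  have hm₁ : s₁.mem = s.mem := rfl
  have h₁ : Env l ps U c Q s₁ := h.congr hm₁ fun r hr => hr₁ r (by omega) (by omega)
  clear_value s₁
  refine (Tri.seq (T₁ := T + 36) (T₂ := 1) (Tri.weaken
    (Q := Env l ps U c (match swap fv tv c with | none => Q | some d => g d)) ?_ fun u hu =>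
      Tri.of_eval rfl le_rfl hu)).mono (by omega) fun _ hu => hu
  refine (Tri.cond (T := T + 35) ?_ ?_).mono (by omega) fun _ hu => hu
  swap
  · intro h0
    have hc : c.testBit fv = false := by
      rw [hY] at h0
      by_contra hne
      simp [hne] at h0
    refine Tri.of_eval rfl (by simp [cost]) ?_
    simpa [swap, hc, eval] using h₁
  intro h0
  have hc : c.testBit fv = true := by
    rw [hY] at h0
    by_contra hne
    simp [hne] at h0
  have hle := two_pow_le_of_testBit hc
  rw [block]
  refine (Tri.seq (T₁ := 7) (T₂ := T + 28) (Tri.of_eval rfl (by simp [block, cost]) ?_)).mono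
    (by omega) fun _ hu => hu
  set s₂ := (block _).eval s₁ with hs₂
  -- Powers and digits are read at the same offset from `ps` and `l.length`; this keeps the digit
  -- just written apart from the power loaded next.
  have hne : ps ≠ l.length := by have := hp.1; omega
  have hpw := pow s₁ c fv Q h₁ hfU
  have hC₂ : s₂.reg rCode = c - 2 ^ fv := by
    simp [hs₂, block, eval, State.setReg_reg, State.setMem_mem, h₁.codeReg, h₁.powReg,
      hr₁ f (by omega) (by omega), hfv, hX, hne, hpw, show f ≠ 17 by omega]
  have hm₂ : ∀ a, s₂.mem a = if a = l.length + fv then 0 else s₁.mem a := by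
    intro a
    simp [hs₂, block, eval, State.setReg_reg, State.setMem_mem, h₁.zero, hX]
  have hr₂ : ∀ r, r ≠ rCode → r ≠ rX → r ≠ rY → s₂.reg r = s₁.reg r := by
    intro r h1 h2 h3
    simp [hs₂, block, eval, State.setReg_reg, h1, h2, h3]
  have h₂ : Env l ps U (c - 2 ^ fv) Q s₂ := h₁.clear hfU hc hm₂ hr₂ hC₂
  have hX₂ : s₂.reg rX = l.length + tv := by
    simp [hs₂, block, eval, State.setReg_reg, h₁.bitsReg, hr₁ t (by omega) (by omega), htv,
      show t ≠ 17 by omega, show t ≠ 16 by omega]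
  have hY₂ : s₂.reg rY = if (c - 2 ^ fv).testBit tv then 1 else 0 := by
    rw [← h₂.bits tv htU, hm₂]
    simp [hs₂, block, eval, State.setReg_reg, State.setMem_mem, h₁.bitsReg,
      hr₁ t (by omega) (by omega), htv, show t ≠ 17 by omega, show t ≠ 16 by omega, h₁.zero, hX]
  clear_value s₂
  rw [block]
  refine (Tri.seq (T₁ := T + 21) (T₂ := 7) (Tri.weaken
    (Q := fun u => Env l ps U (c - 2 ^ fv)
        (match swap fv tv c with | none => Q | some d => g d) u ∧ u.reg f = fv) ?_
      ?_)).mono (by omega) fun _ hu => hu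
  swap
  · rintro u ⟨hu, huf⟩
    refine Tri.of_eval rfl (by simp [block, cost]) ?_
    have hpw' := pow u _ fv _ hu hfU
    have hres := hu.set (t := fv) (u := (block [block [.add rX rBits f, .store rX rOne,
        .add rX rPow f, .load rX rX, .add rCode rCode rX]]).eval u) hfU
        (by rw [testBit_sub_two_pow hc]; simp) ?_ ?_ ?_
    · rwa [Nat.sub_add_cancel hle] at hres
    · intro a
      simp [block, eval, State.setReg_reg, State.setMem_mem, hu.bitsReg, huf, hu.one]
    · intro r h1 h2 h3
      simp [block, eval, State.setReg_reg, h1, h2]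
    · simp [block, eval, State.setReg_reg, State.setMem_mem, hu.codeReg, hu.powReg,
        hu.bitsReg, huf, hne, hpw', show f ≠ 17 by omega]
  refine (Tri.cond (T := T + 20) ?_ ?_).mono (by omega) fun _ hu => hu
  · intro h0
    have hc2 : (c - 2 ^ fv).testBit tv = true := by
      rw [hY₂] at h0
      by_contra hne
      simp [hne] at h0
    refine Tri.of_eval rfl (by simp [cost]) ?_
    simp only [swap, hc, hc2, if_true, eval]
    exact ⟨h₂, by rw [hr₂ f (by omega) (by omega) (by omega), hr₁ f (by omega) (by omega), hfv]⟩
  intro h0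
  have hc2 : (c - 2 ^ fv).testBit tv = false := by
    rw [hY₂] at h0
    by_contra hne
    simp [hne] at h0
  have hsw : swap fv tv c = some (c - 2 ^ fv + 2 ^ tv) := by simp [swap, hc, hc2]
  rw [hsw, block]
  refine (Tri.seq (T₁ := 5) (T₂ := T + 15) (Tri.of_eval rfl (by simp [block, cost]) ?_)).mono
    (by omega) fun _ hu => hu
  set s₃ := (block _).eval s₂ with hs₃
  have htv₂ : s₂.reg t = tv := by
    rw [hr₂ t (by omega) (by omega) (by omega), hr₁ t (by omega) (by omega), htv]
  have hpw₂ := pow s₂ _ tv Q h₂ htU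
  have hr₃ : ∀ r, r ≠ rCode → r ≠ rX → r ≠ rY → s₃.reg r = s₂.reg r := by
    intro r h1 h2 h3
    simp [hs₃, block, eval, State.setReg_reg, h1, h2]
  have h₃ : Env l ps U (c - 2 ^ fv + 2 ^ tv) Q s₃ := by
    refine h₂.set htU hc2 ?_ hr₃ ?_
    · intro a
      simp [hs₃, block, eval, State.setReg_reg, State.setMem_mem, h₂.one, hX₂]
    · simp [hs₃, block, eval, State.setReg_reg, State.setMem_mem, h₂.codeReg, h₂.powReg,
        hX₂, htv₂, hne, hpw₂, show t ≠ 17 by omega]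
  have hreg₃ : ∀ r, 30 ≤ r → s₃.reg r = s.reg r := by
    intro r hr
    rw [hr₃ r (by omega) (by omega) (by omega), hr₂ r (by omega) (by omega) (by omega),
      hr₁ r (by omega) (by omega)]
  clear_value s₃
  rw [block]
  refine (Tri.seq (T₁ := T) (T₂ := 7) (Tri.weaken (hbody s₃ _ h₃ hreg₃).frame ?_)).mono
    (by omega) fun _ hu => hu
  rintro u ⟨hu, hfr⟩
  have hfr' : ∀ r, 30 ≤ r → u.reg r = s.reg r := by
    intro r hr
    rw [hfr r (fun hmem => by have := hw r hmem; omega), hreg₃ r hr]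
  refine Tri.of_eval rfl (by simp [block, cost]) ?_
  have hpw₃ := pow u _ tv _ hu htU
  have htu : u.reg t = tv := by rw [hfr' t ht, htv]
  have hres := hu.clear (f := tv) (u := (block [block [.add rX rPow t, .load rX rX,
      .sub rCode rCode rX, .add rX rBits t, .store rX rZero]]).eval u) htU
      (by rw [testBit_add_two_pow hc2]; simp) ?_ ?_ ?_
  · rw [Nat.add_sub_cancel] at hres
    refine ⟨hres, ?_⟩
    simp only [block, eval, State.setReg_reg, State.setMem_reg]
    simp [show f ≠ 17 by omega, show f ≠ 16 by omega, hfr' f hf, hfv]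
  · intro a
    simp [block, eval, State.setReg_reg, State.setMem_mem, hu.bitsReg, hu.zero, htu,
      show t ≠ 17 by omega, show t ≠ 16 by omega]
  · intro r h1 h2 h3
    simp [block, eval, State.setReg_reg, h1, h2]
  · simp [block, eval, State.setReg_reg, State.setMem_mem, hu.codeReg, hu.powReg, htu,
      hpw₃]

theorem visitRuleProg_spec {l : List ℕ} {ps U : ℕ} {Q : List ℕ} (hp : PowTable l ps U)
    (regs : List (ℕ × ℕ)) (hregs : ∀ p ∈ regs, 30 ≤ p.1 ∧ 30 ≤ p.2) (c : ℕ) (s : State)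
    (h : Env l ps U c Q s) (hU : ∀ p ∈ regs, s.reg p.1 < U ∧ s.reg p.2 < U) :
    Tri (visitRuleProg regs) s (40 * regs.length + 12)
      (Env l ps U c (visitRule (regs.map fun p => (s.reg p.1, s.reg p.2)) c Q)) := by
  induction regs generalizing c s with
  | nil => simpa [visitRuleProg, visitRule, Rule.apply] using visit_spec h
  | cons p regs ih =>
    have h1 := hregs p (by simp)
    have h2 := hU p (by simp)
    refine (swapAround_spec hp h h1.1 h1.2 rfl rfl h2.1 h2.2 (writes_visitRuleProg regs)
      (g := fun d => visitRule (regs.map fun p => (s.reg p.1, s.reg p.2)) d Q)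
      (T := 40 * regs.length + 12) ?_).mono (by simp; omega) ?_
    · intro u d hu hr
      have hmap : (regs.map fun p => (u.reg p.1, u.reg p.2)) =
          regs.map fun p => (s.reg p.1, s.reg p.2) := by
        apply List.map_congr_left
        intro q hq
        rw [hr _ (hregs q (by simp [hq])).1, hr _ (hregs q (by simp [hq])).2]
      rw [← hmap]
      refine ih (fun q hq => hregs q (by simp [hq])) d u hu fun q hq => ?_
      rw [hr _ (hregs q (by simp [hq])).1, hr _ (hregs q (by simp [hq])).2]
      exact hU q (by simp [hq])
    · intro u hu
      have : visitRule ((p :: regs).map fun p => (s.reg p.1, s.reg p.2)) c Q =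
          (match swap (s.reg p.1) (s.reg p.2) c with
            | none => Q
            | some d => visitRule (regs.map fun p => (s.reg p.1, s.reg p.2)) d Q) := by
        rw [visitRule, List.map_cons, Rule.apply]
        cases swap (s.reg p.1) (s.reg p.2) c <;> simp [visitRule]
      rw [this]
      exact hu

end RAM

namespace RAM

open Prog

/-! ### Reading consecutive cells -/

/-- Load consecutive cells into registers and advance the pointer. -/
def readInto (ptr : ℕ) : List ℕ → Prog
  | [] => .skip
  | r :: rs => .seq (.load r ptr) (.seq (.add ptr ptr rOne) (readInto ptr rs))

theorem readInto_loopFree (ptr : ℕ) (rs : List ℕ) : (readInto ptr rs).loopFree = true := by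
  induction rs with
  | nil => rfl
  | cons r rs ih => simpa [readInto, loopFree] using ih

theorem readInto_cost (ptr : ℕ) (rs : List ℕ) : (readInto ptr rs).cost = 2 * rs.length + 1 := by
  induction rs with
  | nil => rfl
  | cons r rs ih => simp [readInto, cost, ih]; ring

theorem readInto_writes (ptr : ℕ) (rs : List ℕ) {r : ℕ} (h : r ∈ (readInto ptr rs).writes) :
    r = ptr ∨ r ∈ rs := by
  induction rs with
  | nil => simp [readInto, writes] at h
  | cons q rs ih =>
    simp only [readInto, writes, List.mem_append, List.mem_singleton] at h
    rcases h with h | h | h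
    · simp [h]
    · exact Or.inl h
    · rcases ih h with h | h
      · exact Or.inl h
      · simp [h]

theorem readInto_eval (ptr : ℕ) (rs : List ℕ) (vs : List ℕ) (s : State) (hone : s.reg rOne = 1)
    (hptr : ptr ∉ rs) (hp1 : ptr ≠ rOne) (hr1 : rOne ∉ rs) (hnd : rs.Nodup)
    (hlen : rs.length = vs.length)
    (hv : ∀ i (h : i < vs.length), s.mem (s.reg ptr + i) = vs[i]) :
    ((readInto ptr rs).eval s).mem = s.mem ∧
      ((readInto ptr rs).eval s).reg ptr = s.reg ptr + rs.length ∧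
      rs.map ((readInto ptr rs).eval s).reg = vs := by
  induction rs generalizing vs s with
  | nil =>
    have : vs = [] := List.length_eq_zero_iff.mp hlen.symm
    simp [readInto, eval, this]
  | cons r rs ih =>
    cases vs with
    | nil => simp at hlen
    | cons v vs =>
      simp only [List.mem_cons, not_or] at hptr hr1
      simp only [List.nodup_cons] at hnd
      have hstep : ∀ x, ((Prog.add ptr ptr rOne).eval ((Prog.load r ptr).eval s)).reg x =
          if x = ptr then s.reg ptr + 1 else if x = r then v else s.reg x := by
        intro x
        have := hv 0 (by simp)
        simp only [Nat.add_zero, List.getElem_cons_zero] at this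
        simp [eval, State.setReg_reg, this, hptr.1, hr1.1, hone]
      obtain ⟨h1, h2, h3⟩ := ih vs ((Prog.add ptr ptr rOne).eval ((Prog.load r ptr).eval s))
        (by rw [hstep, if_neg (Ne.symm hp1), if_neg hr1.1, hone])
        hptr.2 hr1.2 hnd.2 (by simpa using hlen)
        (by
          intro i hi
          rw [hstep, if_pos rfl]
          have := hv (i + 1) (by simpa using hi)
          rw [List.getElem_cons_succ] at this
          rw [← this, show s.reg ptr + 1 + i = s.reg ptr + (i + 1) by ring]
          rfl)
      simp only [readInto, eval] at h1 h2 h3 ⊢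
      refine ⟨h1, ?_, ?_⟩
      · rw [h2]
        have := hstep ptr
        simp only [eval] at this
        rw [this, if_true, List.length_cons]; ring
      · rw [List.map_cons, h3]
        congr 1
        rw [eval_reg_of_notMem_writes]
        · have := hstep r
          simp only [eval] at this
          rw [this, if_neg (Ne.symm hptr.1), if_true]
        · intro hmem
          rcases readInto_writes _ _ hmem with h | h
          · exact hptr.1 h.symm
          · exact hnd.1 h

/-! ### Abstract search -/

theorem mem_enqueue {Q : List ℕ} {c d : ℕ} : d ∈ enqueue Q c ↔ d ∈ Q ∨ d = c := by
  unfold enqueue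
  split_ifs with h
  · constructor
    · exact Or.inl
    · rintro (h' | rfl)
      · exact h'
      · exact h
  · simp

theorem mem_visitRule {r : Rule} {c d : ℕ} {Q : List ℕ} :
    d ∈ visitRule r c Q ↔ d ∈ Q ∨ r.apply c = some d := by
  unfold visitRule
  cases r.apply c with
  | none => simp
  | some e => simp [mem_enqueue, eq_comm]

theorem mem_visitAll {rs : List Rule} {c d : ℕ} {Q : List ℕ} :
    d ∈ visitAll rs c Q ↔ d ∈ Q ∨ ∃ r ∈ rs, r.apply c = some d := by
  induction rs generalizing Q with
  | nil => simp [visitAll]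
  | cons r rs ih =>
    have := ih (Q := visitRule r c Q)
    simp only [visitAll, List.foldl_cons] at this ⊢
    rw [this, mem_visitRule]
    simp [or_assoc]

theorem nodup_visitAll {rs : List Rule} {c : ℕ} {Q : List ℕ} (h : Q.Nodup) :
    (visitAll rs c Q).Nodup := by
  induction rs generalizing Q with
  | nil => exact h
  | cons r rs ih =>
    refine ih (Q := visitRule r c Q) ?_
    unfold visitRule
    cases r.apply c with
    | none => exact h
    | some d =>
      simp only [enqueue]
      split_ifs with hd
      · exact h
      · exact List.nodup_append.mpr ⟨h, by simp, by simp; intro a ha e; exact hd (e ▸ ha)⟩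

theorem prefix_visitAll (rs : List Rule) (c : ℕ) (Q : List ℕ) : Q <+: visitAll rs c Q := by
  induction rs generalizing Q with
  | nil => exact List.prefix_rfl
  | cons r rs ih =>
    refine List.IsPrefix.trans ?_ (ih (visitRule r c Q))
    unfold visitRule
    cases r.apply c with
    | none => exact List.prefix_rfl
    | some d =>
      simp only [enqueue]
      split_ifs
      · exact List.prefix_rfl
      · exact List.prefix_append _ _

/-- Reachability by rules. -/
def RuleReach (rs : List Rule) (c₀ : ℕ) : ℕ → Prop :=
  Relation.ReflTransGen (fun c d => ∃ r ∈ rs, Rule.apply r c = some d) c₀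

/-! ### Decoding -/

/-- Compute the digits of the current code. -/
def decode : Prog :=
  block [.add rX rCode rZero, .add rE rU rZero, .loop rE (block [
    .sub rE rE rOne, .add rY rPow rE, .load rY rY, .add 25 rX rOne, .sub 25 25 rY,
    .add 26 rBits rE, .cond 25 (block [.store 26 rOne, .sub rX rX rY]) (.store 26 rZero)])]

theorem Core.congr {l : List ℕ} {ps U : ℕ} {Q : List ℕ} {s u : State} (h : Core l ps U Q s)
    (hm : ∀ a, (a < l.length ∨ l.length + U ≤ a) → u.mem a = s.mem a)
    (hr : ∀ r ≤ rTail, u.reg r = s.reg r) : Core l ps U Q u where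
  low a ha := by rw [hm _ (Or.inl ha), h.low a ha]
  visited d := by rw [hm _ (Or.inr (by omega)), h.visited]
  queue d := by rw [hm _ (Or.inr (by omega)), h.queue]
  zero := by rw [hr _ (by simp), h.zero]
  one := by rw [hr _ (by simp), h.one]
  bitsReg := by rw [hr _ (by simp), h.bitsReg]
  baseReg := by rw [hr _ (by simp), h.baseReg]
  tailReg := by rw [hr _ (by simp), h.tailReg]
  powReg := by rw [hr _ (by simp), h.powReg]

/-- This makes decoding possible without division: once the residue modulo `2 ^ (e + 1)` is known,
the digit is found by a comparison, and subtracting it leaves the residue modulo `2 ^ e`. -/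
theorem testBit_eq_of_mod (c e : ℕ) : c.testBit e = decide (2 ^ e ≤ c % 2 ^ (e + 1)) := by
  rw [Nat.testBit_eq_decide_div_mod_eq]
  congr 1
  rw [Nat.pow_succ, Nat.mod_mul]
  have h1 : c % 2 ^ e < 2 ^ e := Nat.mod_lt _ (by positivity)
  have h2 : c / 2 ^ e % 2 < 2 := Nat.mod_lt _ (by norm_num)
  apply propext
  constructor
  · intro h; rw [h]; omega
  · intro h
    by_contra hne
    have : c / 2 ^ e % 2 = 0 := by omega
    rw [this] at h; omega

theorem decode_spec {l : List ℕ} {ps U c : ℕ} {Q : List ℕ} {s : State} (hp : PowTable l ps U)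
    (h : Core l ps U Q s) (hc : s.reg rCode = c) (hU : s.reg rU = U) (hcU : c < 2 ^ U) :
    Tri decode s (U * 15 + 5) (Env l ps U c Q) := by
  unfold decode
  rw [block]
  refine (Tri.seq (T₁ := 1) (T₂ := U * 15 + 3) (Tri.of_eval rfl (by simp [cost]) ?_)).mono
    (by omega) fun _ hu => hu
  rw [block]
  refine (Tri.seq (T₁ := 1) (T₂ := U * 15 + 2) (Tri.of_eval rfl (by simp [cost]) ?_)).mono
    (by omega) fun _ hu => hu
  rw [block]
  refine (Tri.seq (T₁ := U * (14 + 1) + 1) (T₂ := 1) (Tri.weaken (Q := Env l ps U c Q) ?_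
    fun u hu => Tri.of_eval rfl le_rfl hu)).mono (by omega) fun _ hu => hu
  -- The digits are extracted from the top downwards, `rX` keeping the part of the code that is not
  -- yet decoded.
  refine Tri.loop_count (fun n u => Core l ps U Q u ∧ u.reg rCode = c ∧ u.reg rE = n ∧
    u.reg rX = c % 2 ^ n ∧ n ≤ U ∧
    ∀ e, n ≤ e → e < U → u.mem (l.length + e) = if c.testBit e then 1 else 0) ?_ ?_ U _ ?_
  · rintro n u ⟨hu, hcu, hE, hX, hn, hb⟩
    refine ⟨by omega, Tri.of_eval rfl (by decide) ?_⟩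
    have hpow : u.mem (ps + n) = 2 ^ n := by
      rw [hu.low _ (by have := hp.1; omega), hp.2 n (by omega)]
    have hbit := testBit_eq_of_mod c n
    have hmod : c % 2 ^ n = if c.testBit n then c % 2 ^ (n + 1) - 2 ^ n else c % 2 ^ (n + 1) := by
      have h1 : c % 2 ^ (n + 1) = c % 2 ^ n + 2 ^ n * (c / 2 ^ n % 2) := by
        rw [Nat.pow_succ, Nat.mod_mul]
      rw [Nat.testBit_eq_decide_div_mod_eq, h1]
      have h2 : c / 2 ^ n % 2 < 2 := Nat.mod_lt _ (by norm_num)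
      rcases (by omega : c / 2 ^ n % 2 = 0 ∨ c / 2 ^ n % 2 = 1) with h3 | h3 <;> simp [h3]
    set v := (block _).eval u with hv
    have hr : ∀ r ≤ rCode, v.reg r = u.reg r := fun r hr =>
      eval_reg_of_notMem_writes _ _ (by simp [block, writes]; omega)
    have hm : ∀ a, v.mem a = if a = l.length + n then (if c.testBit n then 1 else 0) else
        u.mem a := by
      intro a
      by_cases hcb : 2 ^ n ≤ c % 2 ^ (n + 1)
      · have h1 : c % 2 ^ (n + 1) + 1 - 2 ^ n ≠ 0 := by omega
        simp [hv, block, eval, State.setReg_reg, State.setMem_mem, hE, hu.one, hX, hu.powReg,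
          hpow, hu.bitsReg, h1, hbit, hcb]
      · have h1 : c % 2 ^ (n + 1) + 1 - 2 ^ n = 0 := by omega
        simp [hv, block, eval, State.setReg_reg, State.setMem_mem, hE, hu.one, hX, hu.powReg,
          hpow, hu.bitsReg, h1, hbit, hcb, hu.zero]
    have hE' : v.reg rE = n := by
      by_cases hcb : 2 ^ n ≤ c % 2 ^ (n + 1)
      · have h1 : c % 2 ^ (n + 1) + 1 - 2 ^ n ≠ 0 := by omega
        simp [hv, block, eval, State.setReg_reg, State.setMem_mem, hE, hu.one, hX, hu.powReg,
          hpow, hu.bitsReg, h1]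
      · have h1 : c % 2 ^ (n + 1) + 1 - 2 ^ n = 0 := by omega
        simp [hv, block, eval, State.setReg_reg, State.setMem_mem, hE, hu.one, hX, hu.powReg,
          hpow, hu.bitsReg, h1]
    have hX' : v.reg rX = c % 2 ^ n := by
      rw [hmod, hbit]
      by_cases hcb : 2 ^ n ≤ c % 2 ^ (n + 1)
      · have h1 : c % 2 ^ (n + 1) + 1 - 2 ^ n ≠ 0 := by omega
        simp [hv, block, eval, State.setReg_reg, State.setMem_mem, hE, hu.one, hX, hu.powReg,
          hpow, hu.bitsReg, h1, hcb]
      · have h1 : c % 2 ^ (n + 1) + 1 - 2 ^ n = 0 := by omega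
        simp [hv, block, eval, State.setReg_reg, State.setMem_mem, hE, hu.one, hX, hu.powReg,
          hpow, hu.bitsReg, h1, hcb]
    clear_value v
    refine ⟨hu.congr (fun a ha => ?_) fun r hr' => hr r (by omega), by rw [hr _ le_rfl, hcu], hE',
      hX', by omega, fun e h1 h2 => ?_⟩
    · rw [hm, if_neg (by omega)]
    · rw [hm]
      by_cases he : e = n
      · simp [he]
      · rw [if_neg (by omega), hb e (by omega) h2]
  · rintro u ⟨hu, hcu, hE, hX, hn, hb⟩
    exact ⟨hE, { hu with bits := fun e he => hb e (by omega) he, codeReg := hcu }⟩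
  · refine ⟨h.congr (fun _ _ => rfl) fun r hr => ?_, ?_, ?_, ?_, le_rfl, fun e h1 h2 => by omega⟩
    · exact (eval_reg_of_notMem_writes _ _ (by simp [writes]; omega)).trans
        (eval_reg_of_notMem_writes _ _ (by simp [writes]; omega))
    · simp [eval, State.setReg_reg, hc]
    · simp [eval, State.setReg_reg, hU, h.zero]
    · simp [eval, State.setReg_reg, hc, h.zero, Nat.mod_eq_of_lt hcU]

/-! ### Rules -/

/-- The memory representation of a rule. -/
def Rule.flat (r : Rule) : List ℕ := r.flatMap fun p => [p.1, p.2]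

/-- The rule consists of five replacements of numbers below `U`. -/
def Rule.Valid (U : ℕ) (r : Rule) : Prop := r.length = 5 ∧ ∀ p ∈ r, p.1 < U ∧ p.2 < U

theorem Rule.Valid.exists_eq {U : ℕ} {r : Rule} (h : r.Valid U) :
    ∃ p₁ p₂ p₃ p₄ p₅, r = [p₁, p₂, p₃, p₄, p₅] := by
  obtain ⟨h, -⟩ := h
  match r, h with
  | [p₁, p₂, p₃, p₄, p₅], _ => exact ⟨p₁, p₂, p₃, p₄, p₅, rfl⟩

theorem Rule.Valid.length_flat {U : ℕ} {r : Rule} (h : r.Valid U) : r.flat.length = 10 := by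
  obtain ⟨p₁, p₂, p₃, p₄, p₅, rfl⟩ := h.exists_eq
  rfl

/-- Apply all rules to the current code. -/
def applyRules : Prog :=
  block [.add rPtr rRules rZero, .sub rD rRulesEnd rPtr, .loop rD (block [
    readInto rPtr [30, 31, 32, 33, 34, 35, 36, 37, 38, 39],
    visitRuleProg [(30, 31), (32, 33), (34, 35), (36, 37), (38, 39)],
    .sub rD rRulesEnd rPtr])]

theorem Env.mem_eq {l pre mid post : List ℕ} {ps U c : ℕ} {Q : List ℕ} {s : State}
    (h : Env l ps U c Q s) (hl : l = pre ++ mid ++ post) (i : ℕ) (hi : i < mid.length) :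
    s.mem (pre.length + i) = mid[i] := by
  subst hl
  rw [h.low _ (by simp; omega)]
  rw [List.append_assoc, List.getD_append_right _ _ _ _ (by omega), Nat.add_sub_cancel_left,
    List.getD_append _ _ _ _ hi, List.getD_eq_getElem _ _ hi]

theorem applyRules_spec {l pre post : List ℕ} {ps U c : ℕ} {Q : List ℕ} {s : State}
    {rules : List Rule} (hp : PowTable l ps U) (h : Env l ps U c Q s)
    (hl : l = pre ++ rules.flatMap Rule.flat ++ post) (hrules : ∀ r ∈ rules, r.Valid U)
    (hr : s.reg rRules = pre.length)
    (hre : s.reg rRulesEnd = pre.length + (rules.flatMap Rule.flat).length) :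
    Tri applyRules s (rules.length * 250 + 5) (Env l ps U c (visitAll rules c Q)) := by
  unfold applyRules
  rw [block]
  refine (Tri.seq (T₁ := 1) (T₂ := rules.length * 250 + 3) (Tri.of_eval rfl (by simp [cost])
    ?_)).mono (by omega) fun _ hu => hu
  rw [block]
  refine (Tri.seq (T₁ := 1) (T₂ := rules.length * 250 + 2) (Tri.of_eval rfl (by simp [cost])
    ?_)).mono (by omega) fun _ hu => hu
  rw [block]
  refine (Tri.seq (T₁ := rules.length * (249 + 1) + 1) (T₂ := 1) (Tri.weaken
    (Q := Env l ps U c (visitAll rules c Q)) ?_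
    fun u hu => Tri.of_eval rfl le_rfl hu)).mono (by omega) fun _ hu => hu
  -- The rules already carried out have moved into `pre'`. The current queue is tracked only through
  -- what the remaining rules will make of it.
  refine Tri.loop_list (fun rest u => ∃ Q' pre', Env l ps U c Q' u ∧
    visitAll rest c Q' = visitAll rules c Q ∧ l = pre' ++ rest.flatMap Rule.flat ++ post ∧
    (∀ r ∈ rest, r.Valid U) ∧ u.reg rPtr = pre'.length ∧
    u.reg rRulesEnd = pre'.length + (rest.flatMap Rule.flat).length ∧
    u.reg rD = (rest.flatMap Rule.flat).length) ?_ ?_ rules _ ?_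
  · rintro r rest u ⟨Q', pre', hu, hQ, hl', hv, hptr, hend, hD⟩
    have hrv := hv r (by simp)
    have hlen := hrv.length_flat
    refine ⟨by rw [hD]; simp [hlen], ?_⟩
    rw [block]
    have hread := readInto_eval rPtr [30, 31, 32, 33, 34, 35, 36, 37, 38, 39] r.flat u hu.one
      (by simp) (by simp) (by simp) (by decide) (by rw [hlen]; rfl) (by
        intro i hi
        rw [hptr]
        exact hu.mem_eq (mid := r.flat) (post := rest.flatMap Rule.flat ++ post)
          (by rw [hl']; simp) i hi)
    obtain ⟨hm, hpt, hvals⟩ := hread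
    refine (Tri.seq (T₁ := 21) (T₂ := 220) (Tri.of_eval (readInto_loopFree _ _)
      (by rw [readInto_cost]; simp) ?_)).mono (by omega) fun _ hu => hu
    set v := (readInto rPtr [30, 31, 32, 33, 34, 35, 36, 37, 38, 39]).eval u with hvdef
    have hrv' : ∀ x ≤ rE, x ≠ rPtr → v.reg x = u.reg x := by
      intro x hx hx'
      refine eval_reg_of_notMem_writes _ _ fun hmem => ?_
      rcases readInto_writes _ _ hmem with h | h
      · exact hx' h
      · simp at h; omega
    clear_value v
    have henv : Env l ps U c Q' v := hu.congr hm fun x hx => hrv' x (by omega) (by omega)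
    obtain ⟨p₁, p₂, p₃, p₄, p₅, rfl⟩ := hrv.exists_eq
    simp only [Rule.flat, List.map_cons, List.map_nil, List.flatMap_cons, List.flatMap_nil,
      List.cons_append, List.nil_append, List.append_nil, List.cons.injEq, and_true] at hvals
    obtain ⟨e1, e2, e3, e4, e5, e6, e7, e8, e9, e10⟩ := hvals
    have hspec := visitRuleProg_spec hp [(30, 31), (32, 33), (34, 35), (36, 37), (38, 39)]
      (by simp) c v henv (by
        have := hrv.2
        simp only [List.mem_cons, List.not_mem_nil, or_false, forall_eq_or_imp, forall_eq] at this
        simp only [List.mem_cons, List.not_mem_nil, or_false, forall_eq_or_imp, forall_eq,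
          e1, e2, e3, e4, e5, e6, e7, e8, e9, e10]
        exact this)
    simp only [List.map_cons, List.map_nil, e1, e2, e3, e4, e5, e6, e7, e8, e9, e10] at hspec
    rw [block]
    refine (Tri.seq (T₁ := 212) (T₂ := 2) (Tri.mono hspec.frame (by simp) ?_)).mono
      (by omega) fun _ hu => hu
    rintro z ⟨hz, hfr⟩
    have hfr' : ∀ x ≤ rE, x ≠ rX → x ≠ rY → x ≠ rCode → x ≠ rTail → z.reg x = v.reg x := by
      intro x _ h1 h2 h3 h4
      refine hfr x fun hmem => ?_
      have := writes_visitRuleProg _ _ hmem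
      omega
    refine Tri.of_eval rfl (by simp [cost, block]) ?_
    refine ⟨_, pre' ++ Rule.flat [p₁, p₂, p₃, p₄, p₅], hz.congr rfl fun x hx => ?_, hQ, ?_,
      fun r hr => hv r (by simp [hr]), ?_, ?_, ?_⟩
    · exact eval_reg_of_notMem_writes _ _ (by simp [block, writes]; omega)
    · rw [hl']; simp
    · simp [block, eval, State.setReg_reg]
      rw [hfr' rPtr (by simp) (by simp) (by simp) (by simp) (by simp), hpt, hptr, hlen]; rfl
    · simp [block, eval, State.setReg_reg]
      rw [hfr' rRulesEnd (by simp) (by simp) (by simp) (by simp) (by simp),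
        hrv' _ (by simp) (by simp), hend]; simp; ring
    · simp [block, eval, State.setReg_reg]
      rw [hfr' rRulesEnd (by simp) (by simp) (by simp) (by simp) (by simp),
        hrv' _ (by simp) (by simp), hend,
        hfr' rPtr (by simp) (by simp) (by simp) (by simp) (by simp), hpt, hptr]
      simp only [List.flatMap_cons, List.length_append, hlen]
      simp
      omega
  · rintro u ⟨Q', pre', hu, hQ, hl', hv, hptr, hend, hD⟩
    exact ⟨by simpa using hD, by rw [← hQ]; exact hu⟩
  · refine ⟨Q, pre, h.congr rfl fun x hx => ?_, rfl, hl, hrules, ?_, ?_, ?_⟩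
    · exact (eval_reg_of_notMem_writes _ _ (by simp [writes]; omega)).trans
        (eval_reg_of_notMem_writes _ _ (by simp [writes]; omega))
    · simp [eval, State.setReg_reg, hr, h.zero]
    · simp [eval, State.setReg_reg, hre]
    · simp [eval, State.setReg_reg, hre, hr, h.zero]

/-! ### The search -/

/-- One round of the search: expand the first code of the queue. -/
def expand : Prog :=
  block [block [.load rCode rHead, .add rHead rHead rOne, .add rHead rHead rOne], decode,
    -- The digit `12` is the element of the mark `bad`.
    block [.const rX 12, .add rX rX rBits, .load rX rX, .add rBad rBad rX], applyRules,
    .sub rD rTail rHead]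

/-- Search from the code in `rCode`. -/
def search : Prog :=
  block [decode, visit, .sub rD rTail rHead, .loop rD expand]

theorem writes_decode : decode.writes = [rX, rE, rE, rY, rY, 25, 25, 26, rX] := by decide

/-- Needed because `decode` recovers only `U` digits. -/
theorem apply_lt {U : ℕ} {r : Rule} (h : ∀ p ∈ r, p.1 < U ∧ p.2 < U) {c d : ℕ}
    (hd : r.apply c = some d) (hc : c < 2 ^ U) : d < 2 ^ U := by
  induction r generalizing c with
  | nil => simp only [Rule.apply, Option.some.injEq] at hd; omega
  | cons p r ih =>
    simp only [Rule.apply, Option.bind_eq_some_iff] at hd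
    obtain ⟨e, he, hd⟩ := hd
    refine ih (fun q hq => h q (by simp [hq])) hd ?_
    unfold swap at he
    split_ifs at he with h1 h2
    simp only [Option.some.injEq] at he
    rw [← he]
    apply Nat.lt_pow_two_of_testBit
    intro i hi
    rw [testBit_add_two_pow (by simpa using h2), testBit_sub_two_pow h1,
      Nat.testBit_lt_two_pow (lt_of_lt_of_le hc (Nat.pow_le_pow_right (by norm_num) hi))]
    have := (h p (by simp)).2
    simp; omega

/-- The queue is never shortened, only its head advances. It is a list of distinct reachable codes
at all times, so `N` bounds its length and thereby the number of rounds. -/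
theorem search_spec {l pre post : List ℕ} {ps U c₀ N : ℕ} {s : State} {rules : List Rule}
    (hp : PowTable l ps U) (h : Core l ps U [] s)
    (hl : l = pre ++ rules.flatMap Rule.flat ++ post) (hrules : ∀ r ∈ rules, r.Valid U)
    (hr : s.reg rRules = pre.length)
    (hre : s.reg rRulesEnd = pre.length + (rules.flatMap Rule.flat).length)
    (hc : s.reg rCode = c₀) (hU : s.reg rU = U) (hc₀ : c₀ < 2 ^ U) (h12 : 12 < U)
    (hhead : s.reg rHead = l.length + U + 1) (hbad : s.reg rBad = 0)
    (hN : ∀ Q : List ℕ, Q.Nodup → (∀ c ∈ Q, RuleReach rules c₀ c) → Q.length ≤ N) :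
    Tri search s (N * (U * 15 + rules.length * 250 + 40) + U * 15 + 40) (fun u =>
      (u.reg rBad ≠ 0 ↔ ∃ c, RuleReach rules c₀ c ∧ c.testBit 12) ∧ u.reg rZero = 0 ∧
        u.reg rOne = 1) := by
  have hlt : ∀ c, RuleReach rules c₀ c → c < 2 ^ U := by
    intro c hc
    induction hc with
    | refl => exact hc₀
    | tail _ h ih =>
      obtain ⟨r, hr, h⟩ := h
      exact apply_lt (hrules r hr).2 h ih
  unfold search
  rw [block]
  refine (Tri.seq (T₁ := U * 15 + 5) (T₂ := N * (U * 15 + rules.length * 250 + 40) + 30)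
    (Tri.weaken (decode_spec hp h hc hU hc₀).frame ?_)).mono (by omega) fun _ hu => hu
  rintro s₁ ⟨h₁, hf₁⟩
  rw [writes_decode] at hf₁
  rw [block]
  refine (Tri.seq (T₁ := 12) (T₂ := N * (U * 15 + rules.length * 250 + 40) + 10)
    (Tri.weaken (visit_spec h₁).frame ?_)).mono (by omega) fun _ hu => hu
  rintro s₂ ⟨h₂, hf₂⟩
  rw [show visit.writes = [rX, rX, rY, rTail, rTail] by decide] at hf₂
  rw [block]
  refine (Tri.seq (T₁ := 1) (T₂ := N * (U * 15 + rules.length * 250 + 40) + 5)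
    (Tri.of_eval rfl (by simp [cost]) ?_)).mono (by omega) fun _ hu => hu
  rw [block]
  have hreg₂ : ∀ r, r ∉ [rX, rE, rY, 25, 26, rTail] →
      ((Prog.sub rD rTail rHead).eval s₂).reg r = if r = rD then s₂.reg rTail - s.reg rHead else
        s.reg r := by
    intro r hr
    simp at hr
    have e1 : s₂.reg rHead = s.reg rHead := by rw [hf₂ _ (by simp), hf₁ _ (by simp)]
    simp only [eval, State.setReg_reg, e1]
    split_ifs
    · rfl
    · rw [hf₂ _ (by simp; omega), hf₁ _ (by simp; omega)]
  refine (Tri.seq (T₁ := N * (U * 15 + rules.length * 250 + 40) + 1) (T₂ := 1)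
    (Tri.weaken (Q := fun u => (u.reg rBad ≠ 0 ↔ ∃ c, RuleReach rules c₀ c ∧ c.testBit 12) ∧
      u.reg rZero = 0 ∧ u.reg rOne = 1) ?_ fun u hu => Tri.of_eval rfl le_rfl hu)).mono (by omega) fun _ hu => hu
  -- The codes before position `hd` are expanded: their successors are queued, and `rBad` is nonzero
  -- exactly if one of them has digit `12`.
  refine Tri.loop (T := U * 15 + rules.length * 250 + 39) (fun n u => ∃ (hd c : ℕ) (Q : List ℕ), Env l ps U c Q u ∧ n + hd = N ∧
    hd ≤ Q.length ∧ Q.Nodup ∧ c₀ ∈ Q ∧ (∀ c ∈ Q, RuleReach rules c₀ c) ∧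
    (∀ j (hj : j < Q.length), j < hd → ∀ r ∈ rules, ∀ d, Rule.apply r Q[j] = some d → d ∈ Q) ∧
    (u.reg rBad ≠ 0 ↔ ∃ j, ∃ hj : j < Q.length, j < hd ∧ Q[j].testBit 12) ∧
    u.reg rHead = l.length + U + 2 * hd + 1 ∧ u.reg rD = 2 * Q.length - 2 * hd ∧
    u.reg rRules = pre.length ∧ u.reg rU = U ∧
    u.reg rRulesEnd = pre.length + (rules.flatMap Rule.flat).length) ?_ ?_ N _ ?_
  · rintro n u ⟨hd, c, Q, hu, hn, hle, hnd, hQ0, hQ, hcl, hb, hh, hD, hR, hUu, hRE⟩ h0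
    have hlt' : hd < Q.length := by omega
    have hNQ := hN Q hnd hQ
    have hcd : Q[hd] < 2 ^ U := hlt _ (hQ _ (List.getElem_mem _))
    unfold expand
    rw [block]
    refine (Tri.seq (T₁ := 4) (T₂ := U * 15 + rules.length * 250 + 34)
      (Tri.of_eval rfl (by simp [block, cost]) ?_)).mono (by omega) fun _ hu => hu
    set u₁ := (block _).eval u with hu₁
    have hfr₁ : ∀ r, r ≠ rCode → r ≠ rHead → u₁.reg r = u.reg r := fun r h1 h2 =>
      eval_reg_of_notMem_writes _ _ (by simp [block, writes, h1, h2])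
    have hcode₁ : u₁.reg rCode = Q[hd] := by
      simp [hu₁, block, eval, State.setReg_reg, hh, hu.queue, hlt']
    have hhead₁ : u₁.reg rHead = l.length + U + 2 * (hd + 1) + 1 := by
      simp [hu₁, block, eval, State.setReg_reg, hh, hu.one]; ring
    have hcore₁ : Core l ps U Q u₁ := hu.toCore.congr (fun _ _ => rfl) fun r hr =>
      hfr₁ r (by omega) (by omega)
    clear_value u₁
    rw [block]
    refine (Tri.seq (T₁ := U * 15 + 5) (T₂ := rules.length * 250 + 29)
      (Tri.weaken (decode_spec hp hcore₁ hcode₁ (by rw [hfr₁ _ (by simp) (by simp), hUu])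
        hcd).frame ?_)).mono (by omega) fun _ hu => hu
    rintro u₂ ⟨hu₂, hfr₂⟩
    rw [writes_decode] at hfr₂
    rw [block]
    refine (Tri.seq (T₁ := 5) (T₂ := rules.length * 250 + 20)
      (Tri.of_eval rfl (by simp [block, cost]) ?_)).mono (by omega) fun _ hu => hu
    set u₃ := (block _).eval u₂ with hu₃
    have hfr₃ : ∀ r, r ≠ rX → r ≠ rBad → u₃.reg r = u₂.reg r := fun r h1 h2 =>
      eval_reg_of_notMem_writes _ _ (by simp [block, writes, h1, h2])
    have hbad₃ : u₃.reg rBad = u.reg rBad + if Q[hd].testBit 12 then 1 else 0 := by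
      rw [← hu₂.bits 12 h12]
      simp [hu₃, block, eval, State.setReg_reg, hu₂.bitsReg]
      rw [hfr₂ _ (by simp), hfr₁ _ (by simp) (by simp), add_comm 12]
    have henv₃ : Env l ps U Q[hd] Q u₃ := hu₂.congr rfl fun r hr => hfr₃ r (by omega) (by omega)
    clear_value u₃
    have hall : ∀ r, r ∉ [rCode, rHead, rX, rE, rY, 25, 26, rBad] → u₃.reg r = u.reg r := by
      intro r hr
      simp at hr
      rw [hfr₃ _ (by omega) (by omega), hfr₂ _ (by simp; omega), hfr₁ _ (by omega) (by omega)]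
    rw [block]
    refine (Tri.seq (T₁ := rules.length * 250 + 5) (T₂ := 10)
      (Tri.weaken (applyRules_spec hp henv₃ hl hrules (by rw [hall _ (by simp), hR])
        (by rw [hall _ (by simp), hRE])).frame ?_)).mono (by omega) fun _ hu => hu
    rintro u₄ ⟨hu₄, hfr₄⟩
    have hfr₄' : ∀ r, r ∈ [rHead, rBad, rRules, rRulesEnd, rU] → u₄.reg r = u₃.reg r := by
      intro r hr
      simp at hr
      refine hfr₄ r ?_
      rcases hr with rfl | rfl | rfl | rfl | rfl <;> decide
    refine Tri.of_eval rfl (by simp [block, cost]) ?_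
    obtain ⟨Q', hQ'⟩ := prefix_visitAll rules Q[hd] Q
    have hlenQ : (visitAll rules Q[hd] Q).length = Q.length + Q'.length := by rw [← hQ']; simp
    have hget : ∀ j (hj : j < Q.length), (visitAll rules Q[hd] Q)[j]'(by omega) = Q[j] := by
      intro j hj
      simp only [← hQ']
      rw [List.getElem_append_left hj]
    have hhead₄ : u₄.reg rHead = l.length + U + 2 * (hd + 1) + 1 := by
      rw [hfr₄' _ (by simp), hfr₃ _ (by simp) (by simp), hfr₂ _ (by simp), hhead₁]
    refine ⟨n - 1, by omega, hd + 1, Q[hd], visitAll rules Q[hd] Q, hu₄.congr rfl fun r hr => ?_,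
      by omega, by omega, nodup_visitAll hnd, mem_visitAll.mpr (Or.inl hQ0), ?_, ?_, ?_, ?_, ?_,
      ?_, ?_, ?_⟩
    · exact eval_reg_of_notMem_writes _ _ (by simp [block, writes]; omega)
    · intro d hd'
      rcases mem_visitAll.mp hd' with h | ⟨r, hr, h⟩
      · exact hQ d h
      · exact (hQ _ (List.getElem_mem _)).tail ⟨r, hr, h⟩
    · intro j hj hjd r hr d hd'
      have hjQ : j < Q.length := by omega
      rw [hget j hjQ] at hd'
      rcases Nat.lt_succ_iff_lt_or_eq.mp hjd with hj' | rfl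
      · exact mem_visitAll.mpr (Or.inl (hcl j hjQ hj' r hr d hd'))
      · exact mem_visitAll.mpr (Or.inr ⟨r, hr, hd'⟩)
    · simp only [block, eval, State.setReg_reg]
      rw [if_neg (by simp), hfr₄' _ (by simp), hbad₃]
      constructor
      · intro hne
        by_cases hbit : Q[hd].testBit 12
        · exact ⟨hd, by omega, by omega, by rw [hget hd hlt']; exact hbit⟩
        · rw [if_neg hbit] at hne
          obtain ⟨j, hj, hjd, hbj⟩ := hb.mp hne
          exact ⟨j, by omega, by omega, by rw [hget j hj]; exact hbj⟩
      · rintro ⟨j, hj, hjd, hbj⟩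
        rw [hget j (by omega)] at hbj
        rcases Nat.lt_succ_iff_lt_or_eq.mp hjd with hj' | rfl
        · have := hb.mpr ⟨j, by omega, hj', hbj⟩
          omega
        · rw [if_pos hbj]; omega
    · simp only [block, eval, State.setReg_reg]
      rw [if_neg (by simp), hhead₄]
    · simp only [block, eval, State.setReg_reg]
      rw [if_true, hhead₄, hu₄.tailReg]; omega
    · simp only [block, eval, State.setReg_reg]
      rw [if_neg (by simp), hfr₄' _ (by simp), hall _ (by simp), hR]
    · simp only [block, eval, State.setReg_reg]
      rw [if_neg (by simp), hfr₄' _ (by simp), hall _ (by simp), hUu]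
    · simp only [block, eval, State.setReg_reg]
      rw [if_neg (by simp), hfr₄' _ (by simp), hall _ (by simp), hRE]
  · rintro n u ⟨hd, c, Q, hu, hn, hle, hnd, hQ0, hQ, hcl, hb, hh, hD, hR, hUu, hRE⟩ h0
    have hdl : hd = Q.length := by omega
    refine ⟨?_, hu.zero, hu.one⟩
    rw [hb]
    constructor
    · rintro ⟨j, hj, -, hbj⟩
      exact ⟨_, hQ _ (List.getElem_mem hj), hbj⟩
    · rintro ⟨c, hc, hbc⟩
      -- All of the queue is expanded by now, so it is closed under the rules and contains every
      -- reachable code.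
      have hcQ : c ∈ Q := by
        clear hbc
        induction hc with
        | refl => exact hQ0
        | tail _ h ih =>
          obtain ⟨r, hr, h⟩ := h
          obtain ⟨j, hj, rfl⟩ := List.getElem_of_mem ih
          exact hcl j hj (by omega) r hr _ h
      obtain ⟨j, hj, rfl⟩ := List.getElem_of_mem hcQ
      exact ⟨j, hj, by omega, hbc⟩
  · have hQ1 : enqueue [] c₀ = [c₀] := by simp [enqueue]
    rw [hQ1] at h₂
    refine ⟨0, c₀, [c₀], h₂.congr rfl fun r hr => ?_, rfl, by simp, by simp, by simp, ?_, ?_, ?_,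
      ?_, ?_, ?_, ?_, ?_⟩
    · exact eval_reg_of_notMem_writes _ _ (by simp [writes]; omega)
    · intro c hc
      rw [List.mem_singleton] at hc
      rw [hc]; exact Relation.ReflTransGen.refl
    · intro j _ hj; omega
    · rw [hreg₂ _ (by simp), if_neg (by simp), hbad]; simp
    · rw [hreg₂ _ (by simp), if_neg (by simp), hhead]
    · rw [hreg₂ _ (by simp), if_pos rfl, h₂.tailReg, hhead]; simp
    · rw [hreg₂ _ (by simp), if_neg (by simp), hr]
    · rw [hreg₂ _ (by simp), if_neg (by simp), hU]
    · rw [hreg₂ _ (by simp), if_neg (by simp), hre]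

end RAM

namespace RAM

open Prog

notation "rRecs" => 3
notation "rIn" => 5
notation "rOff" => 6
notation "rProc" => 7
notation "rCnt" => 8
notation "rCnt'" => 9
notation "rProcs" => 27
notation "rMsgs" => 28
notation "rRecsEnd" => 29

/-! ### Appending to the memory, and computing elements -/

/-- The memory holds the word `l`, and the next free cell and the constants are at hand. -/
structure Word (l : List ℕ) (s : State) : Prop where
  holds : s.Holds l
  top : s.reg rTop = l.length
  zero : s.reg rZero = 0
  one : s.reg rOne = 1

theorem Word.congr {l : List ℕ} {s u : State} (h : Word l s) (hm : u.mem = s.mem)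
    (hr : ∀ r ≤ rTop, u.reg r = s.reg r) : Word l u :=
  ⟨h.holds.congr hm, by rw [hr _ le_rfl, h.top], by rw [hr _ (by simp), h.zero],
    by rw [hr _ (by simp), h.one]⟩

/-- Append the contents of registers to the memory. -/
def pushAll : List ℕ → Prog
  | [] => .skip
  | r :: rs => .seq (.store rTop r) (.seq (.add rTop rTop rOne) (pushAll rs))

theorem pushAll_loopFree (rs : List ℕ) : (pushAll rs).loopFree = true := by
  induction rs with
  | nil => rfl
  | cons r rs ih => simpa [pushAll, loopFree] using ih

theorem pushAll_cost (rs : List ℕ) : (pushAll rs).cost = 2 * rs.length + 1 := by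
  induction rs with
  | nil => rfl
  | cons r rs ih => simp [pushAll, cost, ih]; ring

theorem pushAll_writes (rs : List ℕ) : ∀ r ∈ (pushAll rs).writes, r = rTop := by
  induction rs with
  | nil => simp [pushAll, writes]
  | cons q rs ih =>
    intro r h
    simp only [pushAll, writes, List.mem_append, List.mem_singleton, List.not_mem_nil,
      false_or] at h
    rcases h with h | h
    · exact h
    · exact ih r h

theorem pushAll_word {l : List ℕ} {s : State} (rs : List ℕ) (h : Word l s) (hr : rTop ∉ rs) :
    Word (l ++ rs.map s.reg) ((pushAll rs).eval s) := by
  induction rs generalizing l s with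
  | nil => simpa [pushAll, eval] using h
  | cons r rs ih =>
    simp only [List.mem_cons, not_or] at hr
    have h1 : Word (l ++ [s.reg r])
        ((Prog.add rTop rTop rOne).eval ((Prog.store rTop r).eval s)) := by
      refine ⟨h.holds.push (x := s.reg r) fun a => ?_, ?_, ?_, ?_⟩
      · simp [eval, State.setMem_mem, h.top]
      · simp [eval, State.setReg_reg, h.top, h.one]
      · simp [eval, State.setReg_reg, h.zero]
      · simp [eval, State.setReg_reg, h.one]
    have h2 := ih h1 hr.2
    simp only [pushAll, eval, List.map_cons] at h2 ⊢
    rw [List.append_assoc, List.singleton_append] at h2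
    convert h2 using 3
    apply List.map_congr_left
    intro x hx
    simp only [State.setReg_reg, State.setMem_reg]
    rw [if_neg]
    rintro rfl
    exact hr.2 hx

theorem pushAll_spec {l : List ℕ} {s : State} (rs : List ℕ) (h : Word l s) (hr : rTop ∉ rs) :
    Tri (pushAll rs) s (2 * rs.length + 1)
      (fun u => Word (l ++ rs.map s.reg) u ∧ ∀ r, r ≠ rTop → u.reg r = s.reg r) :=
  Tri.of_eval (pushAll_loopFree rs) (pushAll_cost rs).le ⟨pushAll_word rs h hr, fun _ hne =>
    eval_reg_of_notMem_writes _ _ fun hmem => hne (pushAll_writes rs _ hmem)⟩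

theorem readInto_spec {l pre vs post : List ℕ} {s : State} (h : Word l s) (ptr : ℕ) (rs : List ℕ)
    (hl : l = pre ++ vs ++ post) (hp : s.reg ptr = pre.length) (hptr : rTop < ptr)
    (hrs : ∀ r ∈ rs, rTop < r ∧ r ≠ ptr) (hnd : rs.Nodup) (hlen : rs.length = vs.length) :
    Tri (readInto ptr rs) s (2 * rs.length + 1) (fun u => Word l u ∧
      u.reg ptr = (pre ++ vs).length ∧ rs.map u.reg = vs ∧
      ∀ r, r ∉ ptr :: rs → u.reg r = s.reg r) := by
  have hfr : ∀ r, r ∉ ptr :: rs → ((readInto ptr rs).eval s).reg r = s.reg r := fun r hr =>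
    eval_reg_of_notMem_writes _ _ fun hmem => hr (by simpa using readInto_writes ptr rs hmem)
  obtain ⟨h1, h2, h3⟩ := readInto_eval ptr rs vs s h.one (fun hm => (hrs _ hm).2 rfl)
    (by omega) (fun hm => by have := (hrs _ hm).1; omega) hnd hlen (by
      intro i hi
      rw [hp, h.holds, hl, List.append_assoc, List.getD_append_right _ _ _ _ (by omega),
        Nat.add_sub_cancel_left, List.getD_append _ _ _ _ hi, List.getD_eq_getElem _ _ hi])
  refine Tri.of_eval (readInto_loopFree _ _) (readInto_cost _ _).le
    ⟨h.congr h1 fun r hr => hfr r ?_, by rw [h2, hp, hlen, List.length_append], h3, hfr⟩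
  simp only [List.mem_cons, not_or]
  exact ⟨by omega, fun hm => by have := (hrs _ hm).1; omega⟩

/-- For each triple `(r, z, g)`, assign `16 z + g` to `r`. -/
def elems : List (ℕ × ℕ × ℕ) → Prog
  | [] => .skip
  -- Four doublings give the factor `16`, for lack of a multiplication.
  | (r, z, g) :: es => .seq (block [.add r z z, .add r r r, .add r r r, .add r r r, .const rX g,
      .add r r rX]) (elems es)

theorem elems_loopFree (es : List (ℕ × ℕ × ℕ)) : (elems es).loopFree = true := by
  induction es with
  | nil => rfl
  | cons e es ih => simpa [elems, loopFree, block] using ih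

theorem elems_cost (es : List (ℕ × ℕ × ℕ)) : (elems es).cost = 7 * es.length + 1 := by
  induction es with
  | nil => rfl
  | cons e es ih => simp [elems, cost, block, ih]; ring

theorem elems_mem (es : List (ℕ × ℕ × ℕ)) (s : State) : ((elems es).eval s).mem = s.mem := by
  induction es generalizing s with
  | nil => rfl
  | cons e es ih => simp [elems, eval, block, ih]

theorem elems_writes (es : List (ℕ × ℕ × ℕ)) :
    ∀ r ∈ (elems es).writes, r = rX ∨ r ∈ es.map Prod.fst := by
  induction es with
  | nil => simp [elems, writes]
  | cons e es ih =>
    intro r h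
    have := ih r
    simp [elems, writes, block] at h this ⊢
    tauto

theorem elems_eval (es : List (ℕ × ℕ × ℕ)) (s : State) (hnd : (es.map Prod.fst).Nodup)
    (hd : ∀ e ∈ es, e.1 ≠ rX ∧ e.2.1 ≠ rX ∧ e.2.1 ∉ es.map Prod.fst) :
    ∀ e ∈ es, ((elems es).eval s).reg e.1 = 16 * s.reg e.2.1 + e.2.2 := by
  induction es generalizing s with
  | nil => simp
  | cons a es ih =>
    obtain ⟨r, z, g⟩ := a
    have h0 := hd (r, z, g) (by simp)
    simp only [List.map_cons, List.nodup_cons] at hnd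
    intro e he
    rw [List.mem_cons] at he
    simp only [elems, eval]
    rcases he with rfl | he
    · rw [eval_reg_of_notMem_writes _ _ (fun hm => ?_)]
      · simp [block, eval, State.setReg_reg, h0.1]
        ring
      · rcases elems_writes es _ hm with h | h
        · exact h0.1 h
        · exact hnd.1 h
    · rw [ih _ hnd.2 (fun e' he' => ?_) e he]
      · have h1 := hd e (by simp [he])
        rw [eval_reg_of_notMem_writes _ _ (fun hm => ?_)]
        have h2 : e.2.1 ≠ r := fun h => h1.2.2 (by simp [h])
        have h3 := h1.2.1
        simp [block, writes] at hm
        tauto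
      · have h1 := hd e' (by simp [he'])
        refine ⟨h1.1, h1.2.1, fun hm => h1.2.2 ?_⟩
        rw [List.map_cons]
        exact List.mem_cons_of_mem _ hm

theorem elems_spec {l : List ℕ} {s : State} (h : Word l s) (es : List (ℕ × ℕ × ℕ))
    (hnd : (es.map Prod.fst).Nodup)
    (hd : ∀ e ∈ es, rTop < e.1 ∧ e.1 ≠ rX ∧ e.2.1 ≠ rX ∧ e.2.1 ∉ es.map Prod.fst) :
    Tri (elems es) s (7 * es.length + 1) (fun u => Word l u ∧
      (∀ e ∈ es, u.reg e.1 = 16 * s.reg e.2.1 + e.2.2) ∧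
      ∀ r, r ≠ rX → r ∉ es.map Prod.fst → u.reg r = s.reg r) := by
  have hfr : ∀ r, r ≠ rX → r ∉ es.map Prod.fst → ((elems es).eval s).reg r = s.reg r :=
    fun r h1 h2 => eval_reg_of_notMem_writes _ _ fun hm => by
      rcases elems_writes es _ hm with h | h
      · exact h1 h
      · exact h2 h
  refine Tri.of_eval (elems_loopFree es) (elems_cost es).le ⟨h.congr (elems_mem es s) fun r hr =>
    hfr r (by omega) fun hm => ?_, elems_eval es s hnd fun e he => (hd e he).2, hfr⟩
  obtain ⟨e, he, rfl⟩ := List.mem_map.mp hm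
  have := (hd e he).1
  omega

/-! ### Parsing the input -/

/-- The data of an automaton that are listed in the input. -/
structure AutData where
  numStates : ℕ
  init : ℕ
  msgs : List ℕ
  bufs : List ℕ
  acts : List (ℕ × ℕ × ℕ)
  trans : List (ℕ × ℕ × ℕ × ℕ × ℕ)

/-- The code of an automaton. -/
def AutData.code (D : AutData) : List ℕ :=
  [D.numStates, D.init, D.msgs.length] ++ D.msgs ++ [D.bufs.length] ++ D.bufs
    ++ [D.acts.length] ++ D.acts.flatMap (fun a => [a.1, a.2.1, a.2.2])
    ++ [D.trans.length] ++ D.trans.flatMap (fun t => [t.1, t.2.1, t.2.2.1, t.2.2.2.1, t.2.2.2.2])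

/-- A transition `(src, buf, msg, tgt)` of a process. The kind is `0` for sends, `1` for receives;
records of kind `2` mark initial states. States are numbered consecutively over all processes. -/
structure Rec where
  kind : ℕ
  proc : ℕ
  src : ℕ
  buf : ℕ
  msg : ℕ
  tgt : ℕ

/-- The memory representation of a record. -/
def Rec.flat (t : Rec) : List ℕ := [t.kind, t.proc, t.src, t.buf, t.msg, t.tgt]

/-- The records of an automaton. -/
def AutData.recs (D : AutData) (p off : ℕ) : List Rec :=
  ⟨2, p, off + D.init, 0, 0, 0⟩ ::
    D.trans.map fun t => ⟨t.2.2.1, p, off + t.1, t.2.1, t.2.2.2.1, off + t.2.2.2.2⟩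

/-- The records of a list of automata. -/
def recsFrom : ℕ → ℕ → List AutData → List Rec
  | _, _, [] => []
  | p, off, D :: ds => D.recs p off ++ recsFrom (p + 1) (off + D.numStates) ds

/-- Parse the transitions of an automaton. -/
def parseTrans : Prog :=
  .loop rCnt' (block [readInto rIn [34, 35, 36, 37, 38],
    block [.add 34 rOff 34, .add 38 rOff 38], pushAll [36, rProc, 34, 35, 37, 38],
    .sub rCnt' rCnt' rOne])

/-- Parse an automaton. -/
def parseAut : Prog :=
  -- Only states and transitions matter. The lists of messages, buffers and actions are jumped over
  -- in constant time, an action taking three cells, so their lengths do not enter the running time.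
  block [readInto rIn [30, 31, 32], .add rIn rIn 32, readInto rIn [32], .add rIn rIn 32,
    readInto rIn [32], block [.add rIn rIn 32, .add rIn rIn 32, .add rIn rIn 32],
    readInto rIn [rCnt'], block [.const 33 2, .add 31 rOff 31],
    pushAll [33, rProc, 31, rZero, rZero, rZero], parseTrans,
    block [.add rOff rOff 30, .add rProc rProc rOne, .sub rCnt rCnt rOne]]

/-- The parser reads in the middle of the memory and writes at its end. In the invariant `pre'` is
what has been read, and `post'` is what lies behind the unread part, including the records written
so far. -/
theorem parseTrans_spec {pre post : List ℕ} {s : State} {p off : ℕ}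
    (ts : List (ℕ × ℕ × ℕ × ℕ × ℕ))
    (h : Word (pre ++ ts.flatMap (fun t => [t.1, t.2.1, t.2.2.1, t.2.2.2.1, t.2.2.2.2]) ++ post) s)
    (hin : s.reg rIn = pre.length) (hp : s.reg rProc = p) (hoff : s.reg rOff = off)
    (hcnt : s.reg rCnt' = ts.length) :
    Tri parseTrans s (ts.length * 31 + 1) (fun u => Word (pre ++ ts.flatMap (fun t => [t.1, t.2.1,
        t.2.2.1, t.2.2.2.1, t.2.2.2.2]) ++ post ++ (ts.map fun t =>
          (⟨t.2.2.1, p, off + t.1, t.2.1, t.2.2.2.1, off + t.2.2.2.2⟩ : Rec)).flatMap Rec.flat) u ∧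
      u.reg rIn = (pre ++ ts.flatMap (fun t => [t.1, t.2.1,
        t.2.2.1, t.2.2.2.1, t.2.2.2.2])).length ∧
      ∀ r, r ∉ [rTop, rIn, rCnt', 34, 35, 36, 37, 38] → u.reg r = s.reg r) := by
  refine Tri.loop_list (T := 30) (fun rest u => ∃ pre' post',
    Word (pre' ++ rest.flatMap (fun t => [t.1, t.2.1, t.2.2.1, t.2.2.2.1, t.2.2.2.2]) ++ post') u ∧
    u.reg rIn = pre'.length ∧ u.reg rCnt' = rest.length ∧
    (∀ r, r ∉ [rTop, rIn, rCnt', 34, 35, 36, 37, 38] → u.reg r = s.reg r) ∧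
    pre' ++ rest.flatMap (fun t => [t.1, t.2.1, t.2.2.1, t.2.2.2.1, t.2.2.2.2]) = pre ++
      ts.flatMap (fun t => [t.1, t.2.1, t.2.2.1, t.2.2.2.1, t.2.2.2.2]) ∧
    post' ++ (rest.map fun t =>
          (⟨t.2.2.1, p, off + t.1, t.2.1, t.2.2.2.1, off + t.2.2.2.2⟩ : Rec)).flatMap Rec.flat =
    post ++ (ts.map fun t =>
      (⟨t.2.2.1, p, off + t.1, t.2.1, t.2.2.2.1, off + t.2.2.2.2⟩ : Rec)).flatMap Rec.flat)
    ?_ ?_ ts s ?_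
  · rintro ⟨a, x, d, y, z⟩ rest u ⟨pre', post', hw, hi, hc, hfr, he1, he2⟩
    refine ⟨by rw [hc]; simp, ?_⟩
    rw [block]
    refine (Tri.seq (T₁ := 11) (T₂ := 19) (Tri.mono (readInto_spec hw rIn [34, 35, 36, 37, 38]
      (pre := pre') (vs := [a, x, d, y, z]) (post := rest.flatMap (fun t => [t.1, t.2.1, t.2.2.1,
        t.2.2.2.1, t.2.2.2.2]) ++ post') (by simp) hi (by simp) (by simp) (by simp) (by simp))
      (by simp) ?_)).mono (by omega) fun _ hu => hu
    rintro u₁ ⟨hw₁, hi₁, hv₁, hf₁⟩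
    simp only [List.map_cons, List.map_nil, List.cons.injEq, and_true] at hv₁
    obtain ⟨v1, v2, v3, v4, v5⟩ := hv₁
    rw [block]
    refine (Tri.seq (T₁ := 3) (T₂ := 16) (Tri.of_eval rfl (by simp [block, cost]) ?_)).mono
      (by omega) fun _ hu => hu
    set u₂ := (block _).eval u₁ with hu₂
    have hf₂ : ∀ r, r ∉ [34, 38] → u₂.reg r = u₁.reg r := fun r hr =>
      eval_reg_of_notMem_writes _ _ (by simpa [block, writes] using hr)
    have w1 : u₂.reg 34 = off + a := by
      simp [hu₂, block, eval, State.setReg_reg, v1, hf₁, hfr, hoff]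
    have w5 : u₂.reg 38 = off + z := by
      simp [hu₂, block, eval, State.setReg_reg, v5, hf₁, hfr, hoff]
    have hw₂ := hw₁.congr (u := u₂) rfl fun r hr => hf₂ r (by simp; omega)
    clear_value u₂
    rw [block]
    refine (Tri.seq (T₁ := 13) (T₂ := 2) (Tri.mono (pushAll_spec [36, rProc, 34, 35, 37, 38] hw₂
      (by simp)) (by simp) ?_)).mono (by omega) fun _ hu => hu
    rintro u₃ ⟨hw₃, hf₃⟩
    refine Tri.of_eval rfl (by simp [block, cost]) ?_
    have hf₄ : ∀ r, r ≠ rCnt' → ((block [Prog.sub rCnt' rCnt' rOne]).eval u₃).reg r = u₃.reg r :=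
      fun r hr => eval_reg_of_notMem_writes _ _ (by simpa [block, writes] using hr)
    have hp' : u₂.reg rProc = p := by
      rw [hf₂ _ (by simp), hf₁ _ (by simp), hfr _ (by simp), hp]
    refine ⟨pre' ++ [a, x, d, y, z],
      post' ++ Rec.flat ⟨d, p, off + a, x, y, off + z⟩, ?_, ?_, ?_, ?_, ?_, ?_⟩
    · refine Word.congr (s := u₃) ?_ rfl fun r hr => hf₄ r (by omega)
      convert hw₃ using 1
      simp [Rec.flat, w1, w5, hp', hf₂, v2, v3, v4]
    · rw [hf₄ _ (by simp), hf₃ _ (by simp), hf₂ _ (by simp), hi₁]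
    · simp only [block, eval, State.setReg_reg, if_true]
      rw [hf₃ _ (by simp), hf₃ _ (by simp), hf₂ _ (by simp), hf₁ _ (by simp), hc, hw₂.one]
      simp
    · intro r hr
      simp at hr
      rw [hf₄ _ (by omega), hf₃ _ (by omega), hf₂ _ (by simp; omega), hf₁ _ (by simp; omega),
        hfr _ (by simp; omega)]
    · rw [← he1]; simp
    · rw [← he2]; simp
  · rintro u ⟨pre', post', hw, hi, hc, hfr, he1, he2⟩
    simp only [List.flatMap_nil, List.append_nil, List.map_nil] at he1 he2 hw
    refine ⟨by simpa using hc, ?_, ?_, hfr⟩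
    · rw [List.append_assoc _ post, ← he2, ← he1]; exact hw
    · rw [← he1]; exact hi
  · exact ⟨pre, post, h, hin, hcnt, fun _ _ => rfl, rfl, rfl⟩

theorem parseAut_spec {pre post : List ℕ} {s : State} {p off : ℕ} (D : AutData)
    (h : Word (pre ++ D.code ++ post) s)
    (hin : s.reg rIn = pre.length) (hp : s.reg rProc = p) (hoff : s.reg rOff = off) :
    Tri parseAut s (D.trans.length * 31 + 69) (fun u =>
      Word (pre ++ D.code ++ post ++ (D.recs p off).flatMap Rec.flat) u ∧
      u.reg rIn = (pre ++ D.code).length ∧ u.reg rProc = p + 1 ∧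
      u.reg rOff = off + D.numStates ∧ u.reg rCnt = s.reg rCnt - 1 ∧
      ∀ r, r ∉ [rTop, rIn, rCnt', rOff, rProc, rCnt, 30, 31, 32, 33, 34, 35, 36, 37, 38] →
        u.reg r = s.reg r) := by
  unfold parseAut
  set T := D.trans.length * 31 with hT
  set tr := D.trans.flatMap (fun t => [t.1, t.2.1, t.2.2.1, t.2.2.2.1, t.2.2.2.2]) with htr
  set ac := D.acts.flatMap (fun a => [a.1, a.2.1, a.2.2]) with hac
  have hacl : ac.length = 3 * D.acts.length := by
    simp [hac, List.length_flatMap, mul_comm]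
  have hcode : D.code = [D.numStates, D.init, D.msgs.length] ++ D.msgs ++ [D.bufs.length] ++
    D.bufs ++ [D.acts.length] ++ ac ++ [D.trans.length] ++ tr := rfl
  rw [block]
  refine (Tri.seq (T₁ := 7) (T₂ := T + 62) (Tri.mono (readInto_spec h rIn [30, 31, 32]
      (pre := pre) (vs := [D.numStates, D.init, D.msgs.length])
      (post := D.msgs ++ [D.bufs.length] ++ D.bufs ++ [D.acts.length] ++ ac ++ [D.trans.length]
        ++ tr ++ post) (by rw [hcode]; simp) hin (by simp) (by simp) (by simp) (by simp))
      (by simp) ?_)).mono (by omega) fun _ hu => hu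
  rintro u₁ ⟨hw₁, hi₁, hv₁, hf₁⟩
  simp only [List.map_cons, List.map_nil, List.cons.injEq, and_true] at hv₁
  obtain ⟨v1, v2, v3⟩ := hv₁
  rw [block]
  refine (Tri.seq (T₁ := 1) (T₂ := T + 61) (Tri.of_eval rfl (by simp [cost]) ?_)).mono
      (by omega) fun _ hu => hu
  set u₂ := (Prog.add rIn rIn 32).eval u₁ with hu₂
  have hf₂ : ∀ r, r ≠ rIn → u₂.reg r = u₁.reg r := fun r hr =>
      eval_reg_of_notMem_writes _ _ (by simpa [writes] using hr)
  have hw₂ := hw₁.congr (u := u₂) rfl fun r hr => hf₂ r (by omega)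
  have hi₂ : u₂.reg rIn = (pre ++ [D.numStates, D.init, D.msgs.length] ++ D.msgs).length := by
    simp [hu₂, eval, State.setReg_reg, hi₁, v3]; ring
  clear_value u₂
  rw [block]
  refine (Tri.seq (T₁ := 3) (T₂ := T + 58) (Tri.mono (readInto_spec hw₂ rIn [32]
      (pre := pre ++ [D.numStates, D.init, D.msgs.length] ++ D.msgs) (vs := [D.bufs.length])
      (post := D.bufs ++ [D.acts.length] ++ ac ++ [D.trans.length]
        ++ tr ++ post) (by rw [hcode]; simp) hi₂ (by simp) (by simp) (by simp) (by simp))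
      (by simp) ?_)).mono (by omega) fun _ hu => hu
  rintro u₃ ⟨hw₃, hi₃, hv₃, hf₃⟩
  simp only [List.map_cons, List.map_nil, List.cons.injEq, and_true] at hv₃
  rw [block]
  refine (Tri.seq (T₁ := 1) (T₂ := T + 57) (Tri.of_eval rfl (by simp [cost]) ?_)).mono
      (by omega) fun _ hu => hu
  set u₄ := (Prog.add rIn rIn 32).eval u₃ with hu₄
  have hf₄ : ∀ r, r ≠ rIn → u₄.reg r = u₃.reg r := fun r hr =>
      eval_reg_of_notMem_writes _ _ (by simpa [writes] using hr)
  have hw₄ := hw₃.congr (u := u₄) rfl fun r hr => hf₄ r (by omega)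
  have hi₄ : u₄.reg rIn = (pre ++ [D.numStates, D.init, D.msgs.length] ++ D.msgs ++
      [D.bufs.length] ++ D.bufs).length := by
    simp [hu₄, eval, State.setReg_reg, hi₃, hv₃]; ring
  clear_value u₄
  rw [block]
  refine (Tri.seq (T₁ := 3) (T₂ := T + 54) (Tri.mono (readInto_spec hw₄ rIn [32]
      (pre := pre ++ [D.numStates, D.init, D.msgs.length] ++ D.msgs ++
      [D.bufs.length] ++ D.bufs) (vs := [D.acts.length])
      (post := ac ++ [D.trans.length]
        ++ tr ++ post) (by rw [hcode]; simp) hi₄ (by simp) (by simp) (by simp) (by simp))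
      (by simp) ?_)).mono (by omega) fun _ hu => hu
  rintro u₅ ⟨hw₅, hi₅, hv₅, hf₅⟩
  simp only [List.map_cons, List.map_nil, List.cons.injEq, and_true] at hv₅
  rw [block]
  refine (Tri.seq (T₁ := 4) (T₂ := T + 50) (Tri.of_eval rfl (by simp [cost, block]) ?_)).mono
      (by omega) fun _ hu => hu
  set u₆ := (block _).eval u₅ with hu₆
  have hf₆ : ∀ r, r ≠ rIn → u₆.reg r = u₅.reg r := fun r hr =>
      eval_reg_of_notMem_writes _ _ (by simpa [block, writes] using hr)
  have hw₆ := hw₅.congr (u := u₆) rfl fun r hr => hf₆ r (by omega)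
  have hi₆ : u₆.reg rIn = (pre ++ [D.numStates, D.init, D.msgs.length] ++ D.msgs ++
      [D.bufs.length] ++ D.bufs ++ [D.acts.length] ++ ac).length := by
    simp [hu₆, block, eval, State.setReg_reg, hi₅, hv₅, hacl]; ring
  clear_value u₆
  rw [block]
  refine (Tri.seq (T₁ := 3) (T₂ := T + 47) (Tri.mono (readInto_spec hw₆ rIn [rCnt']
      (pre := pre ++ [D.numStates, D.init, D.msgs.length] ++ D.msgs ++
      [D.bufs.length] ++ D.bufs ++ [D.acts.length] ++ ac) (vs := [D.trans.length])
      (post := tr ++ post) (by rw [hcode]; simp) hi₆ (by simp) (by simp) (by simp) (by simp))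
      (by simp) ?_)).mono (by omega) fun _ hu => hu
  rintro u₇ ⟨hw₇, hi₇, hv₇, hf₇⟩
  simp only [List.map_cons, List.map_nil, List.cons.injEq, and_true] at hv₇
  have hall₇ : ∀ r, r ∉ [rTop, rIn, rCnt', 30, 31, 32] → u₇.reg r = s.reg r := by
    intro r hr
    simp at hr
    rw [hf₇ _ (by simp; omega), hf₆ _ (by omega), hf₅ _ (by simp; omega), hf₄ _ (by omega),
      hf₃ _ (by simp; omega), hf₂ _ (by omega), hf₁ _ (by simp; omega)]
  have e30 : u₇.reg 30 = D.numStates := by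
    rw [hf₇ _ (by simp), hf₆ _ (by simp), hf₅ _ (by simp), hf₄ _ (by simp),
      hf₃ _ (by simp), hf₂ _ (by simp), v1]
  have e31 : u₇.reg 31 = D.init := by
    rw [hf₇ _ (by simp), hf₆ _ (by simp), hf₅ _ (by simp), hf₄ _ (by simp),
      hf₃ _ (by simp), hf₂ _ (by simp), v2]
  rw [block]
  refine (Tri.seq (T₁ := 3) (T₂ := T + 44) (Tri.of_eval rfl (by simp [cost, block]) ?_)).mono
      (by omega) fun _ hu => hu
  set u₈ := (block _).eval u₇ with hu₈
  have hf₈ : ∀ r, r ∉ [31, 33] → u₈.reg r = u₇.reg r := fun r hr =>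
      eval_reg_of_notMem_writes _ _ (by simp [block, writes] at hr ⊢; omega)
  have hw₈ := hw₇.congr (u := u₈) rfl fun r hr => hf₈ r (by simp; omega)
  have f31 : u₈.reg 31 = off + D.init := by
    simp [hu₈, block, eval, State.setReg_reg, e31, hall₇, hoff]
  have f33 : u₈.reg 33 = 2 := by
    simp [hu₈, block, eval, State.setReg_reg]
  clear_value u₈
  rw [block]
  refine (Tri.seq (T₁ := 13) (T₂ := T + 31) (Tri.mono (pushAll_spec
    [33, rProc, 31, rZero, rZero, rZero] hw₈ (by simp)) (by simp) ?_)).mono (by omega)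
    fun _ hu => hu
  rintro u₉ ⟨hw₉, hf₉⟩
  have h8p : u₈.reg rProc = p := by rw [hf₈ _ (by simp), hall₇ _ (by simp), hp]
  have hlist : [33, rProc, 31, rZero, rZero, rZero].map u₈.reg =
      Rec.flat ⟨2, p, off + D.init, 0, 0, 0⟩ := by
    simp [Rec.flat, f31, f33, h8p, hw₈.zero]
  rw [hlist] at hw₉
  rw [block]
  have hpt := parseTrans_spec (s := u₉) (p := p) (off := off)
    (pre := pre ++ [D.numStates, D.init, D.msgs.length] ++ D.msgs ++
      [D.bufs.length] ++ D.bufs ++ [D.acts.length] ++ ac ++ [D.trans.length])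
    (post := post ++ Rec.flat ⟨2, p, off + D.init, 0, 0, 0⟩) D.trans
    (by convert hw₉ using 1; rw [hcode]; simp [htr])
    (by rw [hf₉ _ (by simp), hf₈ _ (by simp), hi₇])
    (by rw [hf₉ _ (by simp), h8p])
    (by rw [hf₉ _ (by simp), hf₈ _ (by simp), hall₇ _ (by simp), hoff])
    (by rw [hf₉ _ (by simp), hf₈ _ (by simp), hv₇])
  refine (Tri.seq (T₁ := T + 1) (T₂ := 10) (Tri.weaken hpt ?_)).mono (by omega)
    fun _ hu => hu
  rintro v ⟨hwv, hiv, hfv⟩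
  have hallv : ∀ r, r ∉ [rTop, rIn, rCnt', 30, 31, 32, 33, 34, 35, 36, 37, 38] →
      v.reg r = s.reg r := by
    intro r hr
    simp at hr
    rw [hfv _ (by simp; omega), hf₉ _ (by omega), hf₈ _ (by simp; omega), hall₇ _ (by simp; omega)]
  refine Tri.of_eval rfl (by simp [block, cost]) ?_
  have hfz : ∀ r, r ∉ [rOff, rProc, rCnt] → ((block [block [.add rOff rOff 30,
      .add rProc rProc rOne, .sub rCnt rCnt rOne]]).eval v).reg r = v.reg r := fun r hr =>
    eval_reg_of_notMem_writes _ _ (by simpa [block, writes] using hr)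
  have h30 : v.reg 30 = D.numStates := by
    rw [hfv _ (by simp), hf₉ _ (by simp), hf₈ _ (by simp), e30]
  refine ⟨?_, ?_, ?_, ?_, ?_, ?_⟩
  · refine Word.congr (s := v) ?_ rfl fun r hr => hfz r (by simp; omega)
    convert hwv using 1
    rw [hcode, AutData.recs]
    simp [htr]
  · rw [hfz _ (by simp), hiv, hcode]
    simp [htr]
  · simp [block, eval, State.setReg_reg, hallv, hp, h.one]
  · simp [block, eval, State.setReg_reg, hallv, hoff, h30]
  · simp [block, eval, State.setReg_reg, hallv, h.one]
  · intro r hr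
    simp at hr
    rw [hfz _ (by simp; omega), hallv _ (by simp; omega)]

/-- Parse all automata. -/
def parse : Prog := .loop rCnt parseAut

theorem parse_spec {pre post : List ℕ} {s : State} {m : ℕ} (ds : List AutData)
    (h : Word (pre ++ ds.flatMap AutData.code ++ post) s) (hm : ∀ D ∈ ds, D.trans.length ≤ m)
    (hin : s.reg rIn = pre.length) (hcnt : s.reg rCnt = ds.length) :
    Tri parse s (ds.length * (m * 31 + 70) + 1) (fun u =>
      Word (pre ++ ds.flatMap AutData.code ++ post ++
        (recsFrom (s.reg rProc) (s.reg rOff) ds).flatMap Rec.flat) u ∧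
      u.reg rOff = s.reg rOff + (ds.map AutData.numStates).sum ∧
      ∀ r, r ∉ [rTop, rIn, rCnt', rOff, rProc, rCnt, 30, 31, 32, 33, 34, 35, 36, 37, 38] →
        u.reg r = s.reg r) := by
  refine Tri.loop_list (T := m * 31 + 69) (fun rest u => ∃ pre' post',
    Word (pre' ++ rest.flatMap AutData.code ++ post') u ∧ (∀ D ∈ rest, D.trans.length ≤ m) ∧
    u.reg rIn = pre'.length ∧ u.reg rCnt = rest.length ∧
    u.reg rOff + (rest.map AutData.numStates).sum = s.reg rOff + (ds.map AutData.numStates).sum ∧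
    (∀ r, r ∉ [rTop, rIn, rCnt', rOff, rProc, rCnt, 30, 31, 32, 33, 34, 35, 36, 37, 38] →
        u.reg r = s.reg r) ∧
    pre' ++ rest.flatMap AutData.code = pre ++ ds.flatMap AutData.code ∧
    post' ++ (recsFrom (u.reg rProc) (u.reg rOff) rest).flatMap Rec.flat =
      post ++ (recsFrom (s.reg rProc) (s.reg rOff) ds).flatMap Rec.flat) ?_ ?_ ds s ?_
  · rintro D rest u ⟨pre', post', hw, hm', hi, hc, ho, hfr, he1, he2⟩
    refine ⟨by rw [hc]; simp, Tri.mono (parseAut_spec (pre := pre')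
      (post := rest.flatMap AutData.code ++ post') D (by simpa using hw) hi rfl rfl)
      (by have := hm' D (by simp); omega) ?_⟩
    rintro v ⟨hwv, hiv, hpv, hov, hcv, hfv⟩
    refine ⟨pre' ++ D.code, post' ++ (D.recs (u.reg rProc) (u.reg rOff)).flatMap Rec.flat, ?_,
      fun D' hD' => hm' D' (by simp [hD']), hiv, ?_, ?_, ?_, ?_, ?_⟩
    · convert hwv using 1; simp
    · rw [hcv, hc]; simp
    · rw [hov, ← ho]; simp; ring
    · intro r hr; rw [hfv r hr, hfr r hr]
    · rw [← he1]; simp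
    · rw [← he2, hpv, hov]; simp [recsFrom]
  · rintro u ⟨pre', post', hw, hm', hi, hc, ho, hfr, he1, he2⟩
    simp only [List.flatMap_nil, List.append_nil, List.map_nil, recsFrom, List.sum_nil,
      add_zero] at he1 he2 hw ho
    refine ⟨by simpa using hc, ?_, ho, hfr⟩
    rw [List.append_assoc _ post, ← he2, ← he1]; exact hw
  · exact ⟨pre, post, h, hm, hin, hcnt, rfl, fun _ _ => rfl, rfl, rfl⟩

end RAM

namespace RAM

open Prog

/-! ### Generating the rules -/

section Templates

variable {α : Type}

/-- Rules of a send that is not matched. -/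
def loneTmpl (S G F B P P' X : α) : List (List (α × α)) :=
  -- The buffer may be empty or not. The pairs `(G, G)` are padding up to five replacements: `G` is
  -- present once the first one is done.
  [(F, B), (B, B)].flatMap fun fb => [(S, G), fb, (G, G), (G, G), (G, G)] ::
    [(P, P), (P, X), (P', P), (P', X), (X, P), (X, X)].map
      fun c => [(S, G), fb, c, (G, G), (G, G)]

/-- Rules of the send that will be matched by the last receive. -/
def startTmpl (S G F B TI TM n₁ n₂ n₃ P' X : α) : List (List (α × α)) :=
  [P', X].map fun c => [(S, G), (F, B), (n₁, TI), (n₂, TM), (n₃, c)]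

/-- Rules of an exchange. -/
def exchTmpl (S G S₂ G₂ F P P' X P₂ P₂' Y : α) : List (List (α × α)) :=
  -- Here `(F, F)` tests that the buffer is empty. The receiving transition is taken after the
  -- sending one, which covers the case of a single process doing both.
  [(S, G), (S₂, G₂), (F, F), (F, F), (F, F)] ::
    ([P, P', X, P₂, P₂', Y].flatMap fun a => [P, X, P₂, Y].map fun c => (a, c)).map
      fun c => [(S, G), (S₂, G₂), (F, F), c, (F, F)]

/-- The rule of the last receive. -/
def recvTmpl (S G TI TM P bad : α) : List (List (α × α)) :=
  [[(S, G), (TI, TI), (TM, TM), (P, bad), (G, G)]]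

end Templates

/-- Rules for a send. -/
def Rec.sendRules (t : Rec) : List Rule :=
  loneTmpl (16 * t.src + 8) (16 * t.tgt + 8) (16 * t.buf) (16 * t.buf + 1) (16 * t.proc + 4)
      (16 * t.proc + 5) (16 * t.buf + 6) ++
    startTmpl (16 * t.src + 8) (16 * t.tgt + 8) (16 * t.buf) (16 * t.buf + 1) (16 * t.buf + 2)
      (16 * t.msg + 3) 9 10 11 (16 * t.proc + 5) (16 * t.buf + 6)

/-- Rules for a send together with a receive. -/
def Rec.exchRules (t t₂ : Rec) : List Rule :=
  if t₂.kind = 1 ∧ t₂.buf = t.buf ∧ t₂.msg = t.msg then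
    exchTmpl (16 * t.src + 8) (16 * t.tgt + 8) (16 * t₂.src + 8) (16 * t₂.tgt + 8) (16 * t.buf)
      (16 * t.proc + 4) (16 * t.proc + 5) (16 * t.buf + 6) (16 * t₂.proc + 4) (16 * t₂.proc + 5)
      (16 * t.buf + 7)
  else []

/-- Rules for the last receive. -/
def Rec.recvRules (t : Rec) : List Rule :=
  recvTmpl (16 * t.src + 8) (16 * t.tgt + 8) (16 * t.buf + 2) (16 * t.msg + 3) (16 * t.proc + 4) 12

/-- Rules whose first transition is `t`. -/
def Rec.rules (rs : List Rec) (t : Rec) : List Rule :=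
  if t.kind = 0 then t.sendRules ++ rs.flatMap t.exchRules
  else if t.kind = 1 then t.recvRules else []

/-- All rules. -/
def rulesOf (rs : List Rec) : List Rule := rs.flatMap (Rec.rules rs)

/-- Append rules given by registers. -/
def pushRules (L : List (List (ℕ × ℕ))) : Prog := pushAll (L.flatMap Rule.flat)

theorem map_flat (L : List (List (ℕ × ℕ))) (f : ℕ → ℕ) :
    (L.flatMap Rule.flat).map f = (L.map (List.map (Prod.map f f))).flatMap Rule.flat := by
  simp only [Rule.flat, List.map_flatMap, List.flatMap_map]
  simp

/-- The templates are polymorphic: applied to register numbers they tell the program what to write,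
and mapping the register contents over them yields the rules themselves. -/
theorem pushRules_spec {l : List ℕ} {s : State} (L : List (List (ℕ × ℕ))) (h : Word l s)
    (hr : rTop ∉ L.flatMap Rule.flat) :
    Tri (pushRules L) s (2 * (L.flatMap Rule.flat).length + 1)
      (fun u => Word (l ++ (L.map (List.map (Prod.map s.reg s.reg))).flatMap Rule.flat) u ∧
        ∀ r, r ≠ rTop → u.reg r = s.reg r) := by
  have := pushAll_spec (L.flatMap Rule.flat) h hr
  rwa [map_flat] at this

-- There are `1 + 6 * 4` rules of ten cells each.
set_option maxRecDepth 4000 in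
theorem length_exchTmpl (S G S₂ G₂ F P P' X P₂ P₂' Y : ℕ) :
    ((exchTmpl S G S₂ G₂ F P P' X P₂ P₂' Y).flatMap Rule.flat).length = 250 := rfl

-- There are `2 * 7` rules of lone sends and two starting rules, of ten cells each.
set_option maxRecDepth 4000 in
theorem length_sendTmpl (S G F B P P' X TI TM n₁ n₂ n₃ : ℕ) :
    ((loneTmpl S G F B P P' X ++ startTmpl S G F B TI TM n₁ n₂ n₃ P' X).flatMap
      Rule.flat).length = 160 := rfl

/-- Append the rules for the current send together with the receives. -/
def genExch : Prog :=
  block [block [.add 25 rRecs rZero, .sub 26 rRecsEnd 25], .loop 26 (block [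
    readInto 25 [60, 61, 62, 63, 64, 65],
    elems [(70, 62, 8), (71, 65, 8), (72, 61, 4), (73, 61, 5)],
    -- Truncated differences in both directions are added up, so that register `66` is zero exactly
    -- if the kind is `1` and buffer and message agree with those of the send.
    block [.sub 66 60 rOne, .sub 67 rOne 60, .add 66 66 67, .sub 67 63 33, .add 66 66 67,
      .sub 67 33 63, .add 66 66 67, .sub 67 64 34, .add 66 66 67, .sub 67 34 64, .add 66 66 67],
    .cond 66 .skip (pushRules (exchTmpl 40 41 70 71 42 46 47 48 72 73 49)),
    .sub 26 rRecsEnd 25])]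

/-- The registers from `30` on hold the record `t` and the elements for its rules. -/
structure Loaded (t : Rec) (s : State) : Prop where
  kind : s.reg 30 = t.kind
  buf : s.reg 33 = t.buf
  msg : s.reg 34 = t.msg
  src' : s.reg 40 = 16 * t.src + 8
  tgt' : s.reg 41 = 16 * t.tgt + 8
  free' : s.reg 42 = 16 * t.buf
  full' : s.reg 43 = 16 * t.buf + 1
  tbuf' : s.reg 44 = 16 * t.buf + 2
  tmsg' : s.reg 45 = 16 * t.msg + 3
  moved' : s.reg 46 = 16 * t.proc + 4
  fresh' : s.reg 47 = 16 * t.proc + 5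
  send' : s.reg 48 = 16 * t.buf + 6
  recv' : s.reg 49 = 16 * t.buf + 7
  none₁ : s.reg 50 = 9
  none₂ : s.reg 51 = 10
  none₃ : s.reg 52 = 11
  bad : s.reg 53 = 12

theorem Loaded.congr {t : Rec} {s u : State} (h : Loaded t s)
    (hr : ∀ r, 30 ≤ r → r < 60 → u.reg r = s.reg r) : Loaded t u := by
  constructor <;> rw [hr _ (by simp) (by simp)]
  exacts [h.kind, h.buf, h.msg, h.src', h.tgt', h.free', h.full', h.tbuf', h.tmsg', h.moved',
    h.fresh', h.send', h.recv', h.none₁, h.none₂, h.none₃, h.bad]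

theorem length_flat (rs : List Rec) : (rs.flatMap Rec.flat).length = 6 * rs.length := by
  induction rs with
  | nil => rfl
  | cons t rs ih => simp [Rec.flat, ih]; ring

theorem genExch_spec {pre post : List ℕ} {s : State} {t : Rec} (rs : List Rec)
    (h : Word (pre ++ rs.flatMap Rec.flat ++ post) s) (ht : Loaded t s)
    (hb : s.reg rRecs = pre.length) (he : s.reg rRecsEnd = pre.length + 6 * rs.length) :
    Tri genExch s (rs.length * 580 + 5) (fun u =>
      Word (pre ++ rs.flatMap Rec.flat ++ post ++ (rs.flatMap t.exchRules).flatMap Rule.flat) u ∧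
      ∀ r, r < 60 → r ∉ [rTop, rX, 25, 26] → u.reg r = s.reg r) := by
  unfold genExch
  rw [block]
  refine (Tri.seq (T₁ := 3) (T₂ := rs.length * 580 + 2) (Tri.of_eval rfl (by simp [block, cost])
    ?_)).mono (by omega) fun _ hu => hu
  set s₁ := (block _).eval s with hs₁
  have hfr₁ : ∀ r, r ∉ [25, 26] → s₁.reg r = s.reg r := fun r hr =>
    eval_reg_of_notMem_writes _ _ (by simp [block, writes] at hr ⊢; omega)
  have hw₁ := h.congr (u := s₁) rfl fun r hr => hfr₁ r (by simp; omega)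
  have h25 : s₁.reg 25 = pre.length := by
    simp [hs₁, block, eval, State.setReg_reg, hb, h.zero]
  have h26 : s₁.reg 26 = 6 * rs.length := by
    simp [hs₁, block, eval, State.setReg_reg, hb, h.zero, he]
  clear_value s₁
  rw [block]
  refine (Tri.seq (T₁ := rs.length * (579 + 1) + 1) (T₂ := 1) (Tri.weaken (Q := fun u =>
      Word (pre ++ rs.flatMap Rec.flat ++ post ++ (rs.flatMap t.exchRules).flatMap Rule.flat) u ∧
      ∀ r, r < 60 → r ∉ [rTop, rX, 25, 26] → u.reg r = s.reg r) ?_ fun u hu =>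
      Tri.of_eval rfl le_rfl hu)).mono (by omega) fun _ hu => hu
  refine Tri.loop_list (fun rest u => ∃ pre' post',
    Word (pre' ++ rest.flatMap Rec.flat ++ post') u ∧ u.reg 25 = pre'.length ∧
    u.reg rRecsEnd = pre'.length + 6 * rest.length ∧ u.reg 26 = 6 * rest.length ∧
    (∀ r, r < 60 → r ∉ [rTop, rX, 25, 26] → u.reg r = s.reg r) ∧
    pre' ++ rest.flatMap Rec.flat = pre ++ rs.flatMap Rec.flat ∧
    post' ++ (rest.flatMap t.exchRules).flatMap Rule.flat =
      post ++ (rs.flatMap t.exchRules).flatMap Rule.flat) ?_ ?_ rs s₁ ?_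
  · rintro t₂ rest u ⟨pre', post', hw, hp, hre, hd, hfr, he1, he2⟩
    refine ⟨by rw [hd]; simp, ?_⟩
    rw [block]
    refine (Tri.seq (T₁ := 13) (T₂ := 566) (Tri.mono (readInto_spec hw 25 [60, 61, 62, 63, 64, 65]
      (pre := pre') (vs := t₂.flat) (post := rest.flatMap Rec.flat ++ post') (by simp) hp
      (by simp) (by simp) (by simp) (by simp [Rec.flat])) (by simp) ?_)).mono (by omega)
      fun _ hu => hu
    rintro u₁ ⟨hw₁, hp₁, hv₁, hf₁⟩
    simp only [List.map_cons, List.map_nil, Rec.flat, List.cons.injEq, and_true] at hv₁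
    obtain ⟨v1, v2, v3, v4, v5, v6⟩ := hv₁
    rw [block]
    refine (Tri.seq (T₁ := 29) (T₂ := 537) (Tri.mono (elems_spec hw₁
      [(70, 62, 8), (71, 65, 8), (72, 61, 4), (73, 61, 5)] (by simp) (by simp)) (by simp)
      ?_)).mono (by omega) fun _ hu => hu
    rintro u₂ ⟨hw₂, he₂, hf₂⟩
    simp only [List.mem_cons, List.not_mem_nil, or_false, forall_eq_or_imp, forall_eq, v2, v3,
      v6] at he₂
    obtain ⟨w1, w2, w3, w4⟩ := he₂
    simp only [List.map_cons, List.map_nil] at hf₂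
    have hall₂ : ∀ r, r < 60 → r ∉ [rTop, rX, 25, 26] → u₂.reg r = s.reg r := by
      intro r hr hr'
      simp at hr'
      rw [hf₂ _ (by omega) (by simp; omega), hf₁ _ (by simp; omega), hfr _ hr (by simp; omega)]
    have ht₂ : Loaded t u₂ := ht.congr fun r h1 h2 => hall₂ r h2 (by simp; omega)
    have k1 : u₂.reg 60 = t₂.kind := by rw [hf₂ _ (by simp) (by simp), v1]
    have k2 : u₂.reg 63 = t₂.buf := by rw [hf₂ _ (by simp) (by simp), v4]
    have k3 : u₂.reg 64 = t₂.msg := by rw [hf₂ _ (by simp) (by simp), v5]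
    rw [block]
    refine (Tri.seq (T₁ := 12) (T₂ := 525) (Tri.of_eval rfl (by simp [block, cost]) ?_)).mono
      (by omega) fun _ hu => hu
    set u₃ := (block _).eval u₂ with hu₃
    have hf₃ : ∀ r, r ∉ [66, 67] → u₃.reg r = u₂.reg r := fun r hr =>
      eval_reg_of_notMem_writes _ _ (by simp [block, writes] at hr ⊢; omega)
    have hw₃ := hw₂.congr (u := u₃) rfl fun r hr => hf₃ r (by simp; omega)
    have h66 : u₃.reg 66 = t₂.kind - 1 + (1 - t₂.kind) + (t₂.buf - t.buf) + (t.buf - t₂.buf) +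
        (t₂.msg - t.msg) + (t.msg - t₂.msg) := by
      simp [hu₃, block, eval, State.setReg_reg, k1, k2, k3, ht₂.buf, ht₂.msg, hw₂.one]
    have ht₃ : Loaded t u₃ := ht₂.congr fun r h1 h2 => hf₃ r (by simp; omega)
    clear_value u₃
    rw [block]
    refine (Tri.seq (T₁ := 502) (T₂ := 2) (Tri.weaken (Q := fun u' =>
      Word (pre' ++ (t₂ :: rest).flatMap Rec.flat ++ post' ++
        (t.exchRules t₂).flatMap Rule.flat) u' ∧ ∀ r, r ≠ rTop → u'.reg r = u₃.reg r) ?_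
      ?_)).mono (by omega) fun _ hu => hu
    · refine (Tri.cond (T := 501) ?_ ?_).mono le_rfl fun _ hu => hu
      · intro h0
        rw [h66] at h0
        have : t.exchRules t₂ = [] := by
          rw [Rec.exchRules, if_neg]; omega
        refine Tri.of_eval rfl (by simp [cost]) ?_
        simp only [eval, this, List.flatMap_nil, List.append_nil]
        exact ⟨hw₃, fun _ _ => trivial⟩
      · intro h0
        rw [h66] at h0
        refine Tri.mono (pushRules_spec _ hw₃ (by decide)) (by rw [length_exchTmpl]) ?_
        have : (exchTmpl 40 41 70 71 42 46 47 48 72 73 49).map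
            (List.map (Prod.map u₃.reg u₃.reg)) = t.exchRules t₂ := by
          rw [Rec.exchRules, if_pos (by omega), ← ht₃.src', ← ht₃.tgt',
            ← ht₃.moved', ← ht₃.fresh', ← ht₃.send', ← ht₃.recv', ← ht₃.free', ← w1, ← w2, ← w3, ← w4,
            ← hf₃ 70 (by simp), ← hf₃ 71 (by simp), ← hf₃ 72 (by simp), ← hf₃ 73 (by simp)]
          rfl
        rw [this]
        exact fun u hu => hu
    · rintro u₄ ⟨hw₄, hf₄⟩
      refine Tri.of_eval rfl (by simp [block, cost]) ?_
      have hf₅ : ∀ r, r ≠ 26 → ((block [Prog.sub 26 rRecsEnd 25]).eval u₄).reg r = u₄.reg r :=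
        fun r hr => eval_reg_of_notMem_writes _ _ (by simpa [block, writes] using hr)
      have hend : u₄.reg rRecsEnd = pre'.length + 6 * (rest.length + 1) := by
        rw [hf₄ _ (by simp), hf₃ _ (by simp), hf₂ _ (by simp) (by simp), hf₁ _ (by simp), hre]
        simp
      have h25' : u₄.reg 25 = pre'.length + 6 := by
        rw [hf₄ _ (by simp), hf₃ _ (by simp), hf₂ _ (by simp) (by simp), hp₁]
        simp [Rec.flat]
      refine ⟨pre' ++ t₂.flat, post' ++ (t.exchRules t₂).flatMap Rule.flat, ?_, ?_, ?_, ?_, ?_,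
        ?_, ?_⟩
      · refine Word.congr (s := u₄) ?_ rfl fun r hr => hf₅ r (by omega)
        convert hw₄ using 1; simp
      · rw [hf₅ _ (by simp), h25']; simp [Rec.flat]
      · rw [hf₅ _ (by simp), hend]; simp [Rec.flat]; ring
      · simp only [block, eval, State.setReg_reg, if_true]
        rw [hend, h25']; omega
      · intro r hr hr'
        simp at hr'
        rw [hf₅ _ (by omega), hf₄ _ (by omega), hf₃ _ (by simp; omega), hall₂ r hr (by simp; omega)]
      · rw [← he1]; simp
      · rw [← he2]; simp
  · rintro u ⟨pre', post', hw, hp, hre, hd, hfr, he1, he2⟩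
    simp only [List.flatMap_nil, List.append_nil] at he1 he2 hw
    refine ⟨by simpa using hd, ?_, hfr⟩
    rw [List.append_assoc _ post, ← he2, ← he1]; exact hw
  · refine ⟨pre, post, hw₁, h25, by rw [hfr₁ _ (by simp), he], h26, fun r _ hr => hfr₁ r ?_, rfl,
      rfl⟩
    simp at hr ⊢; omega

/-- Append all rules. -/
def genRules : Prog :=
  block [block [.add rPtr rRecs rZero, .sub rD rRecsEnd rPtr], .loop rD (block [
    readInto rPtr [30, 31, 32, 33, 34, 35],
    elems [(40, 32, 8), (41, 35, 8), (42, 33, 0), (43, 33, 1), (44, 33, 2), (45, 34, 3),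
      (46, 31, 4), (47, 31, 5), (48, 33, 6), (49, 33, 7), (50, rZero, 9), (51, rZero, 10),
      (52, rZero, 11), (53, rZero, 12)],
    .cond 30 (block [.sub 36 30 rOne, .cond 36 .skip (pushRules (recvTmpl 40 41 44 45 46 53))])
      (block [pushRules (loneTmpl 40 41 42 43 46 47 48 ++
        startTmpl 40 41 42 43 44 45 50 51 52 47 48), genExch]),
    .sub rD rRecsEnd rPtr])]

theorem genRules_spec {pre post : List ℕ} {s : State} (rs : List Rec)
    (h : Word (pre ++ rs.flatMap Rec.flat ++ post) s)
    (hb : s.reg rRecs = pre.length) (he : s.reg rRecsEnd = pre.length + 6 * rs.length) :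
    Tri genRules s (rs.length * (rs.length * 580 + 460) + 5) (fun u =>
      Word (pre ++ rs.flatMap Rec.flat ++ post ++ (rulesOf rs).flatMap Rule.flat) u ∧
      ∀ r, r < 30 → r ∉ [rTop, rX, 25, 26, rPtr, rD] → u.reg r = s.reg r) := by
  unfold genRules
  rw [block]
  set W := rs.length * 580 with hW
  refine (Tri.seq (T₁ := 3) (T₂ := rs.length * (W + 460) + 2)
    (Tri.of_eval rfl (by simp [block, cost]) ?_)).mono (by omega) fun _ hu => hu
  set s₁ := (block _).eval s with hs₁
  have hfr₁ : ∀ r, r ∉ [rPtr, rD] → s₁.reg r = s.reg r := fun r hr =>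
    eval_reg_of_notMem_writes _ _ (by simp [block, writes] at hr ⊢; omega)
  have hw₁ := h.congr (u := s₁) rfl fun r hr => hfr₁ r (by simp; omega)
  have hptr : s₁.reg rPtr = pre.length := by
    simp [hs₁, block, eval, State.setReg_reg, hb, h.zero]
  have hD : s₁.reg rD = 6 * rs.length := by
    simp [hs₁, block, eval, State.setReg_reg, hb, h.zero, he]
  clear_value s₁
  rw [block]
  refine (Tri.seq (T₁ := rs.length * (W + 460) + 1) (T₂ := 1) (Tri.weaken
      (Q := fun u =>
      Word (pre ++ rs.flatMap Rec.flat ++ post ++ (rulesOf rs).flatMap Rule.flat) u ∧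
      ∀ r, r < 30 → r ∉ [rTop, rX, 25, 26, rPtr, rD] → u.reg r = s.reg r) ?_ fun u hu =>
      Tri.of_eval rfl le_rfl hu)).mono (by omega) fun _ hu => hu
  refine Tri.loop_list (T := W + 459) (fun rest u => ∃ pre' post',
    Word (pre' ++ rest.flatMap Rec.flat ++ post') u ∧ u.reg rPtr = pre'.length ∧
    u.reg rRecsEnd = pre'.length + 6 * rest.length ∧ u.reg rD = 6 * rest.length ∧
    (∀ r, r < 30 → r ∉ [rTop, rX, 25, 26, rPtr, rD] → u.reg r = s.reg r) ∧
    pre' ++ rest.flatMap Rec.flat = pre ++ rs.flatMap Rec.flat ∧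
    post' ++ (rest.flatMap (Rec.rules rs)).flatMap Rule.flat =
      post ++ (rs.flatMap (Rec.rules rs)).flatMap Rule.flat) ?_ ?_ rs s₁ ?_
  · rintro t rest u ⟨pre', post', hw, hp, hre, hd, hfr, he1, he2⟩
    refine ⟨by rw [hd]; simp, ?_⟩
    rw [block]
    refine (Tri.seq (T₁ := 13) (T₂ := W + 446) (Tri.mono (readInto_spec hw rPtr
      [30, 31, 32, 33, 34, 35]
      (pre := pre') (vs := t.flat) (post := rest.flatMap Rec.flat ++ post') (by simp) hp
      (by simp) (by simp) (by simp) (by simp [Rec.flat])) (by simp) ?_)).mono (by omega)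
      fun _ hu => hu
    rintro u₁ ⟨hw₁, hp₁, hv₁, hf₁⟩
    simp only [List.map_cons, List.map_nil, Rec.flat, List.cons.injEq, and_true] at hv₁
    obtain ⟨v1, v2, v3, v4, v5, v6⟩ := hv₁
    rw [block]
    refine (Tri.seq (T₁ := 99) (T₂ := W + 347) (Tri.mono (elems_spec hw₁
      [(40, 32, 8), (41, 35, 8), (42, 33, 0), (43, 33, 1), (44, 33, 2), (45, 34, 3),
      (46, 31, 4), (47, 31, 5), (48, 33, 6), (49, 33, 7), (50, rZero, 9), (51, rZero, 10),
      (52, rZero, 11), (53, rZero, 12)] (by simp) (by simp)) (by simp)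
      ?_)).mono (by omega) fun _ hu => hu
    rintro u₂ ⟨hw₂, he₂, hf₂⟩
    simp only [List.mem_cons, List.not_mem_nil, or_false, forall_eq_or_imp, forall_eq, v2, v3,
      v4, v5, v6, hw₁.zero, Nat.mul_zero, Nat.zero_add, Nat.add_zero] at he₂
    simp only [List.map_cons, List.map_nil] at hf₂
    have ht₂ : Loaded t u₂ := by
      obtain ⟨w1, w2, w3, w4, w5, w6, w7, w8, w9, w10, w11, w12, w13, w14⟩ := he₂
      exact ⟨by rw [hf₂ _ (by simp) (by simp), v1], by rw [hf₂ _ (by simp) (by simp), v4],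
        by rw [hf₂ _ (by simp) (by simp), v5], w1, w2, w3, w4, w5, w6, w7, w8, w9, w10, w11, w12,
        w13, w14⟩
    have hall₂ : ∀ r, r < 30 → r ∉ [rTop, rX, 25, 26, rPtr, rD] → u₂.reg r = s.reg r := by
      intro r hr hr'
      simp at hr'
      rw [hf₂ _ (by omega) (by simp; omega), hf₁ _ (by simp; omega), hfr _ hr (by simp; omega)]
    have hre₂ : u₂.reg rRecsEnd = pre'.length + 6 * (rest.length + 1) := by
      rw [hf₂ _ (by simp) (by simp), hf₁ _ (by simp), hre]; simp
    have hp₂ : u₂.reg rPtr = pre'.length + 6 := by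
      rw [hf₂ _ (by simp) (by simp), hp₁]; simp [Rec.flat]
    rw [block]
    refine (Tri.seq (T₁ := W + 335) (T₂ := 2) (Tri.weaken (Q := fun u' =>
      Word (pre' ++ (t :: rest).flatMap Rec.flat ++ post' ++
        (Rec.rules rs t).flatMap Rule.flat) u' ∧
        ∀ r, r < 30 → r ∉ [rTop, rX, 25, 26] → u'.reg r = u₂.reg r) ?_
      ?_)).mono (by omega) fun _ hu => hu
    · refine (Tri.cond (T := W + 334) ?_ ?_).mono le_rfl fun _ hu => hu
      · intro h0
        rw [ht₂.kind] at h0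
        rw [block]
        refine (Tri.seq (T₁ := 1) (T₂ := 30) (Tri.of_eval rfl (by simp [cost]) ?_)).mono
          (by omega) fun _ hu => hu
        set u₃ := (Prog.sub 36 30 rOne).eval u₂ with hu₃
        have hf₃ : ∀ r, r ≠ 36 → u₃.reg r = u₂.reg r := fun r hr =>
          eval_reg_of_notMem_writes _ _ (by simpa [writes] using hr)
        have h36 : u₃.reg 36 = t.kind - 1 := by
          simp [hu₃, eval, State.setReg_reg, ht₂.kind, hw₂.one]
        have hw₃ := hw₂.congr (u := u₃) rfl fun r hr => hf₃ r (by omega)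
        have ht₃ : ∀ r, r < 60 → r ≠ 36 → u₃.reg r = u₂.reg r := fun r _ => hf₃ r
        clear_value u₃
        rw [block]
        refine (Tri.seq (T₁ := 29) (T₂ := 1) (Tri.weaken ?_
          fun u hu => Tri.of_eval rfl le_rfl hu)).mono (by omega) fun _ hu => hu
        refine (Tri.cond (T := 28) ?_ ?_).mono le_rfl fun _ hu => hu
        · intro h1
          rw [h36] at h1
          refine Tri.of_eval rfl (by simp [cost]) ?_
          have : Rec.rules rs t = [] := by
            rw [Rec.rules, if_neg h0, if_neg (by omega)]
          simp only [this, eval, block, List.flatMap_nil, List.append_nil]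
          exact ⟨hw₃, fun r hr _ => hf₃ r (by omega)⟩
        · intro h1
          rw [h36] at h1
          refine Tri.mono (pushRules_spec _ hw₃ (by decide)) (by decide) ?_
          rintro u' ⟨hw', hf'⟩
          have : (recvTmpl 40 41 44 45 46 53).map
              (List.map (Prod.map u₃.reg u₃.reg)) = Rec.rules rs t := by
            rw [Rec.rules, if_neg h0, if_pos (by omega), Rec.recvRules, ← ht₂.src', ← ht₂.tgt',
              ← ht₂.tbuf', ← ht₂.tmsg', ← ht₂.moved', ← ht₂.bad, ← hf₃ 40 (by simp),
              ← hf₃ 41 (by simp), ← hf₃ 44 (by simp), ← hf₃ 45 (by simp), ← hf₃ 46 (by simp),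
              ← hf₃ 53 (by simp)]
            rfl
          rw [this] at hw'
          refine ⟨hw', fun r hr hr' => ?_⟩
          simp at hr'
          show u'.reg r = _
          rw [hf' r (by omega), hf₃ r (by omega)]
      · intro h0
        rw [ht₂.kind] at h0
        rw [block]
        refine (Tri.seq (T₁ := 321) (T₂ := W + 7)
          (Tri.mono (pushRules_spec _ hw₂ (by decide))
            (by rw [length_sendTmpl]) ?_)).mono
          (by omega) fun _ hu => hu
        rintro u₃ ⟨hw₃, hf₃⟩
        have : (loneTmpl 40 41 42 43 46 47 48 ++ startTmpl 40 41 42 43 44 45 50 51 52 47 48).map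
            (List.map (Prod.map u₂.reg u₂.reg)) = t.sendRules := by
          rw [Rec.sendRules, ← ht₂.src', ← ht₂.tgt', ← ht₂.full', ← ht₂.tbuf',
            ← ht₂.tmsg', ← ht₂.moved', ← ht₂.fresh', ← ht₂.send', ← ht₂.none₁, ← ht₂.none₂,
            ← ht₂.none₃, ← ht₂.free']
          rfl
        rw [this] at hw₃
        have ht₃ := ht₂.congr fun r h1 h2 => hf₃ r (by omega)
        rw [block]
        have hge := genExch_spec (s := u₃) (t := t) rs (pre := pre)
          (post := post' ++ t.sendRules.flatMap Rule.flat) (by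
            convert hw₃ using 1
            rw [← List.append_assoc, ← he1]) ht₃
          (by rw [hf₃ _ (by simp), hall₂ _ (by simp) (by simp), hb])
          (by rw [hf₃ _ (by simp), hall₂ _ (by simp) (by simp), he])
        refine (Tri.seq (T₁ := W + 5) (T₂ := 1) (Tri.weaken hge ?_)).mono (by omega)
          fun _ hu => hu
        rintro u₄ ⟨hw₄, hf₄⟩
        refine Tri.of_eval rfl le_rfl ?_
        simp only [block, eval]
        refine ⟨?_, fun r hr hr' => ?_⟩
        · convert hw₄ using 1
          rw [Rec.rules, if_pos h0, he1]
          simp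
        · rw [hf₄ r (by omega) hr']
          simp at hr'
          rw [hf₃ r (by omega)]
    · rintro u₄ ⟨hw₄, hf₄⟩
      refine Tri.of_eval rfl (by simp [block, cost]) ?_
      have hf₅ : ∀ r, r ≠ rD → ((block [Prog.sub rD rRecsEnd rPtr]).eval u₄).reg r = u₄.reg r :=
        fun r hr => eval_reg_of_notMem_writes _ _ (by simpa [block, writes] using hr)
      have hend : u₄.reg rRecsEnd = pre'.length + 6 * (rest.length + 1) := by
        rw [hf₄ _ (by simp) (by simp), hre₂]
      have hp' : u₄.reg rPtr = pre'.length + 6 := by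
        rw [hf₄ _ (by simp) (by simp), hp₂]
      refine ⟨pre' ++ t.flat, post' ++ (Rec.rules rs t).flatMap Rule.flat, ?_, ?_, ?_, ?_, ?_,
        ?_, ?_⟩
      · refine Word.congr (s := u₄) ?_ rfl fun r hr => hf₅ r (by omega)
        convert hw₄ using 1; simp
      · rw [hf₅ _ (by simp), hp']; simp [Rec.flat]
      · rw [hf₅ _ (by simp), hend]; simp [Rec.flat]; ring
      · simp only [block, eval, State.setReg_reg, if_true]
        rw [hend, hp']; omega
      · intro r hr hr'
        simp at hr'
        rw [hf₅ _ (by omega), hf₄ _ (by omega) (by simp; omega), hall₂ r hr (by simp; omega)]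
      · rw [← he1]; simp
      · rw [← he2]; simp
  · rintro u ⟨pre', post', hw, hp, hre, hd, hfr, he1, he2⟩
    simp only [List.flatMap_nil, List.append_nil] at he1 he2 hw
    refine ⟨by simpa using hd, ?_, hfr⟩
    rw [rulesOf, List.append_assoc _ post, ← he2, ← he1]; exact hw
  · refine ⟨pre, post, hw₁, hptr, by rw [hfr₁ _ (by simp), he], hD, fun r _ hr => hfr₁ r ?_, rfl,
      rfl⟩
    simp at hr ⊢; omega

end RAM

namespace RAM

open Prog

/-! ### The main program -/

/-- Append the powers of two. -/
def powTable : Prog :=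
  block [block [.add rPow rTop rZero, .const 30 1, .add 31 rU rZero], .loop 31 (block [
    pushAll [30], block [.add 30 30 30, .sub 31 31 rOne]])]

theorem powTable_spec {l : List ℕ} {U : ℕ} {s : State} (h : Word l s) (hU : s.reg rU = U) :
    Tri powTable s (U * 10 + 10) (fun u => Word (l ++ (List.range U).map (2 ^ ·)) u ∧
      u.reg rPow = l.length ∧ ∀ r, r ∉ [rTop, rPow, 30, 31] → u.reg r = s.reg r) := by
  unfold powTable
  rw [block]
  refine (Tri.seq (T₁ := 4) (T₂ := U * 10 + 6) (Tri.of_eval rfl (by simp [block, cost])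
    ?_)).mono (by omega) fun _ hu => hu
  set s₁ := (block _).eval s with hs₁
  have hfr₁ : ∀ r, r ∉ [rPow, 30, 31] → s₁.reg r = s.reg r := fun r hr =>
    eval_reg_of_notMem_writes _ _ (by simp [block, writes] at hr ⊢; omega)
  have hw₁ := h.congr (u := s₁) rfl fun r hr => hfr₁ r (by simp; omega)
  have hp : s₁.reg rPow = l.length := by
    simp [hs₁, block, eval, State.setReg_reg, h.top, h.zero]
  have h30 : s₁.reg 30 = 1 := by simp [hs₁, block, eval, State.setReg_reg]
  have h31 : s₁.reg 31 = U := by simp [hs₁, block, eval, State.setReg_reg, hU, h.zero]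
  clear_value s₁
  rw [block]
  refine (Tri.seq (T₁ := U * (9 + 1) + 1) (T₂ := 1) (Tri.weaken
    (Q := fun u => Word (l ++ (List.range U).map (2 ^ ·)) u ∧
      u.reg rPow = l.length ∧ ∀ r, r ∉ [rTop, rPow, 30, 31] → u.reg r = s.reg r) ?_
    fun u hu => Tri.of_eval rfl le_rfl hu)).mono (by omega) fun _ hu => hu
  refine Tri.loop_count (fun n u => ∃ j, j + n = U ∧ Word (l ++ (List.range j).map (2 ^ ·)) u ∧
    u.reg rPow = l.length ∧ u.reg 30 = 2 ^ j ∧ u.reg 31 = n ∧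
    ∀ r, r ∉ [rTop, rPow, 30, 31] → u.reg r = s.reg r) ?_ ?_ U s₁ ?_
  · rintro n u ⟨j, hj, hw, hpw, h0, h1, hfr⟩
    refine ⟨by omega, ?_⟩
    rw [block]
    refine (Tri.seq (T₁ := 3) (T₂ := 6) (Tri.mono (pushAll_spec [30] hw (by simp)) (by simp)
      ?_)).mono (by omega) fun _ hu => hu
    rintro u₁ ⟨hw₁, hf₁⟩
    refine Tri.of_eval rfl (by simp [block, cost]) ?_
    have hf₂ : ∀ r, r ∉ [30, 31] → ((block [block [Prog.add 30 30 30,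
        Prog.sub 31 31 rOne]]).eval u₁).reg r = u₁.reg r :=
      fun r hr => eval_reg_of_notMem_writes _ _ (by simpa [block, writes] using hr)
    refine ⟨j + 1, by omega, ?_, ?_, ?_, ?_, ?_⟩
    · refine Word.congr (s := u₁) ?_ rfl fun r hr => hf₂ r (by simp; omega)
      convert hw₁ using 1
      simp [List.range_succ, h0]
    · rw [hf₂ _ (by simp), hf₁ _ (by simp), hpw]
    · simp [block, eval, State.setReg_reg, hf₁, h0, pow_succ]; ring
    · simp [block, eval, State.setReg_reg, hf₁, h1, hw.one]
    · intro r hr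
      simp at hr
      rw [hf₂ _ (by simp; omega), hf₁ _ (by omega), hfr _ (by simp; omega)]
  · rintro u ⟨j, hj, hw, hpw, h0, h1, hfr⟩
    rw [Nat.add_zero] at hj
    subst hj
    exact ⟨h1, hw, hpw, hfr⟩
  · exact ⟨0, by simp, by simpa using hw₁, hp, by simpa using h30, h31, fun r hr =>
      hfr₁ r (by simp at hr ⊢; omega)⟩

/-- Add the element in register `37` to the current code. -/
def addPow : Prog := block [.add 37 37 rPow, .load 37 37, .add rCode rCode 37]

theorem addPow_spec {l : List ℕ} {ps U e : ℕ} {s : State} (hp : PowTable l ps U) (h : Word l s)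
    (hps : s.reg rPow = ps) (he : s.reg 37 = e) (heU : e < U) :
    Tri addPow s 4 (fun u => Word l u ∧ u.reg rCode = s.reg rCode + 2 ^ e ∧
      ∀ r, r ∉ [37, rCode] → u.reg r = s.reg r) := by
  have hf : ∀ r, r ∉ [37, rCode] → (addPow.eval s).reg r = s.reg r :=
    fun r hr => eval_reg_of_notMem_writes _ _ (by simpa [addPow, block, writes] using hr)
  refine Tri.of_eval rfl (by decide) ⟨h.congr rfl fun r hr => hf r (by simp; omega), ?_, hf⟩
  have : s.mem (e + ps) = 2 ^ e := by rw [add_comm, h.holds, hp.2 e heU]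
  simp [addPow, block, eval, State.setReg_reg, hps, he, this]

/-- Compute the code of the initial node. -/
def initCode : Prog :=
  block [block [.const rCode 0, .add rPtr rRecs rZero, .sub rD rRecsEnd rPtr],
    .loop rD (block [readInto rPtr [30, 31, 32, 33, 34, 35], .sub 36 30 rOne,
      .cond 36 (block [elems [(37, 32, 8)], addPow]) .skip, .sub rD rRecsEnd rPtr]),
    .add 30 rBufs rZero,
    .loop 30 (block [.sub 30 30 rOne, elems [(37, 30, 0)], addPow]),
    .const 37 9, addPow, .const 37 10, addPow, .const 37 11, addPow]

/-- The code of the initial node. -/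
def initSum (rs : List Rec) (b : ℕ) : ℕ :=
  (rs.map fun t => if 2 ≤ t.kind then 2 ^ (16 * t.src + 8) else 0).sum +
    ((List.range b).map fun x => 2 ^ (16 * x)).sum + 2 ^ 9 + 2 ^ 10 + 2 ^ 11

theorem initCode_spec {l pre post : List ℕ} {ps U b : ℕ} {s : State} {rs : List Rec}
    (hp : PowTable l ps U) (h : Word l s) (hl : l = pre ++ rs.flatMap Rec.flat ++ post)
    (hps : s.reg rPow = ps) (hb : s.reg rRecs = pre.length)
    (he : s.reg rRecsEnd = pre.length + 6 * rs.length) (hbuf : s.reg rBufs = b)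
    (hrs : ∀ t ∈ rs, 16 * t.src + 8 < U) (hbU : 16 * b ≤ U) (h12 : 12 < U) :
    Tri initCode s (rs.length * 40 + b * 20 + 30) (fun u => Word l u ∧
      u.reg rCode = initSum rs b ∧
      ∀ r, r < 30 → r ∉ [rX, rCode, rPtr, rD] → u.reg r = s.reg r) := by
  unfold initCode
  rw [block]
  refine (Tri.seq (T₁ := 4) (T₂ := rs.length * 40 + b * 20 + 26)
    (Tri.of_eval rfl (by simp [block, cost]) ?_)).mono (by omega) fun _ hu => hu
  set s₁ := (block _).eval s with hs₁
  have hfr₁ : ∀ r, r ∉ [rCode, rPtr, rD] → s₁.reg r = s.reg r := fun r hr =>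
    eval_reg_of_notMem_writes _ _ (by simp [block, writes] at hr ⊢; omega)
  have hw₁ := h.congr (u := s₁) rfl fun r hr => hfr₁ r (by simp; omega)
  have hc₁ : s₁.reg rCode = 0 := by simp [hs₁, block, eval, State.setReg_reg]
  have hptr : s₁.reg rPtr = pre.length := by
    simp [hs₁, block, eval, State.setReg_reg, hb, h.zero]
  have hD : s₁.reg rD = 6 * rs.length := by
    simp [hs₁, block, eval, State.setReg_reg, hb, h.zero, he]
  clear_value s₁
  rw [block]
  refine (Tri.seq (T₁ := rs.length * (39 + 1) + 1) (T₂ := b * 20 + 25) (Tri.weaken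
    (Q := fun u => Word l u ∧
      u.reg rCode = (rs.map fun t => if 2 ≤ t.kind then 2 ^ (16 * t.src + 8) else 0).sum ∧
      ∀ r, r < 30 → r ∉ [rX, rCode, rPtr, rD] → u.reg r = s.reg r) ?_ ?_)).mono (by omega)
    fun _ hu => hu
  · refine Tri.loop_list (fun rest u => ∃ pre', Word l u ∧
      l = pre' ++ rest.flatMap Rec.flat ++ post ∧ u.reg rPtr = pre'.length ∧
      (∀ t ∈ rest, 16 * t.src + 8 < U) ∧
      u.reg rRecsEnd = pre'.length + 6 * rest.length ∧ u.reg rD = 6 * rest.length ∧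
      u.reg rCode + (rest.map fun t => if 2 ≤ t.kind then 2 ^ (16 * t.src + 8) else 0).sum =
        (rs.map fun t => if 2 ≤ t.kind then 2 ^ (16 * t.src + 8) else 0).sum ∧
      ∀ r, r < 30 → r ∉ [rX, rCode, rPtr, rD] → u.reg r = s.reg r) ?_ ?_ rs s₁ ?_
    · rintro t rest u ⟨pre', hw, hl', hp', hrs', hre, hd, hsum, hfr⟩
      refine ⟨by rw [hd]; simp, ?_⟩
      rw [block]
      refine (Tri.seq (T₁ := 13) (T₂ := 26) (Tri.mono (readInto_spec hw rPtr
        [30, 31, 32, 33, 34, 35]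
        (pre := pre') (vs := t.flat) (post := rest.flatMap Rec.flat ++ post)
        (by rw [hl']; simp) hp'
        (by simp) (by simp) (by simp) (by simp [Rec.flat])) (by simp) ?_)).mono (by omega)
        fun _ hu => hu
      rintro u₁ ⟨hw₁, hp₁, hv₁, hf₁⟩
      simp only [List.map_cons, List.map_nil, Rec.flat, List.cons.injEq, and_true] at hv₁
      obtain ⟨v1, v2, v3, v4, v5, v6⟩ := hv₁
      rw [block]
      refine (Tri.seq (T₁ := 1) (T₂ := 25) (Tri.of_eval rfl (by simp [cost]) ?_)).mono
        (by omega) fun _ hu => hu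
      set u₂ := (Prog.sub 36 30 rOne).eval u₁ with hu₂
      have hf₂ : ∀ r, r ≠ 36 → u₂.reg r = u₁.reg r := fun r hr =>
        eval_reg_of_notMem_writes _ _ (by simpa [writes] using hr)
      have h36 : u₂.reg 36 = t.kind - 1 := by
        simp [hu₂, eval, State.setReg_reg, v1, hw₁.one]
      have hw₂ := hw₁.congr (u := u₂) rfl fun r hr => hf₂ r (by omega)
      clear_value u₂
      rw [block]
      refine (Tri.seq (T₁ := 15) (T₂ := 2) (Tri.weaken (Q := fun u' => Word l u' ∧
        u'.reg rCode = u₂.reg rCode + (if 2 ≤ t.kind then 2 ^ (16 * t.src + 8) else 0) ∧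
        ∀ r, r ∉ [rX, rCode, 37] → u'.reg r = u₂.reg r) ?_ ?_)).mono (by omega) fun _ hu => hu
      · refine (Tri.cond (T := 14) ?_ ?_).mono le_rfl fun _ hu => hu
        · intro h0
          rw [h36] at h0
          rw [block]
          refine (Tri.seq (T₁ := 8) (T₂ := 5) (Tri.mono (elems_spec hw₂ [(37, 32, 8)] (by simp)
            (by simp)) (by simp) ?_)).mono (by omega) fun _ hu => hu
          rintro u₃ ⟨hw₃, he₃, hf₃⟩
          simp only [List.mem_cons, List.not_mem_nil, or_false, forall_eq] at he₃
          simp only [List.map_cons, List.map_nil] at hf₃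
          rw [hf₂ _ (by simp), v3] at he₃
          rw [block]
          refine (Tri.seq (T₁ := 4) (T₂ := 1) (Tri.weaken (addPow_spec hp hw₃ (by
            rw [hf₃ _ (by simp) (by simp), hf₂ _ (by simp), hf₁ _ (by simp),
              hfr _ (by simp) (by simp), hps]) he₃ (hrs' t (by simp))) ?_)).mono
            (by omega) fun _ hu => hu
          rintro u₄ ⟨hw₄, hc₄, hf₄⟩
          refine Tri.of_eval rfl le_rfl ?_
          simp only [block, eval]
          refine ⟨hw₄, ?_, fun r hr => ?_⟩
          · rw [hc₄, if_pos (by omega), hf₃ _ (by simp) (by simp)]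
          · simp at hr
            rw [hf₄ _ (by simp; omega), hf₃ _ (by omega) (by simp; omega)]
        · intro h0
          rw [h36] at h0
          refine Tri.of_eval rfl (by simp [cost]) ?_
          simp only [eval]
          exact ⟨hw₂, by rw [if_neg (by omega), add_zero], fun _ _ => by trivial⟩
      · rintro u₃ ⟨hw₃, hc₃, hf₃⟩
        refine Tri.of_eval rfl (by simp [block, cost]) ?_
        have hf₅ : ∀ r, r ≠ rD → ((block [Prog.sub rD rRecsEnd rPtr]).eval u₃).reg r = u₃.reg r :=
          fun r hr => eval_reg_of_notMem_writes _ _ (by simpa [block, writes] using hr)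
        have hend : u₃.reg rRecsEnd = pre'.length + 6 * (rest.length + 1) := by
          rw [hf₃ _ (by simp), hf₂ _ (by simp), hf₁ _ (by simp), hre]
          simp
        have hp' : u₃.reg rPtr = pre'.length + 6 := by
          rw [hf₃ _ (by simp), hf₂ _ (by simp), hp₁]
          simp [Rec.flat]
        refine ⟨pre' ++ t.flat, ?_, by rw [hl']; simp, ?_, fun t' ht' => hrs' t' (by simp [ht']),
          ?_, ?_, ?_, ?_⟩
        · exact Word.congr (s := u₃) hw₃ rfl fun r hr => hf₅ r (by omega)
        · rw [hf₅ _ (by simp), hp']; simp [Rec.flat]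
        · rw [hf₅ _ (by simp), hend]; simp [Rec.flat]; ring
        · simp only [block, eval, State.setReg_reg, if_true]
          rw [hend, hp']; omega
        · rw [hf₅ _ (by simp), hc₃, ← hsum, hf₂ _ (by simp), hf₁ _ (by simp), List.map_cons,
            List.sum_cons, add_assoc]
        · intro r hr hr'
          simp at hr'
          rw [hf₅ _ (by omega), hf₃ _ (by simp; omega), hf₂ _ (by omega), hf₁ _ (by simp; omega),
            hfr _ hr (by simp; omega)]
    · rintro u ⟨pre', hw, hl', hp', hrs', hre, hd, hsum, hfr⟩
      exact ⟨by simpa using hd, hw, by simpa using hsum, hfr⟩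
    · refine ⟨pre, hw₁, hl, hptr, hrs, by rw [hfr₁ _ (by simp), he], hD, by rw [hc₁, zero_add],
        fun r _ hr => hfr₁ r ?_⟩
      simp at hr ⊢; omega
  rintro s₂ ⟨hw₂, hc₂, hf₂⟩
  rw [block]
  refine (Tri.seq (T₁ := 1) (T₂ := b * 20 + 24) (Tri.of_eval rfl (by simp [cost]) ?_)).mono
    (by omega) fun _ hu => hu
  set s₃ := (Prog.add 30 rBufs rZero).eval s₂ with hs₃
  have hfr₃ : ∀ r, r ≠ 30 → s₃.reg r = s₂.reg r := fun r hr =>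
    eval_reg_of_notMem_writes _ _ (by simpa [writes] using hr)
  have hw₃ := hw₂.congr (u := s₃) rfl fun r hr => hfr₃ r (by omega)
  have h30 : s₃.reg 30 = b := by
    simp [hs₃, eval, State.setReg_reg, hw₂.zero, hf₂, hbuf]
  clear_value s₃
  rw [block]
  refine (Tri.seq (T₁ := b * (19 + 1) + 1) (T₂ := 23) (Tri.weaken
    (Q := fun u => Word l u ∧
      u.reg rCode = s₃.reg rCode + ((List.range b).map fun x => 2 ^ (16 * x)).sum ∧
      ∀ r, r < 30 → r ∉ [rX, rCode] → u.reg r = s₃.reg r) ?_ ?_)).mono (by omega)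
    fun _ hu => hu
  · refine Tri.loop_count (fun n u => Word l u ∧ u.reg 30 = n ∧ n ≤ b ∧
      u.reg rCode + ((List.range n).map fun x => 2 ^ (16 * x)).sum =
        s₃.reg rCode + ((List.range b).map fun x => 2 ^ (16 * x)).sum ∧
      ∀ r, r < 30 → r ∉ [rX, rCode] → u.reg r = s₃.reg r) ?_ ?_ b s₃ ?_
    · rintro n u ⟨hw, h0, hn, hsum, hfr⟩
      refine ⟨by omega, ?_⟩
      rw [block]
      refine (Tri.seq (T₁ := 1) (T₂ := 18) (Tri.of_eval rfl (by simp [cost]) ?_)).mono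
        (by omega) fun _ hu => hu
      set u₁ := (Prog.sub 30 30 rOne).eval u with hu₁
      have hf₁ : ∀ r, r ≠ 30 → u₁.reg r = u.reg r := fun r hr =>
        eval_reg_of_notMem_writes _ _ (by simpa [writes] using hr)
      have hw₁ := hw.congr (u := u₁) rfl fun r hr => hf₁ r (by omega)
      have h30' : u₁.reg 30 = n := by simp [hu₁, eval, State.setReg_reg, h0, hw.one]
      clear_value u₁
      rw [block]
      refine (Tri.seq (T₁ := 8) (T₂ := 5) (Tri.mono (elems_spec hw₁ [(37, 30, 0)] (by simp)
        (by simp)) (by simp) ?_)).mono (by omega) fun _ hu => hu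
      rintro u₂ ⟨hw₂, he₂, hf₂⟩
      simp only [List.mem_cons, List.not_mem_nil, or_false, forall_eq, h30', add_zero] at he₂
      simp only [List.map_cons, List.map_nil] at hf₂
      rw [block]
      refine (Tri.seq (T₁ := 4) (T₂ := 1) (Tri.weaken (addPow_spec hp hw₂ (by
        rw [hf₂ _ (by simp) (by simp), hf₁ _ (by simp), hfr _ (by simp) (by simp),
          hfr₃ _ (by simp), ‹∀ r, r < 30 → r ∉ [rX, rCode, rPtr, rD] → s₂.reg r = s.reg r› _
          (by simp) (by simp), hps]) he₂ (by omega)) ?_)).mono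
        (by omega) fun _ hu => hu
      rintro u₄ ⟨hw₄, hc₄, hf₄⟩
      refine Tri.of_eval rfl le_rfl ?_
      simp only [block, eval]
      refine ⟨hw₄, ?_, by omega, ?_, fun r hr hr' => ?_⟩
      · rw [hf₄ _ (by simp), hf₂ _ (by simp) (by simp), h30']
      · rw [hc₄, hf₂ _ (by simp) (by simp), hf₁ _ (by simp), ← hsum, List.range_succ]
        simp; ring
      · simp at hr'
        rw [hf₄ _ (by simp; omega), hf₂ _ (by omega) (by simp; omega), hf₁ _ (by omega),
          hfr _ hr (by simp; omega)]
    · rintro u ⟨hw, h0, hn, hsum, hfr⟩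
      exact ⟨h0, hw, by simpa using hsum, hfr⟩
    · exact ⟨hw₃, h30, le_rfl, rfl, fun _ _ _ => rfl⟩
  rintro s₄ ⟨hw₄, hc₄, hf₄⟩
  have hpow₄ : s₄.reg rPow = ps := by
    rw [hf₄ _ (by simp) (by simp), hfr₃ _ (by simp), hf₂ _ (by simp) (by simp), hps]
  have key : ∀ (e : ℕ) (u : State), e < U → Word l u → u.reg rPow = ps →
      Tri (.seq (.const 37 e) addPow) u 5 (fun u' => Word l u' ∧
        u'.reg rCode = u.reg rCode + 2 ^ e ∧ ∀ r, r ∉ [37, rCode] → u'.reg r = u.reg r) := by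
    intro e u he hu hpu
    refine (Tri.seq (T₁ := 1) (T₂ := 4) (Tri.of_eval rfl (by simp [cost]) ?_)).mono
      (by omega) fun _ hu => hu
    have hfc : ∀ r, r ≠ 37 → ((Prog.const 37 e).eval u).reg r = u.reg r := fun r hr =>
      eval_reg_of_notMem_writes _ _ (by simpa [writes] using hr)
    refine Tri.weaken (addPow_spec hp (hu.congr rfl fun r hr => hfc r (by omega))
      (by rw [hfc _ (by simp), hpu]) (e := e) (by simp [eval, State.setReg_reg]) he) ?_
    rintro u' ⟨h1, h2, h3⟩
    refine ⟨h1, by rw [h2, hfc _ (by simp)], fun r hr => ?_⟩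
    rw [h3 r hr]
    simp at hr
    exact hfc r (by omega)
  -- Regroups a sequence so that `key` applies to its first two programs.
  have assoc : ∀ {c d e : Prog} {s : State} {T : ℕ} {Q : State → Prop},
      Tri (.seq (.seq c d) e) s T Q → Tri (.seq c (.seq d e)) s T Q := by
    rintro c d e s T Q ⟨t, u, hr, ht, hu⟩
    cases hr with
    | seq h₁ h₂ =>
      cases h₁ with
      | seq h₃ h₄ => exact ⟨_, u, Runs.seq h₃ (Runs.seq h₄ h₂), by omega, hu⟩
  rw [block, block]
  refine assoc ((Tri.seq (T₁ := 5) (T₂ := 18) (Tri.weaken (key 9 s₄ (by omega) hw₄ hpow₄)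
    ?_)).mono (by omega) fun _ hu => hu)
  rintro s₅ ⟨hw₅, hc₅, hf₅⟩
  rw [block, block]
  refine assoc ((Tri.seq (T₁ := 5) (T₂ := 13) (Tri.weaken (key 10 s₅ (by omega) hw₅
    (by rw [hf₅ _ (by simp), hpow₄])) ?_)).mono (by omega) fun _ hu => hu)
  rintro s₆ ⟨hw₆, hc₆, hf₆⟩
  rw [block, block]
  refine assoc ((Tri.seq (T₁ := 5) (T₂ := 8) (Tri.weaken (key 11 s₆ (by omega) hw₆
    (by rw [hf₆ _ (by simp), hf₅ _ (by simp), hpow₄])) ?_)).mono (by omega) fun _ hu => hu)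
  rintro s₇ ⟨hw₇, hc₇, hf₇⟩
  refine Tri.of_eval rfl (by simp [block, cost]) ?_
  simp only [block, eval]
  refine ⟨hw₇, ?_, fun r hr hr' => ?_⟩
  · rw [hc₇, hc₆, hc₅, hc₄, hfr₃ _ (by simp), hc₂, initSum]
  · simp at hr'
    rw [hf₇ _ (by simp; omega), hf₆ _ (by simp; omega), hf₅ _ (by simp; omega),
      hf₄ _ hr (by simp; omega), hfr₃ _ (by omega), hf₂ _ hr (by simp; omega)]

end RAM

/-! ### Correctness and running time of the decision procedure -/

namespace RAM

open Prog

/-- The decision procedure for systems with at least one buffer and one message. -/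
def decideBody : Prog :=
  block [block [.add rCnt rProcs rZero, .add rRecs rTop rZero], parse,
    .add rRecsEnd rTop rZero, .add rRules rTop rZero, genRules,
    -- Each element is `16 z + g` with `g < 16` and `z` either `0` or the number of a process,
    -- buffer, message or state. So `16` times the sum of these four cardinalities plus one exceeds
    -- all elements.
    block [.add rRulesEnd rTop rZero, .add rU rProcs rBufs, .add rU rU rMsgs, .add rU rU rOff,
      .add rU rU rOne, .add rU rU rU, .add rU rU rU, .add rU rU rU, .add rU rU rU],
    powTable, initCode,
    block [.add rBits rTop rZero, .add rBase rBits rU, .add rTail rBase rOne,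
      .add rHead rBase rOne], search,
    .cond rBad (.const 0 0) (.const 0 1)]

/-- The decision procedure. -/
def decideProg : Prog :=
  -- The input length, delivered in register `0`, becomes the first free address. Register `0` then
  -- serves as the constant zero and finally as the output.
  block [block [.add rTop rZero rTop, .const 0 0, .const rOne 1],
    readInto rIn [rProcs, rBufs, rMsgs],
    .cond rBufs (.cond rMsgs decideBody (.const 0 1)) (.const 0 1)]

/-- The bound for the elements. -/
def elemBound (k b v L : ℕ) : ℕ := 16 * (k + b + v + L + 1)

/-- A bound for the running time of the main part. -/
def timeBound (k b m R U N M : ℕ) : ℕ :=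
  k * (m * 31 + 70) + R * (R * 580 + 460) + U * 10 + (R * 40 + b * 20) +
    (N * (U * 15 + M * 250 + 40) + U * 15) + 200

/-- All facts about systems enter as hypotheses on records and rules, so this concerns the machine
alone. -/
theorem decideBody_spec {k b v m N L U : ℕ} {ds : List AutData} {s : State} {w : List ℕ}
    {rs : List Rec} (hw : w = [k, b, v] ++ ds.flatMap AutData.code) (hrs : rs = recsFrom 0 0 ds)
    (hL : L = (ds.map AutData.numStates).sum) (hU : U = elemBound k b v L)
    (h : Word w s) (hk : ds.length = k)
    (hin : s.reg rIn = 3) (hK : s.reg rProcs = k) (hB : s.reg rBufs = b) (hV : s.reg rMsgs = v)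
    (hoff : s.reg rOff = 0) (hproc : s.reg rProc = 0) (hbad : s.reg rBad = 0)
    (hm : ∀ D ∈ ds, D.trans.length ≤ m)
    (hrec : ∀ t ∈ rs, 16 * t.src + 8 < U)
    (hrules : ∀ r ∈ rulesOf rs, r.Valid U)
    (hinit : initSum rs b < 2 ^ U)
    (hN : ∀ Q : List ℕ, Q.Nodup → (∀ c ∈ Q, RuleReach (rulesOf rs) (initSum rs b) c) →
      Q.length ≤ N) :
    Tri decideBody s (timeBound k b m rs.length U N (rulesOf rs).length)
      (fun u => ((∃ c, RuleReach (rulesOf rs) (initSum rs b) c ∧ c.testBit 12) ∧ u.reg 0 = 0) ∨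
        ((¬ ∃ c, RuleReach (rulesOf rs) (initSum rs b) c ∧ c.testBit 12) ∧ u.reg 0 = 1)) := by
  set M := (rulesOf rs).length with hM
  have hUv : U = 16 * (k + b + v + L + 1) := hU
  unfold decideBody timeBound
  set T₁ := k * (m * 31 + 70) with hT₁
  set T₂ := rs.length * (rs.length * 580 + 460) with hT₂
  set T₃ := N * (U * 15 + M * 250 + 40) with hT₃
  rw [block]
  refine (Tri.seq (T₁ := 3) (T₂ := T₁ + T₂ + U * 10 + (rs.length * 40 + b * 20) + (T₃ + U * 15)
    + 190) (Tri.of_eval rfl (by simp [block, cost]) ?_)).mono (by omega) fun _ hu => hu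
  set s₁ := (block _).eval s with hs₁
  have hf₁ : ∀ r, r ∉ [rCnt, rRecs] → s₁.reg r = s.reg r := fun r hr =>
    eval_reg_of_notMem_writes _ _ (by simpa [block, writes] using hr)
  have hw₁ := h.congr (u := s₁) rfl fun r hr => hf₁ r (by simp; omega)
  have hcnt : s₁.reg rCnt = ds.length := by
    simp [hs₁, block, eval, State.setReg_reg, hK, h.zero, hk]
  have hR₁ : s₁.reg rRecs = w.length := by
    simp [hs₁, block, eval, State.setReg_reg, h.top, h.zero]
  clear_value s₁
  rw [block]
  have hp := parse_spec (s := s₁) (m := m) (pre := [k, b, v]) (post := []) ds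
    (by rw [List.append_nil, ← hw]; exact hw₁) hm (by rw [hf₁ _ (by simp), hin]; rfl) hcnt
  rw [hf₁ rProc (by simp), hf₁ rOff (by simp), hproc, hoff, hk, List.append_nil, zero_add, ← hw,
    ← hrs, ← hL] at hp
  refine (Tri.seq (T₁ := T₁ + 1) (T₂ := T₂ + U * 10 + (rs.length * 40 + b * 20) + (T₃ + U * 15)
    + 180) (Tri.weaken hp ?_)).mono (by omega) fun _ hu => hu
  rintro s₂ ⟨hw₂, hoff₂, hf₂⟩
  rw [block]
  refine (Tri.seq (T₁ := 1) (T₂ := T₂ + U * 10 + (rs.length * 40 + b * 20) + (T₃ + U * 15)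
    + 179) (Tri.of_eval rfl (by simp [cost]) ?_)).mono (by omega) fun _ hu => hu
  rw [block]
  refine (Tri.seq (T₁ := 1) (T₂ := T₂ + U * 10 + (rs.length * 40 + b * 20) + (T₃ + U * 15)
    + 178) (Tri.of_eval rfl (by simp [cost]) ?_)).mono (by omega) fun _ hu => hu
  set s₃ := (Prog.add rRules rTop rZero).eval ((Prog.add rRecsEnd rTop rZero).eval s₂) with hs₃
  have hf₃ : ∀ r, r ∉ [rRecsEnd, rRules] → s₃.reg r = s₂.reg r := by
    intro r hr
    simp at hr
    exact (eval_reg_of_notMem_writes _ _ (by simp [writes]; omega)).trans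
      (eval_reg_of_notMem_writes _ _ (by simp [writes]; omega))
  have hw₃ := hw₂.congr (u := s₃) rfl fun r hr => hf₃ r (by simp; omega)
  have hE₃ : s₃.reg rRecsEnd = w.length + 6 * rs.length := by
    have := hw₂.top
    rw [List.length_append, length_flat] at this
    simp [hs₃, eval, State.setReg_reg, hw₂.zero, this]
  have hRl₃ : s₃.reg rRules = (w ++ rs.flatMap Rec.flat).length := by
    simp [hs₃, eval, State.setReg_reg, hw₂.zero, hw₂.top]
  clear_value s₃
  rw [block]
  have hR₃ : s₃.reg rRecs = w.length := by
    rw [hf₃ _ (by simp), hf₂ _ (by simp), hR₁]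
  have hg := genRules_spec (s := s₃) (pre := w) (post := []) rs
    (by rw [List.append_nil]; exact hw₃) hR₃ hE₃
  rw [List.append_nil] at hg
  refine (Tri.seq (T₁ := T₂ + 5) (T₂ := U * 10 + (rs.length * 40 + b * 20) + (T₃ + U * 15)
    + 170) (Tri.weaken hg ?_)).mono (by omega) fun _ hu => hu
  rintro s₄ ⟨hw₄, hf₄⟩
  have hall₄ : ∀ r, r < 30 → r ∉ [rTop, rX, 25, 26, rPtr, rD, rRecsEnd, rRules, rIn, rCnt', rOff,
      rProc, rCnt, rRecs] → s₄.reg r = s.reg r := by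
    intro r hr hr'
    simp at hr'
    rw [hf₄ r hr (by simp; omega), hf₃ _ (by simp; omega), hf₂ _ (by simp; omega),
      hf₁ _ (by simp; omega)]
  rw [block]
  refine (Tri.seq (T₁ := 10) (T₂ := U * 10 + (rs.length * 40 + b * 20) + (T₃ + U * 15)
    + 160) (Tri.of_eval rfl (by simp [block, cost]) ?_)).mono (by omega) fun _ hu => hu
  set s₅ := (block _).eval s₄ with hs₅
  have hf₅ : ∀ r, r ∉ [rRulesEnd, rU] → s₅.reg r = s₄.reg r := fun r hr =>
    eval_reg_of_notMem_writes _ _ (by simpa [block, writes] using hr)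
  have hw₅ := hw₄.congr (u := s₅) rfl fun r hr => hf₅ r (by simp; omega)
  have hRE₅ : s₅.reg rRulesEnd = (w ++ rs.flatMap Rec.flat).length +
      ((rulesOf rs).flatMap Rule.flat).length := by
    rw [← List.length_append, ← hw₄.top]
    simp [hs₅, block, eval, State.setReg_reg, hw₄.zero]
  have hU₅ : s₅.reg rU = U := by
    have e1 : s₄.reg rProcs = k := by rw [hall₄ _ (by simp) (by simp), hK]
    have e2 : s₄.reg rBufs = b := by rw [hall₄ _ (by simp) (by simp), hB]
    have e3 : s₄.reg rMsgs = v := by rw [hall₄ _ (by simp) (by simp), hV]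
    have e4 : s₄.reg rOff = L := by
      rw [hf₄ _ (by simp) (by simp), hf₃ _ (by simp), hoff₂]
    simp [hs₅, block, eval, State.setReg_reg, hw₄.one, e1, e2, e3, e4, hUv]
    ring
  clear_value s₅
  rw [block]
  refine (Tri.seq (T₁ := U * 10 + 10) (T₂ := (rs.length * 40 + b * 20) + (T₃ + U * 15)
    + 150) (Tri.weaken (powTable_spec hw₅ hU₅) ?_)).mono (by omega) fun _ hu => hu
  rintro s₆ ⟨hw₆, hP₆, hf₆⟩
  set l := w ++ rs.flatMap Rec.flat ++ (rulesOf rs).flatMap Rule.flat ++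
    (List.range U).map (2 ^ ·) with hl
  have hpt : PowTable l (w ++ rs.flatMap Rec.flat ++ (rulesOf rs).flatMap Rule.flat).length U := by
    refine ⟨by simp only [hl, List.length_append, List.length_map,
      List.length_range]; omega, fun e he => ?_⟩
    rw [hl, List.getD_append_right _ _ _ _ (by omega), Nat.add_sub_cancel_left]
    simp [List.getD_eq_getElem?_getD, he]
  have hall₆ : ∀ r, r < 30 → r ∉ [rTop, rPow, rRulesEnd, rU] → s₆.reg r = s₄.reg r := by
    intro r hr hr'
    simp at hr'
    rw [hf₆ _ (by simp; omega), hf₅ _ (by simp; omega)]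
  rw [block]
  have hi := initCode_spec (s := s₆) (pre := w) (post := (rulesOf rs).flatMap Rule.flat ++
    (List.range U).map (2 ^ ·)) (rs := rs) (b := b) hpt hw₆ (by simp [hl]) hP₆
    (by rw [hall₆ _ (by simp) (by simp), hf₄ _ (by simp) (by simp), hR₃])
    (by rw [hall₆ _ (by simp) (by simp), hf₄ _ (by simp) (by simp), hE₃])
    (by rw [hall₆ _ (by simp) (by simp), hall₄ _ (by simp) (by simp), hB])
    hrec (by omega) (by omega)
  refine (Tri.seq (T₁ := rs.length * 40 + b * 20 + 30) (T₂ := T₃ + U * 15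
    + 110) (Tri.weaken hi ?_)).mono (by omega) fun _ hu => hu
  rintro s₇ ⟨hw₇, hc₇, hf₇⟩
  rw [block]
  refine (Tri.seq (T₁ := 5) (T₂ := T₃ + U * 15 + 100)
    (Tri.of_eval rfl (by simp [block, cost]) ?_)).mono (by omega) fun _ hu => hu
  set s₈ := (block _).eval s₇ with hs₈
  have hf₈ : ∀ r, r ∉ [rBits, rBase, rTail, rHead] → s₈.reg r = s₇.reg r := fun r hr =>
    eval_reg_of_notMem_writes _ _ (by simpa [block, writes] using hr)
  have hw₈ := hw₇.congr (u := s₈) rfl fun r hr => hf₈ r (by simp; omega)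
  have hU₇ : s₇.reg rU = U := by
    rw [hf₇ _ (by simp) (by simp), hf₆ _ (by simp), hU₅]
  have hbits : s₈.reg rBits = l.length := by
    simp [hs₈, block, eval, State.setReg_reg, hw₇.zero, hw₇.top]
  have hbase : s₈.reg rBase = l.length + U := by
    simp [hs₈, block, eval, State.setReg_reg, hw₇.zero, hw₇.top, hU₇]
  have htail : s₈.reg rTail = l.length + U + 1 := by
    simp [hs₈, block, eval, State.setReg_reg, hw₇.zero, hw₇.top, hU₇, hw₇.one]
  have hhead : s₈.reg rHead = l.length + U + 1 := by
    simp [hs₈, block, eval, State.setReg_reg, hw₇.zero, hw₇.top, hU₇, hw₇.one]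
  clear_value s₈
  -- The memory beyond the static part is still zero, which is the correct state of both tables for
  -- the empty queue.
  have hzero : ∀ a, l.length ≤ a → s₈.mem a = 0 := fun a ha => by
    rw [hw₈.holds, List.getD_eq_default _ _ ha]
  have hcore : Core l (w ++ rs.flatMap Rec.flat ++ (rulesOf rs).flatMap Rule.flat).length U []
      s₈ :=
    { low := fun a _ => hw₈.holds a
      visited := fun d => by rw [hzero _ (by omega)]; simp
      queue := fun j => by rw [hzero _ (by omega)]; simp
      zero := hw₈.zero
      one := hw₈.one
      bitsReg := hbits
      baseReg := hbase
      tailReg := by rw [htail]; simp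
      powReg := by rw [hf₈ _ (by simp), hf₇ _ (by simp) (by simp), hP₆] }
  have hs := search_spec (s := s₈) (c₀ := initSum rs b) (N := N) (rules := rulesOf rs)
    (pre := w ++ rs.flatMap Rec.flat) (post := (List.range U).map (2 ^ ·)) hpt hcore (by rw [hl])
    hrules
    (by rw [hf₈ _ (by simp), hf₇ _ (by simp) (by simp), hall₆ _ (by simp) (by simp),
      hf₄ _ (by simp) (by simp), hRl₃])
    (by rw [hf₈ _ (by simp), hf₇ _ (by simp) (by simp), hf₆ _ (by simp), hRE₅])
    (by rw [hf₈ _ (by simp), hc₇]) (by rw [hf₈ _ (by simp), hU₇]) hinit (by omega) hhead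
    (by rw [hf₈ _ (by simp), hf₇ _ (by simp) (by simp), hall₆ _ (by simp) (by simp),
      hall₄ _ (by simp) (by simp), hbad]) hN
  rw [block]
  refine (Tri.seq (T₁ := T₃ + U * 15 + 40) (T₂ := 10) (Tri.weaken hs ?_)).mono (by omega)
    fun _ hu => hu
  rintro u ⟨hbad', -, -⟩
  refine Tri.of_eval rfl (by simp [block, cost]) ?_
  by_cases h0 : u.reg rBad = 0
  · right
    refine ⟨fun hex => hbad'.mpr hex h0, ?_⟩
    simp [block, eval, State.setReg_reg, h0]
  · left
    refine ⟨hbad'.mp h0, ?_⟩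
    simp [block, eval, State.setReg_reg, h0]

/-- Without buffers or without messages there are no actions, and the product in the time bound
vanishes. This case is therefore answered in constant time before any parsing. -/
theorem decideProg_spec {k b v T : ℕ} {w w' : List ℕ} {P : Prop} (hw : w = [k, b, v] ++ w')
    (hb : b = 0 ∨ v = 0 → ¬ P)
    (hbody : b ≠ 0 → v ≠ 0 → ∀ s, Word w s → s.reg rIn = 3 → s.reg rProcs = k →
      s.reg rBufs = b → s.reg rMsgs = v → s.reg rOff = 0 → s.reg rProc = 0 → s.reg rBad = 0 →
      Tri decideBody s T (fun u => (P ∧ u.reg 0 = 0) ∨ (¬ P ∧ u.reg 0 = 1))) :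
    Tri decideProg (initState w) (if b = 0 ∨ v = 0 then 20 else T + 20)
      (fun u => (P ∧ u.reg 0 = 0) ∨ (¬ P ∧ u.reg 0 = 1)) := by
  unfold decideProg
  rw [block]
  set T' := if b = 0 ∨ v = 0 then 20 else T + 20 with hT'
  have hT0 : 20 ≤ T' := by rw [hT']; split_ifs <;> omega
  refine (Tri.seq (T₁ := 5) (T₂ := T' - 5) (Tri.of_eval rfl (by simp [block, cost]) ?_)).mono
    (by omega) fun _ hu => hu
  set s₁ := (block _).eval (initState w) with hs₁
  have hw₁ : Word w s₁ :=
    { holds := fun a => rfl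
      top := by simp [hs₁, block, eval, State.setReg_reg, initState]
      zero := by simp [hs₁, block, eval, State.setReg_reg, initState]
      one := by simp [hs₁, block, eval, State.setReg_reg, initState] }
  have hr₁ : ∀ r, 2 < r → s₁.reg r = 0 := fun r hr => by
    simp [hs₁, block, eval, State.setReg_reg, initState, show r ≠ 0 by omega,
      show r ≠ 1 by omega, show r ≠ 2 by omega]
  clear_value s₁
  rw [block]
  refine (Tri.seq (T₁ := 7) (T₂ := T' - 12) (Tri.weaken (readInto_spec (pre := []) hw₁ rIn
    [rProcs, rBufs, rMsgs] hw (by rw [hr₁ _ (by simp)]; rfl) (by simp) (by simp) (by simp)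
    (by simp)) ?_)).mono (by omega) fun _ hu => hu
  rintro s₂ ⟨hw₂, hin, hv, hf⟩
  simp only [List.map_cons, List.map_nil, List.cons.injEq, and_true] at hv
  obtain ⟨hK, hB, hV⟩ := hv
  have hr₂ : ∀ r, r ∉ [0, 1, 2, rIn, rProcs, rBufs, rMsgs] → s₂.reg r = 0 := fun r hr => by
    simp at hr
    rw [hf r (by simp; omega), hr₁ r (by omega)]
  have hone : b = 0 ∨ v = 0 → Tri (.const 0 1) s₂ 1
      (fun u => (P ∧ u.reg 0 = 0) ∨ (¬ P ∧ u.reg 0 = 1)) := fun h0 =>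
    Tri.of_eval rfl (by simp [cost]) (Or.inr ⟨hb h0, by simp [eval, State.setReg_reg]⟩)
  rw [block]
  refine (Tri.seq (T₁ := T' - 13) (T₂ := 1) (Q := fun u => (P ∧ u.reg 0 = 0) ∨ (¬ P ∧ u.reg 0 = 1))
    (Tri.weaken ?_ fun u hu => Tri.of_eval (c := block []) rfl (by simp [block, cost]) hu)).mono
    (by omega) fun _ hu => hu
  refine (Tri.cond (T := T' - 14) (fun hb0 => Tri.mono (T := (T' - 16) + 1)
    (Q := fun u => (P ∧ u.reg 0 = 0) ∨ (¬ P ∧ u.reg 0 = 1)) (Tri.cond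
    (T := T' - 16) (fun hv0 => ?_) fun hv0 => ?_) (by omega) fun _ hu => hu) fun hb0 => ?_).mono
    (T' := T' - 13) (by omega) fun _ hu => hu
  · rw [hB] at hb0
    rw [hV] at hv0
    refine (hbody hb0 hv0 s₂ hw₂ hin hK hB hV (hr₂ _ (by simp)) (hr₂ _ (by simp))
      (hr₂ _ (by simp))).mono ?_ fun _ hu => hu
    rw [hT', if_neg (by tauto)]
    omega
  · exact (hone (Or.inr (hV ▸ hv0))).mono (T' := T' - 16) (by omega) fun _ hu => hu
  · exact (hone (Or.inl (hB ▸ hb0))).mono (by omega) fun _ hu => hu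

end RAM

/-! ### Combinatorics of executions -/

namespace FIFO

namespace System

/-! ### Runs -/

section Runs

variable {π ι μ : Type} {S : System π ι μ}

theorem owner_unique {p q : π} {a : Action ι μ} (hp : a ∈ (S.aut p).actions)
    (hq : a ∈ (S.aut q).actions) : p = q := by
  by_contra h
  exact Finset.disjoint_left.mp (S.disjoint p q h) hp hq

theorem Run.append {x y z : S.Config} {e f : List (Action ι μ)} (h : S.Run x e y)
    (h' : S.Run y f z) : S.Run x (e ++ f) z := by
  induction h with
  | nil => exact h'
  | cons hs _ ih => exact Run.cons hs (ih h')

theorem Run.single {x y : S.Config} {a : Action ι μ} (h : S.Step x a y) : S.Run x [a] y :=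
  Run.cons h (Run.nil _)

theorem run_append_iff {x z : S.Config} {e f : List (Action ι μ)} :
    S.Run x (e ++ f) z ↔ ∃ y, S.Run x e y ∧ S.Run y f z := by
  refine ⟨fun h => ?_, fun ⟨y, h, h'⟩ => h.append h'⟩
  induction e generalizing x with
  | nil => exact ⟨x, Run.nil x, h⟩
  | cons a e ih =>
    cases h with
    | cons hs h =>
      obtain ⟨y, h₁, h₂⟩ := ih h
      exact ⟨y, Run.cons hs h₁, h₂⟩

theorem run_singleton_iff {x y : S.Config} {a : Action ι μ} : S.Run x [a] y ↔ S.Step x a y := by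
  refine ⟨fun h => ?_, Run.single⟩
  cases h with
  | cons hs h => cases h; exact hs

theorem BufStep.other {b c : ι → List μ} {a : Action ι μ} (h : BufStep b a c) {j : ι}
    (hj : j ≠ a.1) : c j = b j := h.2 j hj

theorem Run.buf_eq {x y : S.Config} {e : List (Action ι μ)} (h : S.Run x e y) {i : ι}
    (hi : ∀ a ∈ e, a.1 ≠ i) : y.buf i = x.buf i := by
  induction h with
  | nil => rfl
  | cons hs _ ih =>
    rw [ih fun a ha => hi a (by simp [ha]), hs.2.other fun hh => hi _ (by simp) hh.symm]

/-- A buffer that is not received from keeps its first message. -/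
theorem Run.head {x y : S.Config} {e : List (Action ι μ)} (h : S.Run x e y) {i : ι} {m : μ}
    (hi : ∀ a ∈ e, a.1 = i → a.2.1 = Dir.send) (hx : ∃ t, x.buf i = m :: t) :
    ∃ t, y.buf i = m :: t := by
  induction h with
  | nil => exact hx
  | @cons x y z a e hs _ ih =>
    refine ih (fun a ha => hi a (by simp [ha])) ?_
    obtain ⟨t, ht⟩ := hx
    obtain ⟨j, d, n⟩ := a
    by_cases hj : i = j
    · subst hj
      obtain rfl : d = Dir.send := hi (i, d, n) (by simp) rfl
      exact ⟨t ++ [n], by rw [hs.2.1, ht]; rfl⟩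
    · exact ⟨t, by rw [hs.2.other hj, ht]⟩

theorem countOn_append [DecidableEq ι] (d : Dir) (i : ι) (e f : List (Action ι μ)) :
    countOn d i (e ++ f) = countOn d i e + countOn d i f := List.countP_append

theorem countOn_singleton [DecidableEq ι] (d : Dir) (i : ι) (a : Action ι μ) :
    countOn d i [a] = if a.1 = i ∧ a.2.1 = d then 1 else 0 := by
  simp [countOn, List.countP_cons]

theorem Run.count [DecidableEq ι] {x y : S.Config} {e : List (Action ι μ)} (h : S.Run x e y)
    (i : ι) : (y.buf i).length + countOn Dir.recv i e = (x.buf i).length + countOn Dir.send i e := by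
  induction h with
  | nil => simp [countOn]
  | @cons x y z a e hs _ ih =>
    rw [← List.singleton_append, countOn_append, countOn_append, countOn_singleton,
      countOn_singleton]
    obtain ⟨j, d, n⟩ := a
    by_cases hj : i = j
    · subst hj
      cases d with
      | send =>
        have := congrArg List.length hs.2.1
        simp at this ⊢
        omega
      | recv =>
        have := congrArg List.length hs.2.1
        simp at this ⊢
        omega
    · have := congrArg List.length (hs.2.other hj)
      simp [Ne.symm hj]
      omega

theorem Run.count_init [DecidableEq ι] {y : S.Config} {e : List (Action ι μ)}
    (h : S.Run S.initConfig e y) (i : ι) :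
    (y.buf i).length + countOn Dir.recv i e = countOn Dir.send i e := by
  simpa [initConfig] using h.count i

/-- Two steps of different processes may be exchanged if their effects on the buffers may. -/
theorem Step.swap {x y z : S.Config} {a b : Action ι μ} (ha : S.Step x a y) (hb : S.Step y b z)
    (hab : ¬ S.SameOwner a b)
    (hbuf : ∃ c, BufStep x.buf b c ∧ BufStep c a z.buf) :
    ∃ y', S.Step x b y' ∧ S.Step y' a z := by
  classical
  obtain ⟨⟨p, hp, hp'⟩, -⟩ := ha
  obtain ⟨⟨q, hq, hq'⟩, -⟩ := hb
  obtain ⟨c, hc, hc'⟩ := hbuf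
  have hpq : p ≠ q := by
    rintro rfl
    exact hab ⟨p, (S.aut p).trans_sub _ hp, (S.aut p).trans_sub _ hq⟩
  refine ⟨⟨Function.update x.state q (z.state q), c⟩, ⟨⟨q, ?_, fun r hr => ?_⟩, hc⟩,
    ⟨⟨p, ?_, fun r hr => ?_⟩, hc'⟩⟩
  · rw [hp' q hpq.symm] at hq
    simpa using hq
  · simp [hr]
  · rw [← hq' p hpq] at hp
    simpa [hpq] using hp
  · by_cases hrq : r = q
    · subst hrq; simp
    · simp [hrq, hq' r hrq, hp' r hr]

/-- Different owners and different buffers. -/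
def Indep (S : System π ι μ) (a b : Action ι μ) : Prop := ¬ S.SameOwner a b ∧ a.1 ≠ b.1

theorem Indep.commutes {a b : Action ι μ} (h : S.Indep a b) : S.Commutes a b :=
  ⟨h.1, fun hh => h.2 hh.1⟩

theorem Commutes.symm {a b : Action ι μ} (h : S.Commutes a b) : S.Commutes b a :=
  ⟨fun ⟨p, h1, h2⟩ => h.1 ⟨p, h2, h1⟩, fun hh => h.2 ⟨hh.1.symm, hh.2.symm⟩⟩

/-- Independence, unlike `Commutes`, also rules out a send and a receive on the same buffer, so the
two effects concern different words. -/
theorem Step.swap_of_indep {x y z : S.Config} {a b : Action ι μ} (ha : S.Step x a y)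
    (hb : S.Step y b z) (hab : S.Indep a b) : ∃ y', S.Step x b y' ∧ S.Step y' a z := by
  classical
  refine ha.swap hb hab.1 ⟨Function.update x.buf b.1 (z.buf b.1), ⟨?_, fun j hj => by simp [hj]⟩,
    ?_, fun j hj => ?_⟩
  · have h₁ := hb.2.1
    have h₂ := ha.2.other hab.2.symm
    obtain ⟨j, d, n⟩ := b
    cases d <;> simpa [h₂] using h₁
  · have h₁ := ha.2.1
    have h₂ := hb.2.other hab.2
    have h₃ := hab.2
    obtain ⟨j, d, n⟩ := a
    cases d <;> simpa [h₂, h₃] using h₁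
  · by_cases h : j = b.1
    · subst h; simp
    · simp [h, hb.2.other h, ha.2.other hj]

theorem Run.swap_step {x y z : S.Config} {e : List (Action ι μ)} {b : Action ι μ}
    (h : S.Run x e y) (hb : S.Step y b z) (he : ∀ a ∈ e, S.Indep a b) :
    ∃ y', S.Step x b y' ∧ S.Run y' e z := by
  induction h with
  | nil => exact ⟨z, hb, Run.nil z⟩
  | cons hs _ ih =>
    obtain ⟨y', h₁, h₂⟩ := ih hb fun a ha => he a (by simp [ha])
    obtain ⟨x', h₃, h₄⟩ := hs.swap_of_indep h₁ (he _ (by simp))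
    exact ⟨x', h₃, Run.cons h₄ h₂⟩

theorem Run.swap_run {x y z : S.Config} {e f : List (Action ι μ)}
    (h : S.Run x e y) (hf : S.Run y f z) (he : ∀ a ∈ e, ∀ b ∈ f, S.Indep a b) :
    ∃ y', S.Run x f y' ∧ S.Run y' e z := by
  induction hf generalizing x with
  | nil => exact ⟨x, Run.nil x, h⟩
  | cons hs _ ih =>
    obtain ⟨y', h₁, h₂⟩ := h.swap_step hs fun a ha => he a ha _ (by simp)
    obtain ⟨x', h₃, h₄⟩ := ih h₂ fun a ha b hb => he a ha b (by simp [hb])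
    exact ⟨x', Run.cons h₁ h₃, h₄⟩

/-- A receive may be advanced over the send on a nonempty buffer. -/
theorem Step.swap_recv {x y z : S.Config} {a : Action ι μ} {i : ι} {m : μ} (ha : S.Step x a y)
    (hb : S.Step y (i, Dir.recv, m) z) (hab : ¬ S.SameOwner a (i, Dir.recv, m))
    (hi : a.1 = i → a.2.1 = Dir.send) (hx : ∃ t, x.buf i = m :: t) :
    ∃ y', S.Step x (i, Dir.recv, m) y' ∧ S.Step y' a z := by
  classical
  by_cases h : a.1 = i
  · obtain ⟨j, d, n⟩ := a
    obtain rfl : d = Dir.send := hi h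
    obtain rfl : j = i := h
    obtain ⟨t, ht⟩ := hx
    refine ha.swap hb hab ⟨Function.update x.buf j t, ⟨by simpa using ht, fun k hk => by
      simp at hk; simp [hk]⟩, ?_, fun k hk => ?_⟩
    · have h₁ := ha.2.1
      have h₂ := hb.2.1
      simp only [ht, h₂] at h₁
      simpa using h₁
    · simp at hk
      simp [hk, hb.2.other (j := k) hk, ha.2.other (j := k) hk]
  · exact ha.swap_of_indep hb ⟨hab, h⟩

theorem Run.swap_recv {x y z : S.Config} {e : List (Action ι μ)} {i : ι} {m : μ}
    (h : S.Run x e y) (hb : S.Step y (i, Dir.recv, m) z)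
    (he : ∀ a ∈ e, ¬ S.SameOwner a (i, Dir.recv, m))
    (hi : ∀ a ∈ e, a.1 = i → a.2.1 = Dir.send) (hx : ∃ t, x.buf i = m :: t) :
    ∃ y', S.Step x (i, Dir.recv, m) y' ∧ S.Run y' e z := by
  induction h with
  | nil => exact ⟨z, hb, Run.nil z⟩
  | cons hs _ ih =>
    obtain ⟨y', h₁, h₂⟩ := ih hb (fun a ha => he a (by simp [ha])) (fun a ha => hi a (by simp [ha]))
      ((Run.single hs).head (by simpa using hi _ (by simp)) hx)
    obtain ⟨x', h₃, h₄⟩ := hs.swap_recv h₁ (he _ (by simp)) (hi _ (by simp)) hx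
    exact ⟨x', h₃, Run.cons h₄ h₂⟩

/-! ### Block runs -/

/-- A send, or an exchange: a send to an empty buffer followed by its receive. -/
def Block (S : System π ι μ) (x : S.Config) (e : List (Action ι μ)) (y : S.Config) : Prop :=
  S.Run x e y ∧ ∃ i m, e = [(i, Dir.send, m)] ∨
    (e = [(i, Dir.send, m), (i, Dir.recv, m)] ∧ x.buf i = [])

/-- A run that consists of blocks. -/
inductive BlockRun (S : System π ι μ) (x : S.Config) : List (Action ι μ) → S.Config → Prop
  | nil : BlockRun S x [] x
  | snoc {y z : S.Config} {e f : List (Action ι μ)} :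
      BlockRun S x e y → S.Block y f z → BlockRun S x (e ++ f) z

theorem BlockRun.run {x y : S.Config} {e : List (Action ι μ)} (h : S.BlockRun x e y) :
    S.Run x e y := by
  induction h with
  | nil => exact Run.nil x
  | snoc _ hb ih => exact ih.append hb.1

theorem BlockRun.append {x y z : S.Config} {e f : List (Action ι μ)} (h : S.BlockRun x e y)
    (h' : S.BlockRun y f z) : S.BlockRun x (e ++ f) z := by
  induction h' with
  | nil => simpa using h
  | snoc _ hb ih => rw [← List.append_assoc]; exact ih.snoc hb

/-- In a block run a receive occurs only together with a send on the same buffer. Dependencies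
through a buffer can therefore be traced by its sending end alone. -/
theorem BlockRun.exists_send {x y : S.Config} {e : List (Action ι μ)} (h : S.BlockRun x e y)
    {a : Action ι μ} (ha : a ∈ e) : ∃ m, (a.1, Dir.send, m) ∈ e := by
  induction h with
  | nil => simp at ha
  | snoc _ hB ih =>
    rcases List.mem_append.mp ha with ha | ha
    · obtain ⟨m, hm⟩ := ih ha
      exact ⟨m, by simp [hm]⟩
    · obtain ⟨-, j, n, rfl | ⟨rfl, -⟩⟩ := hB
      · simp at ha; subst ha; exact ⟨n, by simp⟩
      · simp at ha
        rcases ha with rfl | rfl <;> exact ⟨n, by simp⟩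

/-- An exchange needs its buffer to be empty; the other block uses a different buffer and does not
affect this. -/
theorem Block.swap {x y z : S.Config} {e f : List (Action ι μ)} (h : S.Block x e y)
    (h' : S.Block y f z) (hi : ∀ a ∈ e, ∀ b ∈ f, S.Indep a b) :
    ∃ y', S.Block x f y' ∧ S.Block y' e z := by
  obtain ⟨hr, i, m, hm⟩ := h
  obtain ⟨hr', j, n, hn⟩ := h'
  obtain ⟨y', h₁, h₂⟩ := hr.swap_run hr' hi
  have hij : i ≠ j := by
    rcases hm with rfl | ⟨rfl, -⟩ <;> rcases hn with rfl | ⟨rfl, -⟩ <;>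
    exact (hi (i, Dir.send, m) (by simp) (j, Dir.send, n) (by simp)).2
  refine ⟨y', ⟨h₁, j, n, hn.imp id fun hn => ⟨hn.1, ?_⟩⟩, ⟨h₂, i, m, hm.imp id fun hm => ⟨hm.1, ?_⟩⟩⟩
  · rw [← hn.2, hr.buf_eq]
    rcases hm with rfl | ⟨rfl, -⟩ <;> simp [hij]
  · rw [← hm.2, h₁.buf_eq]
    rcases hn with rfl | ⟨rfl, -⟩ <;> simp [hij.symm]

theorem BlockRun.swap {x y z : S.Config} {e f : List (Action ι μ)} (h : S.BlockRun x e y)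
    (h' : S.Block y f z) (hi : ∀ a ∈ e, ∀ b ∈ f, S.Indep a b) :
    ∃ y', S.Block x f y' ∧ S.BlockRun y' e z := by
  induction h generalizing z with
  | nil => exact ⟨z, h', BlockRun.nil⟩
  | snoc _ hb ih =>
    obtain ⟨w, h₁, h₂⟩ := hb.swap h' fun a ha => hi a (by simp [ha])
    obtain ⟨y', h₃, h₄⟩ := ih h₁ fun a ha => hi a (by simp [ha])
    exact ⟨y', h₃, h₄.snoc h₂⟩

/-- The blocks keep their form: an exchange on `i` cannot occur, because the buffer `i` is nonempty
throughout. -/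
theorem BlockRun.swap_recv {x y z : S.Config} {e : List (Action ι μ)} {i : ι} {m : μ}
    (h : S.BlockRun x e y) (hb : S.Step y (i, Dir.recv, m) z)
    (he : ∀ a ∈ e, ¬ S.SameOwner a (i, Dir.recv, m))
    (hi : ∀ a ∈ e, a.1 = i → a.2.1 = Dir.send) (hx : ∃ t, x.buf i = m :: t) :
    ∃ y', S.Step x (i, Dir.recv, m) y' ∧ S.BlockRun y' e z := by
  induction h generalizing z with
  | nil => exact ⟨z, hb, BlockRun.nil⟩
  | @snoc y w e f hr hB ih =>
    obtain ⟨hf, j, n, hn⟩ := hB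
    have hw := hr.run.head (fun a ha => hi a (by simp [ha])) hx
    obtain ⟨w', h₁, h₂⟩ := hf.swap_recv hb (fun a ha => he a (by simp [ha]))
      (fun a ha => hi a (by simp [ha])) hw
    obtain ⟨y', h₃, h₄⟩ := ih h₁ (fun a ha => he a (by simp [ha])) fun a ha => hi a (by simp [ha])
    refine ⟨y', h₃, h₄.snoc ⟨h₂, j, n, hn.imp id fun hn => ⟨hn.1, ?_⟩⟩⟩
    rw [← hn.2, h₁.2.other]
    rintro rfl
    obtain ⟨t, ht⟩ := hw
    simp [hn.2] at ht

/-- The position in a block run of the send whose message is the first in a buffer. -/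
theorem BlockRun.split {x : S.Config} {e : List (Action ι μ)} {i : ι} {m : μ}
    (h : S.BlockRun S.initConfig e x) (hx : ∃ t, x.buf i = m :: t) :
    ∃ e₁ e₂ y z, e = e₁ ++ [(i, Dir.send, m)] ++ e₂ ∧ S.BlockRun S.initConfig e₁ y ∧ y.buf i = [] ∧
      S.Block y [(i, Dir.send, m)] z ∧ S.BlockRun z e₂ x ∧
      ∀ a ∈ e₂, a.1 = i → a.2.1 = Dir.send := by
  induction h with
  | nil => simp [initConfig] at hx
  | @snoc y z e f hr hB ih =>
    by_cases hy : ∃ t, y.buf i = m :: t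
    · obtain ⟨e₁, e₂, u, v, rfl, h₁, h₂, h₃, h₄, h₅⟩ := ih hy
      refine ⟨e₁, e₂ ++ f, u, v, by simp, h₁, h₂, h₃, h₄.snoc hB, fun a ha => ?_⟩
      rcases List.mem_append.mp ha with ha | ha
      · exact h₅ a ha
      -- An exchange on `i` would need the buffer `i` to be empty, but it starts with `m`.
      · obtain ⟨-, j, n, rfl | ⟨rfl, hj⟩⟩ := hB
        · simp at ha; simp [ha]
        · obtain ⟨t, ht⟩ := hy
          rintro rfl
          simp at ha
          rcases ha with rfl | rfl <;> simp [hj] at ht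
    · obtain ⟨hf, j, n, hn⟩ := hB
      -- Otherwise the last block puts `m` at the head of `i`. It must be a lone send to an empty
      -- buffer, since an exchange leaves the buffer empty and a send to a nonempty buffer keeps its
      -- head.
      have hij : i = j := by
        by_contra hij
        refine hy ?_
        rwa [← hf.buf_eq (i := i)]
        rcases hn with rfl | ⟨rfl, -⟩ <;> simp [Ne.symm hij]
      subst hij
      obtain ⟨t, ht⟩ := hx
      rcases hn with rfl | ⟨rfl, hi⟩
      · have h1 := (run_singleton_iff.mp hf).2.1
        simp only [ht] at h1
        cases hyi : y.buf i with
        | nil =>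
          rw [hyi] at h1
          simp at h1
          obtain ⟨rfl, rfl⟩ := h1
          exact ⟨e, [], y, z, by simp, hr, hyi, ⟨hf, i, m, Or.inl rfl⟩, BlockRun.nil, by simp⟩
        | cons m' t' =>
          rw [hyi] at h1
          simp at h1
          exact absurd ⟨t', by rw [hyi, h1.1]⟩ hy
      · cases hf with
        | cons hs hf =>
          have h1 := hs.2.1
          have h2 := (run_singleton_iff.mp hf).2.1
          simp only [hi] at h1
          simp only [h1, ht] at h2
          simp at h2

end Runs

end System

end FIFO

namespace FIFO

namespace System

/-! ### Causal equivalence -/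

section Causal

variable {π ι μ : Type} [DecidableEq ι] {S : System π ι μ}

/-- A number of positions can be transported along a bijection, which is not possible for a count in
a prefix. -/
theorem countOn_take (d : Dir) (i : ι) (e : List (Action ι μ)) (j : ℕ) (hj : j ≤ e.length) :
    countOn d i (e.take j) = (Finset.univ.filter fun l : Fin e.length =>
      l.val < j ∧ (e.get l).1 = i ∧ (e.get l).2.1 = d).card := by
  induction j with
  | zero => simp [countOn]
  | succ j ih =>
    have hlt : j < e.length := hj
    rw [← List.take_append_getElem hlt, countOn_append, countOn_singleton, ih hlt.le]
    have hsplit : (Finset.univ.filter fun l : Fin e.length =>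
        l.val < j + 1 ∧ (e.get l).1 = i ∧ (e.get l).2.1 = d) =
        (Finset.univ.filter fun l : Fin e.length =>
          l.val < j ∧ (e.get l).1 = i ∧ (e.get l).2.1 = d) ∪
        (if e[j].1 = i ∧ e[j].2.1 = d then {⟨j, hlt⟩} else ∅) := by
      ext ⟨l, hl⟩
      split_ifs with h
      · simp only [Finset.mem_filter, Finset.mem_univ, true_and, Finset.mem_union,
          Finset.mem_singleton, Fin.mk.injEq]
        constructor
        · rintro ⟨h1, h2⟩
          rcases Nat.lt_succ_iff_lt_or_eq.mp h1 with h1 | h1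
          · exact Or.inl ⟨h1, h2⟩
          · exact Or.inr h1
        · rintro (⟨h1, h2⟩ | rfl)
          · exact ⟨by omega, h2⟩
          · exact ⟨by omega, h⟩
      · simp only [Finset.mem_filter, Finset.mem_univ, true_and, Finset.union_empty]
        constructor
        · rintro ⟨h1, h2⟩
          rcases Nat.lt_succ_iff_lt_or_eq.mp h1 with h1 | rfl
          · exact ⟨h1, h2⟩
          · exact absurd h2 h
        · rintro ⟨h1, h2⟩
          exact ⟨by omega, h2⟩
    rw [hsplit, Finset.card_union_of_disjoint]
    · split_ifs <;> simp
    · split_ifs <;> simp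

/-- Since `hm` keeps the order of actions of one type on one buffer, each of them keeps its rank
among these actions. -/
theorem countOn_take_equiv {e f : List (Action ι μ)} (σ : Fin e.length ≃ Fin f.length)
    (hl : ∀ j, f.get (σ j) = e.get j)
    (hm : ∀ j k, (e.get j).1 = (e.get k).1 → (e.get j).2.1 = (e.get k).2.1 → j < k → σ j < σ k)
    (j : Fin e.length) :
    countOn (e.get j).2.1 (e.get j).1 (f.take (σ j)) =
      countOn (e.get j).2.1 (e.get j).1 (e.take j) := by
  rw [countOn_take _ _ _ _ (σ j).2.le, countOn_take _ _ _ _ j.2.le]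
  symm
  refine Finset.card_bij (fun l _ => σ l) (fun l hl' => ?_) (fun _ _ _ _ h => σ.injective h)
    fun l hl' => ?_
  · simp only [Finset.mem_filter, Finset.mem_univ, true_and] at hl' ⊢
    rw [hl]
    exact ⟨hm _ _ hl'.2.1 hl'.2.2 hl'.1, hl'.2⟩
  · simp only [Finset.mem_filter, Finset.mem_univ, true_and] at hl'
    refine ⟨σ.symm l, ?_, by simp⟩
    have h2 : e.get (σ.symm l) = f.get l := by rw [← hl, Equiv.apply_symm_apply]
    simp only [Finset.mem_filter, Finset.mem_univ, true_and]
    rw [h2]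
    refine ⟨?_, hl'.2⟩
    rcases lt_trichotomy (σ.symm l) j with h | h | h
    · exact h
    · rw [← h, Equiv.apply_symm_apply] at hl'
      exact absurd hl'.1 (lt_irrefl _)
    · have h3 := hm j (σ.symm l) (by rw [h2, hl'.2.1]) (by rw [h2, hl'.2.2]) h
      rw [Equiv.apply_symm_apply] at h3
      exact absurd (lt_trans hl'.1 h3) (lt_irrefl _)

theorem isMatch_iff {e : List (Action ι μ)} {j k : Fin e.length} :
    IsMatch e j k ↔ (e.get j).2.1 = Dir.send ∧ (e.get k).2.1 = Dir.recv ∧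
      (e.get j).1 = (e.get k).1 ∧ (e.get j).2.2 = (e.get k).2.2 ∧
      countOn (e.get j).2.1 (e.get j).1 (e.take j) =
        countOn (e.get k).2.1 (e.get k).1 (e.take k) := by
  constructor
  · rintro ⟨i, m, h1, h2, h3⟩
    have h1' : e.get j = (i, Dir.send, m) := by simpa using h1
    have h2' : e.get k = (i, Dir.recv, m) := by simpa using h2
    rw [h1', h2']
    exact ⟨rfl, rfl, rfl, rfl, h3⟩
  · rintro ⟨h1, h2, h3, h4, h5⟩
    refine ⟨(e.get j).1, (e.get j).2.2, ?_, ?_, ?_⟩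
    · rw [← h1]; simp
    · rw [← h2, h3, h4]; simp
    · rw [← h1, h5, ← h2, h3]

/-- Matching depends only on labels and ranks. This serves both for the exchange of adjacent actions
and for arbitrary causal equivalences, where `hm` holds because actions of one type on one buffer do
not commute. -/
theorem isMatch_equiv {e f : List (Action ι μ)} (σ : Fin e.length ≃ Fin f.length)
    (hl : ∀ j, f.get (σ j) = e.get j)
    (hm : ∀ j k, (e.get j).1 = (e.get k).1 → (e.get j).2.1 = (e.get k).2.1 → j < k → σ j < σ k)
    (j k : Fin e.length) : IsMatch f (σ j) (σ k) ↔ IsMatch e j k := by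
  rw [isMatch_iff, isMatch_iff, hl, hl, countOn_take_equiv σ hl hm, countOn_take_equiv σ hl hm]

theorem CausalEquiv.refl (e : List (Action ι μ)) : S.CausalEquiv e e :=
  ⟨Equiv.refl _, fun _ => rfl, fun _ _ => Iff.rfl⟩

theorem CausalEquiv.trans {e f g : List (Action ι μ)} (h : S.CausalEquiv e f)
    (h' : S.CausalEquiv f g) : S.CausalEquiv e g := by
  obtain ⟨σ, h1, h2⟩ := h
  obtain ⟨τ, h3, h4⟩ := h'
  exact ⟨σ.trans τ, fun j => by rw [Equiv.trans_apply, h3, h1],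
    fun j k => by rw [h2, h4]; rfl⟩

/-- Exchange two adjacent actions that commute and are not matched. -/
def SwapStep (S : System π ι μ) (e f : List (Action ι μ)) : Prop :=
  ∃ u a b v, e = u ++ a :: b :: v ∧ f = u ++ b :: a :: v ∧ S.Commutes a b ∧
    (a.1 = b.1 → countOn Dir.send b.1 u ≠ countOn Dir.recv b.1 u)

/-- Neither of the two actions counts towards the rank of the other, their types being different, so
both ranks are counts in `u`. -/
theorem isMatch_adjacent {u v : List (Action ι μ)} {a b : Action ι μ}
    (h : IsMatch (u ++ a :: b :: v) u.length (u.length + 1) ∨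
      IsMatch (u ++ a :: b :: v) (u.length + 1) u.length) :
    a.1 = b.1 ∧ countOn Dir.send b.1 u = countOn Dir.recv b.1 u := by
  have ht : (u ++ a :: b :: v).take (u.length + 1) = u ++ [a] := by
    rw [List.take_length_add_append]; simp
  have ht' : (u ++ a :: b :: v).take u.length = u := by simp
  rcases h with ⟨i, m, h1, h2, h3⟩ | ⟨i, m, h1, h2, h3⟩
  · rw [ht, ht', countOn_append, countOn_singleton] at h3
    simp at h1 h2
    subst h1 h2
    simpa using h3
  · rw [ht, ht', countOn_append, countOn_singleton] at h3
    simp at h1 h2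
    subst h1 h2
    simpa using h3

theorem SwapStep.causalEquiv {e f : List (Action ι μ)} (h : S.SwapStep e f) :
    S.CausalEquiv e f := by
  obtain ⟨u, a, b, v, rfl, rfl, hc, hn⟩ := h
  set e := u ++ a :: b :: v with he
  set f := u ++ b :: a :: v with hf
  have hlen : e.length = f.length := by simp [he, hf]
  have h0 : u.length < e.length := by simp [he]
  have h1 : u.length + 1 < e.length := by simp [he]
  let σ : Fin e.length ≃ Fin f.length :=
    (Equiv.swap ⟨u.length, h0⟩ ⟨u.length + 1, h1⟩).trans (finCongr hlen)
  have hσ : ∀ j : Fin e.length, (σ j).val =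
      if j.val = u.length then u.length + 1 else if j.val = u.length + 1 then u.length
        else j.val := by
    intro j
    simp only [σ, Equiv.trans_apply, finCongr_apply, Fin.val_cast, Equiv.swap_apply_def, Fin.ext_iff]
    split_ifs <;> rfl
  clear_value σ
  have hl : ∀ j, f.get (σ j) = e.get j := by
    intro j
    have : f[(σ j).val]? = e[j.val]? := by
      rw [hσ]
      obtain ⟨j, hj⟩ := j
      simp only [hf, he]
      split_ifs with h2 h3
      · rw [h2]; simp
      · rw [h3]; simp
      · rcases lt_or_ge j u.length with h4 | h4
        · rw [List.getElem?_append_left h4, List.getElem?_append_left h4]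
        · rw [List.getElem?_append_right h4, List.getElem?_append_right h4]
          obtain ⟨n, hn⟩ : ∃ n, j - u.length = n + 2 := ⟨j - u.length - 2, by omega⟩
          rw [hn]
          simp
    simpa using this
  -- The transposition reverses the order of no pair but the exchanged one.
  have hmono : ∀ j k : Fin e.length, j < k → ¬ (j.val = u.length ∧ k.val = u.length + 1) →
      σ j < σ k := by
    intro j k hjk hne
    rw [Fin.lt_def, hσ, hσ]
    rw [Fin.lt_def] at hjk
    split_ifs <;> omega
  have hget : ∀ j : Fin e.length, j.val = u.length → e.get j = a := by
    rintro ⟨j, hj⟩ rfl; simp [he]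
  have hget' : ∀ j : Fin e.length, j.val = u.length + 1 → e.get j = b := by
    rintro ⟨j, hj⟩ rfl; simp [he]
  have hmatch := isMatch_equiv σ hl fun j k h2 h3 hjk => hmono j k hjk fun h4 =>
    hc.2 (by rw [← hget j h4.1, ← hget' k h4.2]; exact ⟨h2, h3⟩)
  refine ⟨σ, hl, fun j k => ?_⟩
  rw [HappensBefore, HappensBefore, hl, hl, hmatch, hmatch]
  -- The exchanged positions are joined by no edge, so reversing them is harmless.
  have hkey : ∀ j k : Fin e.length, j.val = u.length → k.val = u.length + 1 →
      S.Commutes (e.get j) (e.get k) ∧ ¬ IsMatch e j k ∧ ¬ IsMatch e k j := by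
    intro j k h2 h3
    refine ⟨by rw [hget j h2, hget' k h3]; exact hc, fun h4 => ?_, fun h4 => ?_⟩
    · rw [h2, h3] at h4
      have := isMatch_adjacent (Or.inl h4)
      exact hn this.1 this.2
    · rw [h2, h3] at h4
      have := isMatch_adjacent (Or.inr h4)
      exact hn this.1 this.2
  by_cases h2 : j.val = u.length ∧ k.val = u.length + 1
  · have := hkey j k h2.1 h2.2
    tauto
  by_cases h3 : k.val = u.length ∧ j.val = u.length + 1
  · have := hkey k j h3.1 h3.2
    have h4 := this.1.symm
    tauto
  have : j < k ↔ σ j < σ k := by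
    rcases lt_trichotomy j k with h4 | h4 | h4
    · exact iff_of_true h4 (hmono j k h4 h2)
    · rw [h4]; simp
    · exact iff_of_false h4.not_gt (hmono k j h4 h3).not_gt
  rw [this]

/-- A sequence of exchanges of adjacent actions that commute and are not matched. -/
abbrev Swaps (S : System π ι μ) : List (Action ι μ) → List (Action ι μ) → Prop :=
  Relation.ReflTransGen S.SwapStep

theorem Swaps.causalEquiv {e f : List (Action ι μ)} (h : S.Swaps e f) : S.CausalEquiv e f := by
  induction h with
  | refl => exact CausalEquiv.refl e
  | tail _ hs ih => exact ih.trans hs.causalEquiv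

theorem Swaps.append {e f : List (Action ι μ)} (h : S.Swaps e f) (w : List (Action ι μ)) :
    S.Swaps (e ++ w) (f ++ w) := by
  induction h with
  | refl => exact Relation.ReflTransGen.refl
  | tail _ hs ih =>
    obtain ⟨u, a, b, v, rfl, rfl, hc⟩ := hs
    exact ih.tail ⟨u, a, b, v ++ w, by simp, by simp, hc⟩

/-- The action `b` moves left past one action at a time; `hn` provides the condition of `SwapStep`
for each of these exchanges. -/
theorem Swaps.move {u e v : List (Action ι μ)} {b : Action ι μ} (hc : ∀ a ∈ e, S.Commutes a b)
    (hn : ∀ e₀ a e₁, e = e₀ ++ a :: e₁ → a.1 = b.1 →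
      countOn Dir.send b.1 (u ++ e₀) ≠ countOn Dir.recv b.1 (u ++ e₀)) :
    S.Swaps (u ++ e ++ [b] ++ v) (u ++ [b] ++ e ++ v) := by
  induction e using List.reverseRecOn generalizing v with
  | nil => simpa using Relation.ReflTransGen.refl
  | append_singleton e a ih =>
    refine Relation.ReflTransGen.head (b := u ++ e ++ [b] ++ a :: v) ?_ ?_
    · exact ⟨u ++ e, a, b, v, by simp, by simp, hc a (by simp), hn e a [] rfl⟩
    · have := ih (v := a :: v) (fun x hx => hc x (by simp [hx])) fun e₀ x e₁ he =>
        hn e₀ x (e₁ ++ [a]) (by simp [he])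
      simpa using this

theorem Swaps.exchange {u e f v : List (Action ι μ)} (hi : ∀ a ∈ e, ∀ b ∈ f, S.Indep a b) :
    S.Swaps (u ++ e ++ f ++ v) (u ++ f ++ e ++ v) := by
  induction f generalizing u with
  | nil => simpa using Relation.ReflTransGen.refl
  | cons b f ih =>
    have h1 : S.Swaps (u ++ e ++ [b] ++ (f ++ v)) (u ++ [b] ++ e ++ (f ++ v)) :=
      Swaps.move (fun a ha => (hi a ha b (by simp)).commutes)
        fun e₀ a e₁ he h => absurd h (hi a (by simp [he]) b (by simp)).2
    have h2 := ih (u := u ++ [b]) fun a ha c hc => hi a ha c (by simp [hc])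
    refine Relation.ReflTransGen.trans (b := u ++ [b] ++ e ++ (f ++ v)) ?_ ?_
    · simpa using h1
    · simpa using h2

/-! ### Block runs are greedy -/

theorem countOn_take_succ_le {d : Dir} {i : ι} {e : List (Action ι μ)} {k : ℕ} {m : μ}
    (h : e[k]? = some (i, d, m)) : countOn d i (e.take k) + 1 ≤ countOn d i e := by
  obtain ⟨hk, hk'⟩ := List.getElem?_eq_some_iff.mp h
  conv_rhs => rw [← List.take_append_drop (k + 1) e, ← List.take_append_getElem hk]
  rw [countOn_append, countOn_append, countOn_singleton, hk']
  simp

/-- A receive within `e` has its partner within `e`, since the prefix `e` is a run and contains at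
least as many sends as receives on each buffer. The receive of a final exchange finds all earlier
messages of its buffer consumed, so only the send of the same exchange has its rank. -/
theorem BlockRun.greedyWord {x : S.Config} {e : List (Action ι μ)}
    (h : S.BlockRun S.initConfig e x) : GreedyWord e := by
  induction h with
  | nil => rintro j k ⟨i, m, h, -⟩; simp at h
  | @snoc y z e f hr hB ih =>
    rintro j k ⟨i, m, hj, hk, hcount⟩
    obtain ⟨-, i', m', hf⟩ := hB
    have hct := hr.run.count_init i
    rcases lt_or_ge k e.length with hke | hke
    · rw [List.getElem?_append_left hke] at hk
      rw [List.take_append_of_le_length hke.le] at hcount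
      rcases lt_or_ge j e.length with hje | hje
      · rw [List.getElem?_append_left hje] at hj
        rw [List.take_append_of_le_length hje.le] at hcount
        exact ih j k ⟨i, m, hj, hk, hcount⟩
      · obtain ⟨n, rfl⟩ := Nat.exists_eq_add_of_le hje
        rw [List.take_length_add_append, countOn_append] at hcount
        have := countOn_take_succ_le hk
        omega
    · obtain ⟨n, rfl⟩ := Nat.exists_eq_add_of_le hke
      rw [List.getElem?_append_right (by omega), Nat.add_sub_cancel_left] at hk
      rcases hf with rfl | ⟨rfl, hi⟩
      · cases n <;> simp at hk
      · obtain rfl : n = 1 := by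
          rcases n with _ | _ | n <;> simp at hk ⊢
        simp at hk
        obtain ⟨rfl, rfl⟩ := hk
        rw [hi] at hct
        rw [List.take_length_add_append, countOn_append] at hcount
        simp [countOn_singleton] at hcount
        rcases lt_or_ge j e.length with hje | hje
        · rw [List.getElem?_append_left hje] at hj
          rw [List.take_append_of_le_length hje.le] at hcount
          have := countOn_take_succ_le hj
          simp at hct
          omega
        · obtain ⟨n, rfl⟩ := Nat.exists_eq_add_of_le hje
          rw [List.getElem?_append_right (by omega), Nat.add_sub_cancel_left] at hj
          rcases n with _ | _ | n <;> simp at hj ⊢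

end Causal

end System

end FIFO

namespace FIFO

namespace System

/-! ### The abstract search space -/

/-- What is remembered about the actions that causally follow the marked send: nothing before
the marked send, the violation, a process that has acted since, the process of the marked send,
or an end of a buffer. -/
inductive Mark (π ι : Type) where
  | none
  | bad
  | moved (p : π)
  | fresh (p : π)
  | snd (i : ι)
  | rcv (i : ι)
deriving DecidableEq

/-- A node: control states, buffers that are not empty, contents of the marked send, mark. -/
structure Node (S : System π ι μ) where
  state : (p : π) → Fin (S.aut p).numStates
  full : ι → Bool
  goal : Option (ι × μ)
  mark : Mark π ι

section Abstract

variable {π ι μ : Type} [DecidableEq π] [DecidableEq ι] {S : System π ι μ}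

/-- The initial node. -/
def initNode (S : System π ι μ) : S.Node where
  state := fun p => (S.aut p).init
  full := fun _ => false
  goal := none
  mark := Mark.none

/-- Marks that are passed on by a send. -/
def LoneMark (p : π) (i : ι) (c c' : Mark π ι) : Prop :=
  c' = c ∨ (c = .moved p ∨ c = .fresh p ∨ c = .snd i) ∧ (c' = .moved p ∨ c' = .snd i)

/-- Marks that are passed on by an exchange. -/
def ExchMark (p q : π) (i : ι) (c c' : Mark π ι) : Prop :=
  c' = c ∨ (c = .moved p ∨ c = .fresh p ∨ c = .snd i ∨ c = .moved q ∨ c = .fresh q ∨ c = .rcv i) ∧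
    (c' = .moved p ∨ c' = .snd i ∨ c' = .moved q ∨ c' = .rcv i)

/-- The steps of the search. -/
inductive NodeStep (S : System π ι μ) (x : S.Node) : S.Node → Prop
  | lone {p : π} {i : ι} {m : μ} {t : Fin (S.aut p).numStates} {c : Mark π ι}
      (h : (x.state p, (i, Dir.send, m), t) ∈ (S.aut p).trans) (hc : LoneMark p i x.mark c) :
      NodeStep S x ⟨Function.update x.state p t, Function.update x.full i true, x.goal, c⟩
  -- This guesses the send that the last receive will match. The mark is `fresh p` and not `moved
  -- p`: a receive by the sender itself is harmless as long as the sender has not acted again.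
  | start {p : π} {i : ι} {m : μ} {t : Fin (S.aut p).numStates} {c : Mark π ι}
      (h : (x.state p, (i, Dir.send, m), t) ∈ (S.aut p).trans) (hi : x.full i = false)
      (hg : x.goal = none) (hm : x.mark = Mark.none) (hc : c = .fresh p ∨ c = .snd i) :
      NodeStep S x ⟨Function.update x.state p t, Function.update x.full i true, some (i, m), c⟩
  | exch {p q : π} {i : ι} {m : μ} {t : Fin (S.aut p).numStates} {u : Fin (S.aut q).numStates}
      {c : Mark π ι} (h : (x.state p, (i, Dir.send, m), t) ∈ (S.aut p).trans)
      -- Sender and receiver may coincide, so the receive starts from the updated state.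
      (h' : (Function.update x.state p t q, (i, Dir.recv, m), u) ∈ (S.aut q).trans)
      (hi : x.full i = false) (hc : ExchMark p q i x.mark c) :
      NodeStep S x ⟨Function.update (Function.update x.state p t) q u, x.full, x.goal, c⟩
  | recv {p : π} {i : ι} {m : μ} {t : Fin (S.aut p).numStates}
      (h : (x.state p, (i, Dir.recv, m), t) ∈ (S.aut p).trans)
      (hg : x.goal = some (i, m)) (hm : x.mark = .moved p) :
      NodeStep S x ⟨Function.update x.state p t, x.full, x.goal, .bad⟩

/-- The nodes found by the search. -/
def Found (S : System π ι μ) : S.Node → Prop := Relation.ReflTransGen S.NodeStep S.initNode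

/-- The node of a configuration. -/
def node (x : S.Config) (g : Option (ι × μ)) (c : Mark π ι) : S.Node where
  state := x.state
  full := fun i => !(x.buf i).isEmpty
  goal := g
  mark := c

/-! ### Systems without violation are greedy -/

/-- The mark belongs to the action. -/
def Mark.On (S : System π ι μ) (c : Mark π ι) (a : Action ι μ) : Prop :=
  (∃ p, c = .moved p ∧ a ∈ (S.aut p).actions) ∨ c = .snd a.1 ∧ a.2.1 = Dir.send

theorem Step.state_eq {x y : S.Config} {a : Action ι μ} {p : π}
    (h : (x.state p, a, y.state p) ∈ (S.aut p).trans) (hs : S.Step x a y) :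
    y.state = Function.update x.state p (y.state p) := by
  obtain ⟨⟨q, hq, hq'⟩, -⟩ := hs
  obtain rfl : p = q := owner_unique ((S.aut p).trans_sub _ h) ((S.aut q).trans_sub _ hq)
  funext r
  by_cases hr : r = p
  · subst hr; simp
  · simp [hr, hq' r hr]

theorem node_eq {x : S.Config} (g : Option (ι × μ)) (c : Mark π ι)
    {s : (p : π) → Fin (S.aut p).numStates} {f : ι → Bool} (h₁ : x.state = s)
    (h₂ : ∀ i, f i = !(x.buf i).isEmpty) : node x g c = ⟨s, f, g, c⟩ := by
  subst h₁
  simp only [node, Node.mk.injEq, true_and, and_true]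
  funext i
  exact (h₂ i).symm

/-- A block counts as a single vertex of the dependency graph: a mark used by any of its actions may
be passed on to a resource of any other, regardless of their order. -/
theorem Block.found {x y : S.Config} {e : List (Action ι μ)} {g : Option (ι × μ)} {c c' : Mark π ι}
    (h : S.Block x e y) (hf : S.Found (node x g c))
    (hc : c' = c ∨ (∃ a ∈ e, Mark.On S c a ∨ ∃ p, c = .fresh p ∧ a ∈ (S.aut p).actions) ∧
      ∃ a ∈ e, Mark.On S c' a) : S.Found (node y g c') := by
  obtain ⟨hr, i, m, rfl | ⟨rfl, hi⟩⟩ := h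
  · have hs := run_singleton_iff.mp hr
    obtain ⟨p, hp, -⟩ := hs.1
    have hpa := (S.aut p).trans_sub _ hp
    refine hf.tail ?_
    rw [node_eq g c' (f := Function.update (node x g c).full i true) (hs.state_eq hp) ?_]
    · refine NodeStep.lone hp (hc.imp id ?_)
      rintro ⟨⟨a, ha, h1⟩, a', ha', h2⟩
      rw [List.mem_singleton] at ha ha'
      subst ha ha'
      refine ⟨?_, ?_⟩
      · rcases h1 with (⟨q, h1, h3⟩ | h1) | ⟨q, h1, h3⟩
        · obtain rfl := owner_unique hpa h3
          exact Or.inl h1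
        · exact Or.inr (Or.inr h1.1)
        · obtain rfl := owner_unique hpa h3
          exact Or.inr (Or.inl h1)
      · rcases h2 with ⟨q, h1, h3⟩ | h1
        · obtain rfl := owner_unique hpa h3
          exact Or.inl h1
        · exact Or.inr h1.1
    · intro j
      by_cases hj : j = i
      · subst hj
        have := hs.2.1
        simp only at this
        simp [this]
      · simp [hj, node, hs.2.other (j := j) hj]
  · cases hr with
    | @cons x z y _ _ hs hr =>
      have hs' := run_singleton_iff.mp hr
      obtain ⟨p, hp, -⟩ := hs.1
      obtain ⟨q, hq, -⟩ := hs'.1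
      have hpa := (S.aut p).trans_sub _ hp
      have hqa := (S.aut q).trans_sub _ hq
      refine hf.tail ?_
      rw [node_eq g c' (s := Function.update (Function.update (node x g c).state p (z.state p)) q
        (y.state q)) (f := (node x g c).full) ?_ ?_]
      · refine NodeStep.exch hp (m := m) ?_ (i := i) (by simp [node, hi]) (hc.imp id ?_)
        · simpa [node, ← hs.state_eq hp] using hq
        rintro ⟨⟨a, ha, h1⟩, a', ha', h2⟩
        simp only [List.mem_cons, List.not_mem_nil, or_false] at ha ha'
        refine ⟨?_, ?_⟩
        · rcases ha with rfl | rfl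
          · rcases h1 with (⟨r, h1, h3⟩ | h1) | ⟨r, h1, h3⟩
            · obtain rfl := owner_unique hpa h3
              simp [node, h1]
            · simp [node, h1.1]
            · obtain rfl := owner_unique hpa h3
              simp [node, h1]
          · rcases h1 with (⟨r, h1, h3⟩ | h1) | ⟨r, h1, h3⟩
            · obtain rfl := owner_unique hqa h3
              simp [node, h1]
            · simp at h1
            · obtain rfl := owner_unique hqa h3
              simp [node, h1]
        · rcases ha' with rfl | rfl
          · rcases h2 with ⟨r, h1, h3⟩ | h1
            · obtain rfl := owner_unique hpa h3
              simp [node, h1]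
            · simp [node, h1.1]
          · rcases h2 with ⟨r, h1, h3⟩ | h1
            · obtain rfl := owner_unique hqa h3
              simp [node, h1]
            · simp at h1
      · rw [hs'.state_eq hq, hs.state_eq hp]
        simp [node]
      · intro j
        by_cases hj : j = i
        · subst hj
          have h1 := hs.2.1
          have h2 := hs'.2.1
          simp only [h1, hi] at h2
          simp at h2
          simp [node, hi, h2]
        · simp [hj, node, hs.2.other (j := j) hj, hs'.2.other (j := j) hj]

theorem BlockRun.found {x : S.Config} {e : List (Action ι μ)}
    (h : S.BlockRun S.initConfig e x) : S.Found (node x none Mark.none) := by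
  induction h with
  | nil => exact Relation.ReflTransGen.refl
  | snoc _ hb ih => exact hb.found ih (Or.inl rfl)

theorem found_start {x y : S.Config} {p : π} {i : ι} {m : μ} {c : Mark π ι}
    (hf : S.Found (node x none Mark.none)) (hi : x.buf i = [])
    (hs : S.Step x (i, Dir.send, m) y) (hp : (i, Dir.send, m) ∈ (S.aut p).actions)
    (hc : c = .fresh p ∨ c = .snd i) : S.Found (node y (some (i, m)) c) := by
  obtain ⟨q, hq, -⟩ := hs.1
  obtain rfl := owner_unique hp ((S.aut q).trans_sub _ hq)
  refine hf.tail ?_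
  rw [node_eq (some (i, m)) c (f := Function.update (node x none Mark.none).full i true)
    (hs.state_eq hq) ?_]
  · exact NodeStep.start hq (by simp [node, hi]) rfl rfl hc
  · intro j
    by_cases hj : j = i
    · subst hj
      have := hs.2.1
      simp only at this
      simp [this]
    · simp [hj, node, hs.2.other (j := j) hj]

/-- The actions that do not causally follow the marked send can be moved before it. -/
theorem BlockRun.advance {x y z : S.Config} {e₁ e₂ : List (Action ι μ)} {p : π} {i : ι} {m : μ}
    (h₁ : S.BlockRun S.initConfig e₁ x) (hi : x.buf i = [])
    (hs : S.Block x [(i, Dir.send, m)] y) (hp : (i, Dir.send, m) ∈ (S.aut p).actions)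
    (h₂ : S.BlockRun y e₂ z) :
    ∃ e₃ e₄ x' y', S.BlockRun S.initConfig e₃ x' ∧ x'.buf i = [] ∧
      S.Block x' [(i, Dir.send, m)] y' ∧ S.BlockRun y' e₄ z ∧
      S.Swaps (e₁ ++ [(i, Dir.send, m)] ++ e₂) (e₃ ++ [(i, Dir.send, m)] ++ e₄) ∧
      (∀ a ∈ e₄, a ∈ e₂) ∧ (∀ a ∈ e₄, ∀ c, Mark.On S c a → S.Found (node z (some (i, m)) c)) ∧
      ∀ c, c = .fresh p ∨ c = .snd i → S.Found (node z (some (i, m)) c) := by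
  induction h₂ with
  | nil =>
    exact ⟨e₁, [], x, y, h₁, hi, hs, BlockRun.nil, by simpa using Relation.ReflTransGen.refl,
      by simp, by simp, fun c hc => found_start h₁.found hi (run_singleton_iff.mp hs.1) hp hc⟩
  | @snoc z w e₂ f hr hB ih =>
    obtain ⟨e₃, e₄, x', y', h₃, hi', hs', h₄, hsw, hsub, hF, hF'⟩ := ih
    have hmain : S.BlockRun y' (e₄ ++ f) w := h₄.snoc hB
    have hkeep : ∀ c, S.Found (node z (some (i, m)) c) → S.Found (node w (some (i, m)) c) :=
      fun c hc => hB.found hc (Or.inl rfl)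
    -- A block that is independent of the marked send and of all its followers moves in front of the
    -- send; any other block joins the followers.
    by_cases hind : ∀ a ∈ (i, Dir.send, m) :: e₄, ∀ b ∈ f, S.Indep a b
    · obtain ⟨u, hu, hu'⟩ := h₄.swap hB fun a ha => hind a (by simp [ha])
      obtain ⟨v, hv, hv'⟩ := hs'.swap hu fun a ha => hind a (by simp at ha; simp [ha])
      refine ⟨e₃ ++ f, e₄, v, u, h₃.snoc hv, ?_, hv', hu', ?_, fun a ha => by simp [hsub a ha],
        fun a ha c hc => hkeep c (hF a ha c hc), fun c hc => hkeep c (hF' c hc)⟩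
      · rw [hv.1.buf_eq, hi']
        exact fun b hb => (hind (i, Dir.send, m) (by simp) b hb).2.symm
      · have h1 := hsw.append f
        have h2 : S.Swaps (e₃ ++ ((i, Dir.send, m) :: e₄) ++ f ++ [])
          (e₃ ++ f ++ ((i, Dir.send, m) :: e₄) ++ []) := Swaps.exchange hind
        simp only [List.append_assoc, List.cons_append, List.nil_append, List.append_nil] at h1 h2 ⊢
        exact h1.trans h2
    · refine ⟨e₃, e₄ ++ f, x', y', h₃, hi', hs', hmain, ?_, ?_, ?_, fun c hc => hkeep c (hF' c hc)⟩
      · simpa using hsw.append f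
      · intro a ha
        rcases List.mem_append.mp ha with ha | ha
        · simp [hsub a ha]
        · simp [ha]
      · intro a ha c hc
        rcases List.mem_append.mp ha with ha | ha
        · exact hkeep c (hF a ha c hc)
        push Not at hind
        obtain ⟨a', ha', b, hb, hab⟩ := hind
        -- The dependency goes through a common process or through a common buffer. In the second
        -- case both sides contain a send on that buffer, so the mark `snd` passes it on.
        have hon : ∃ c₀, S.Found (node z (some (i, m)) c₀) ∧ ∃ b ∈ f,
            Mark.On S c₀ b ∨ ∃ p, c₀ = .fresh p ∧ b ∈ (S.aut p).actions := by
          by_cases hown : S.SameOwner a' b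
          · obtain ⟨q, h5, h6⟩ := hown
            rcases List.mem_cons.mp ha' with rfl | ha'
            · obtain rfl := owner_unique hp h5
              exact ⟨.fresh p, hF' _ (Or.inl rfl), b, hb, Or.inr ⟨p, rfl, h6⟩⟩
            · exact ⟨.moved q, hF a' ha' _ (Or.inl ⟨q, rfl, h5⟩), b, hb, Or.inl (Or.inl ⟨q, rfl, h6⟩)⟩
          · have hbuf : a'.1 = b.1 := by
              by_contra hne
              exact hab ⟨hown, hne⟩
            have hsend : ∃ m', (a'.1, Dir.send, m') ∈ f := by
              rw [hbuf]
              obtain ⟨-, j, n, rfl | ⟨rfl, -⟩⟩ := hB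
              · simp at hb; subst hb; exact ⟨n, by simp⟩
              · simp at hb
                rcases hb with rfl | rfl <;> exact ⟨n, by simp⟩
            obtain ⟨m', hm'⟩ := hsend
            refine ⟨.snd a'.1, ?_, _, hm', Or.inl (Or.inr ⟨rfl, rfl⟩)⟩
            rcases List.mem_cons.mp ha' with rfl | ha'
            · exact hF' _ (Or.inr rfl)
            · obtain ⟨n, hn⟩ : ∃ n, (a'.1, Dir.send, n) ∈ e₄ := h₄.exists_send ha'
              exact hF _ hn _ (Or.inr ⟨rfl, rfl⟩)
        obtain ⟨c₀, h5, h6⟩ := hon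
        exact hB.found h5 (Or.inr ⟨h6, a, ha, hc⟩)

/-- If the search finds no violation, then each execution can be transformed into a block run. -/
theorem exists_blockRun (hbad : ∀ x : S.Node, S.Found x → x.mark ≠ .bad)
    (e : List (Action ι μ)) (x : S.Config) (h : S.Run S.initConfig e x) :
    ∃ f, S.BlockRun S.initConfig f x ∧ S.Swaps e f := by
  induction e using List.reverseRecOn generalizing x with
  | nil => cases h; exact ⟨[], BlockRun.nil, Relation.ReflTransGen.refl⟩
  | append_singleton e a ih =>
    obtain ⟨y, h₁, h₂⟩ := run_append_iff.mp h
    obtain ⟨f, hf, hef⟩ := ih y h₁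
    have hs := run_singleton_iff.mp h₂
    obtain ⟨i, d, m⟩ := a
    cases d with
    | send => exact ⟨f ++ [(i, Dir.send, m)], hf.snoc ⟨h₂, i, m, Or.inl rfl⟩, hef.append _⟩
    | recv =>
      -- The message received last was put by a lone send to an empty buffer; this is the marked
      -- send.
      obtain ⟨e₁, e₂, u, v, rfl, h₃, hu, hb, h₄, h₅⟩ := hf.split ⟨_, hs.2.1⟩
      obtain ⟨p, hp, -⟩ := (run_singleton_iff.mp hb.1).1
      obtain ⟨e₃, e₄, u', v', h₆, hu', hb', h₇, hsw, hsub, hF, -⟩ :=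
        h₃.advance hu hb ((S.aut p).trans_sub _ hp) h₄
      -- A follower in the receiving process would give the mark `moved q`, and the last receive
      -- would lead the search to `bad`.
      have hown : ∀ a ∈ e₄, ¬ S.SameOwner a (i, Dir.recv, m) := by
        rintro a ha ⟨q, h8, h9⟩
        have h10 := hF a ha _ (Or.inl ⟨q, rfl, h8⟩)
        obtain ⟨r, hr, -⟩ := hs.1
        obtain rfl := owner_unique h9 ((S.aut r).trans_sub _ hr)
        exact hbad _ (h10.tail (NodeStep.recv (t := x.state q) hr rfl rfl)) rfl
      have hrecv : ∀ a ∈ e₄, a.1 = i → a.2.1 = Dir.send := fun a ha => h₅ a (hsub a ha)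
      have hv' : v'.buf i = [m] := by
        have := (run_singleton_iff.mp hb'.1).2.1
        simpa [hu'] using this
      obtain ⟨w, h8, h9⟩ := h₇.swap_recv hs hown hrecv ⟨[], hv'⟩
      refine ⟨e₃ ++ [(i, Dir.send, m), (i, Dir.recv, m)] ++ e₄, ?_, ?_⟩
      · exact (h₆.snoc ⟨hb'.1.append (Run.single h8), i, m, Or.inr ⟨rfl, hu'⟩⟩).append h9
      · have h10 : S.Swaps ((e₃ ++ [(i, Dir.send, m)]) ++ e₄ ++ [(i, Dir.recv, m)] ++ [])
            ((e₃ ++ [(i, Dir.send, m)]) ++ [(i, Dir.recv, m)] ++ e₄ ++ []) := by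
          refine Swaps.move (fun a ha => ⟨hown a ha, fun hh => ?_⟩) fun f₀ a f₁ he _ => ?_
          · have := hrecv a ha hh.1
            rw [this] at hh
            simp at hh
          -- After the marked send the sends on `i` outnumber the receives by one, and `f₀` contains
          -- no receive on `i`. So the receive is matched with none of the actions that it passes.
          · have h11 : S.Run S.initConfig (e₃ ++ [(i, Dir.send, m)]) v' := h₆.run.append hb'.1
            have h12 := h11.count_init i
            have h13 : countOn Dir.recv i f₀ = 0 := by
              rw [countOn, List.countP_eq_zero]
              intro b hb hh
              simp at hh
              have := hrecv b (by rw [he]; simp [hb]) hh.1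
              rw [this] at hh
              simp at hh
            rw [countOn_append Dir.send, countOn_append Dir.recv, h13, ← h12, hv']
            simp
            omega
        have h11 := (hef.append [(i, Dir.recv, m)]).trans (hsw.append [(i, Dir.recv, m)])
        simp only [List.append_assoc, List.cons_append, List.nil_append, List.append_nil] at h10 h11 ⊢
        exact h11.trans h10

theorem greedy_of_not_found (hbad : ∀ x : S.Node, S.Found x → x.mark ≠ .bad) : S.Greedy := by
  rintro e ⟨x, hx⟩
  obtain ⟨f, hf, hsw⟩ := exists_blockRun hbad e x hx
  exact ⟨f, hf.greedyWord, hsw.causalEquiv⟩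

end Abstract

end System

end FIFO

namespace FIFO

namespace System

/-! ### A violation yields an execution that is not greedy -/

section Violation

variable {π ι μ : Type} [DecidableEq π] [DecidableEq ι] {S : System π ι μ}

/-- Positions that stay behind the position `s` if matched actions are kept together. -/
inductive Follows (S : System π ι μ) (f : List (Action ι μ)) (s : ℕ) : ℕ → Prop
  | start {j : ℕ} {a b : Action ι μ} : f[s]? = some a → f[j]? = some b → s < j →
      ¬ S.Commutes a b → Follows S f s j
  | step {j k : ℕ} {a b : Action ι μ} : Follows S f s j → f[j]? = some a → f[k]? = some b → j < k →
      ¬ S.Commutes a b → Follows S f s k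
  | fwd {j k : ℕ} : Follows S f s j → IsMatch f j k → Follows S f s k
  | back {j k : ℕ} : Follows S f s k → IsMatch f j k → Follows S f s j

theorem getElem?_append_some {α : Type} {f : List α} {j : ℕ} {a : α} (h : f[j]? = some a)
    (g : List α) : (f ++ g)[j]? = some a := by
  rw [List.getElem?_append_left (List.getElem?_eq_some_iff.mp h).1, h]

theorem IsMatch.append {f : List (Action ι μ)} {j k : ℕ} (h : IsMatch f j k)
    (g : List (Action ι μ)) : IsMatch (f ++ g) j k := by
  obtain ⟨i, m, h1, h2, h3⟩ := h
  refine ⟨i, m, getElem?_append_some h1 g, getElem?_append_some h2 g, ?_⟩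
  rwa [List.take_append_of_le_length (List.getElem?_eq_some_iff.mp h1).1.le,
    List.take_append_of_le_length (List.getElem?_eq_some_iff.mp h2).1.le]

theorem Follows.append {f : List (Action ι μ)} {s j : ℕ} (h : S.Follows f s j)
    (g : List (Action ι μ)) : S.Follows (f ++ g) s j := by
  induction h with
  | start h1 h2 h3 h4 =>
    exact .start (getElem?_append_some h1 g) (getElem?_append_some h2 g) h3 h4
  | step _ h1 h2 h3 h4 ih =>
    exact .step ih (getElem?_append_some h1 g) (getElem?_append_some h2 g) h3 h4
  | fwd _ h ih => exact .fwd ih (h.append g)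
  | back _ h ih => exact .back ih (h.append g)

theorem Follows.lt {f : List (Action ι μ)} {s j : ℕ} (h : S.Follows f s j) : j < f.length := by
  induction h with
  | start _ h => exact (List.getElem?_eq_some_iff.mp h).1
  | step _ _ h => exact (List.getElem?_eq_some_iff.mp h).1
  | fwd _ h => obtain ⟨i, m, -, h, -⟩ := h; exact (List.getElem?_eq_some_iff.mp h).1
  | back _ h => obtain ⟨i, m, h, -⟩ := h; exact (List.getElem?_eq_some_iff.mp h).1

/-- The action uses the resource named by the mark. -/
def Mark.Uses (S : System π ι μ) : Mark π ι → Action ι μ → Prop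
  | .none, _ => False
  | .bad, _ => False
  | .moved p, a => a ∈ (S.aut p).actions
  | .fresh p, a => a ∈ (S.aut p).actions
  | .snd i, a => a.1 = i ∧ a.2.1 = Dir.send
  | .rcv i, a => a.1 = i ∧ a.2.1 = Dir.recv

theorem Mark.Uses.not_commutes {c : Mark π ι} {a b : Action ι μ} (ha : c.Uses S a)
    (hb : c.Uses S b) : ¬ S.Commutes a b := by
  rintro ⟨h1, h2⟩
  cases c with
  | none => exact ha
  | bad => exact ha
  | moved p => exact h1 ⟨p, ha, hb⟩
  | fresh p => exact h1 ⟨p, ha, hb⟩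
  | snd i => exact h2 ⟨ha.1.trans hb.1.symm, ha.2.trans hb.2.symm⟩
  | rcv i => exact h2 ⟨ha.1.trans hb.1.symm, ha.2.trans hb.2.symm⟩

/-- The resource named by the mark is used by an action that follows the marked send, or by
the marked send itself. -/
def MarkedBy (S : System π ι μ) (f : List (Action ι μ)) (s : ℕ) (c : Mark π ι) : Prop :=
  ∃ j a, (S.Follows f s j ∨ j = s ∧ ∀ p, c ≠ .moved p) ∧ f[j]? = some a ∧ c.Uses S a

theorem MarkedBy.append {f : List (Action ι μ)} {s : ℕ} {c : Mark π ι} (h : S.MarkedBy f s c)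
    (g : List (Action ι μ)) : S.MarkedBy (f ++ g) s c := by
  obtain ⟨j, a, h1, h2, h3⟩ := h
  exact ⟨j, a, h1.imp (fun h => h.append g) id, getElem?_append_some h2 g, h3⟩

theorem MarkedBy.follows {f g : List (Action ι μ)} {s n : ℕ} {c : Mark π ι} {b : Action ι μ}
    (h : S.MarkedBy f s c) (hn : g[n]? = some b) (hb : c.Uses S b) :
    S.Follows (f ++ g) s (f.length + n) := by
  obtain ⟨j, a, h1, h2, h3⟩ := h
  have hlt := (List.getElem?_eq_some_iff.mp h2).1
  have hn' : (f ++ g)[f.length + n]? = some b := by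
    rw [List.getElem?_append_right (by omega), Nat.add_sub_cancel_left, hn]
  rcases h1 with h1 | ⟨rfl, -⟩
  · exact .step (h1.append g) (getElem?_append_some h2 g) hn' (by omega) (h3.not_commutes hb)
  · exact .start (getElem?_append_some h2 g) hn' (by omega) (h3.not_commutes hb)

theorem MarkedBy.of_follows {f g : List (Action ι μ)} {s n : ℕ} {c : Mark π ι} {b : Action ι μ}
    (h : S.Follows (f ++ g) s (f.length + n)) (hn : g[n]? = some b) (hb : c.Uses S b) :
    S.MarkedBy (f ++ g) s c :=
  ⟨_, b, Or.inl h, by rw [List.getElem?_append_right (by omega), Nat.add_sub_cancel_left, hn], hb⟩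

/-- The node is reached by an execution. -/
def Sound (x : S.Node) : Prop :=
  ∃ f c, S.Run S.initConfig f c ∧ c.state = x.state ∧ (∀ i, x.full i = false → c.buf i = []) ∧
    (x.mark = .none ∧ x.goal = none ∨ ∃ i m s, x.goal = some (i, m) ∧ x.full i = true ∧
      -- The equality of counts says that the next receive on `i` will be matched with the position
      -- `s`.
      f[s]? = some (i, Dir.send, m) ∧ countOn Dir.send i (f.take s) = countOn Dir.recv i f ∧
      (∃ t, c.buf i = m :: t) ∧ S.MarkedBy f s x.mark)

/-- In a greedy equivalent the last receive comes right after the marked send. All followers come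
after the marked send, and that next place is taken, so they come after the receive. But the
follower `j` belongs to the receiving process and must precede the receive. -/
theorem not_greedy_of_follows {f : List (Action ι μ)} {s j : ℕ} {i : ι} {m : μ} {x : S.Config}
    (hx : S.Run S.initConfig (f ++ [(i, Dir.recv, m)]) x) (hs : f[s]? = some (i, Dir.send, m))
    (hc : countOn Dir.send i (f.take s) = countOn Dir.recv i f) (hj : S.Follows f s j)
    {a : Action ι μ} (ha : f[j]? = some a) (hown : S.SameOwner a (i, Dir.recv, m)) :
    ¬ S.Greedy := by
  intro hG
  have hG' := hG _ ⟨x, hx⟩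
  obtain ⟨w, hw⟩ : ∃ w, w = f ++ [(i, Dir.recv, m)] := ⟨_, rfl⟩
  rw [← hw] at hG'
  obtain ⟨g, hg, σ, hl, hσ⟩ := hG'
  have hlen : w.length = f.length + 1 := by simp [hw]
  have hmono : ∀ k l : Fin w.length, k < l → ¬ S.Commutes (w.get k) (w.get l) → σ k < σ l :=
    fun k l hkl hn => ((hσ k l).mp ⟨hkl, Or.inl hn⟩).1
  have hmatch := isMatch_equiv σ hl fun k l h1 h2 hkl => hmono k l hkl fun h => h.2 ⟨h1, h2⟩
  have hpair : ∀ k l : Fin w.length, IsMatch w k l → (σ l).val = (σ k).val + 1 :=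
    fun k l h => hg _ _ ((hmatch k l).mpr h)
  have hsl := (List.getElem?_eq_some_iff.mp hs).1
  have hsome : ∀ {k : ℕ} {b : Action ι μ}, f[k]? = some b → w[k]? = some b :=
    fun h => by rw [hw]; exact getElem?_append_some h _
  have hmw : ∀ {k l : ℕ}, IsMatch f k l → IsMatch w k l := fun h => by rw [hw]; exact h.append _
  let t : Fin w.length := ⟨s, by omega⟩
  let r : Fin w.length := ⟨f.length, by omega⟩
  have hr : (σ r).val = (σ t).val + 1 := by
    refine hpair t r ⟨i, m, hsome hs, by simp [hw, r], ?_⟩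
    simp only [t, r, hw]
    rw [List.take_append_of_le_length hsl.le, hc]
    simp
  have hget : ∀ {k : ℕ} {b : Action ι μ} (hk : k < w.length), f[k]? = some b →
      w.get ⟨k, hk⟩ = b := by
    intro k b hk hb
    have := hsome hb
    simpa [hk] using this
  have hne : ∀ k (hk : k < f.length), (σ ⟨k, by omega⟩).val ≠ (σ t).val + 1 := by
    intro k hk h
    rw [← hr, Fin.val_inj, σ.apply_eq_iff_eq] at h
    simp [r] at h
    omega
  have hkey : ∀ k, S.Follows f s k → ∀ hk : k < w.length, (σ t).val + 1 < (σ ⟨k, hk⟩).val := by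
    intro k h
    induction h with
    | start h1 h2 h3 h4 =>
      intro hk
      have := hne _ (List.getElem?_eq_some_iff.mp h2).1
      have h5 := hmono t ⟨_, hk⟩ h3 (by rw [hget _ h1, hget _ h2]; exact h4)
      rw [Fin.lt_def] at h5
      omega
    | step hf h1 h2 h3 h4 ih =>
      intro hk
      have h6 := hf.lt
      have h5 := hmono ⟨_, by omega⟩ ⟨_, hk⟩ h3 (by rw [hget _ h1, hget _ h2]; exact h4)
      have h7 := ih (by omega)
      rw [Fin.lt_def] at h5
      omega
    | fwd hf h ih =>
      intro hk
      have h6 := hf.lt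
      have h5 := hpair ⟨_, by omega⟩ ⟨_, hk⟩ (hmw h)
      have h7 := ih (by omega)
      omega
    -- The send is one place before its receive, hence not before the place next to the marked send;
    -- and that place is occupied by the last receive.
    | @back k l hf h ih =>
      intro hk
      have h6 := hf.lt
      have h5 := hpair ⟨_, hk⟩ ⟨l, by omega⟩ (hmw h)
      have h7 := ih (by omega)
      have h8 := hne k (hf.back h).lt
      omega
  have h1 := hkey j hj (by have := hj.lt; omega)
  have h2 := hmono ⟨j, by have := hj.lt; omega⟩ r hj.lt (by
    rw [hget _ ha]
    have : w.get r = (i, Dir.recv, m) := by simp [hw, r]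
    rw [this]
    exact fun h => h.1 hown)
  rw [Fin.lt_def] at h2
  omega

theorem step_mk {x : S.Config} {p : π} {a : Action ι μ} {t : Fin (S.aut p).numStates}
    {b : ι → List μ} (h : (x.state p, a, t) ∈ (S.aut p).trans) (hb : BufStep x.buf a b) :
    S.Step x a ⟨Function.update x.state p t, b⟩ :=
  ⟨⟨p, by simpa using h, fun q hq => by simp [hq]⟩, hb⟩

theorem bufStep_send (b : ι → List μ) (i : ι) (m : μ) :
    BufStep b (i, Dir.send, m) (Function.update b i (b i ++ [m])) :=
  ⟨by simp, fun j hj => by simp at hj; simp [hj]⟩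

theorem bufStep_recv {b : ι → List μ} {i : ι} {m : μ} {t : List μ} (h : b i = m :: t) :
    BufStep b (i, Dir.recv, m) (Function.update b i t) :=
  ⟨by simpa using h, fun j hj => by simp at hj; simp [hj]⟩

/-- The step is carried out on an execution that realises `x`. Only a step of type `recv` ends the
simulation, and there `not_greedy_of_follows` applies. -/
theorem NodeStep.sound {x y : S.Node} (h : S.NodeStep x y) (hx : S.Sound x) :
    y.mark = .bad ∧ ¬ S.Greedy ∨ S.Sound y := by
  obtain ⟨f, c, hrun, hst, hbuf, hcase⟩ := hx
  cases h with
  | @lone p i m t c' h hc =>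
    right
    have hs := step_mk (x := c) (by rw [hst]; exact h) (bufStep_send c.buf i m)
    refine ⟨f ++ [(i, Dir.send, m)], _, hrun.append (Run.single hs), by rw [hst], ?_, ?_⟩
    · intro j hj
      by_cases hji : j = i
      · subst hji; simp at hj
      · simp [hji] at hj ⊢; exact hbuf j hj
    · rcases hcase with ⟨hm, hg⟩ | ⟨j, n, s, hg, hfull, hs, hcnt, ⟨u, hu⟩, hmk⟩
      · left
        simp only [LoneMark, hm] at hc
        simp at hc
        exact ⟨hc, hg⟩
      · right
        have hsl := (List.getElem?_eq_some_iff.mp hs).1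
        refine ⟨j, n, s, hg, ?_, getElem?_append_some hs _, ?_, ?_, ?_⟩
        · by_cases hji : j = i
          · subst hji; simp
          · simp [hji, hfull]
        · rw [List.take_append_of_le_length hsl.le, hcnt, countOn_append, countOn_singleton]
          simp
        · by_cases hji : j = i
          · subst hji; simp [hu]
          · simp [hji, hu]
        · rcases hc with rfl | ⟨hc, hc'⟩
          · exact hmk.append _
          · have hpa := (S.aut p).trans_sub _ h
            refine MarkedBy.of_follows (n := 0) (b := (i, Dir.send, m))
              (hmk.follows (b := (i, Dir.send, m)) rfl ?_) rfl ?_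
            · rcases hc with hc | hc | hc <;> rw [hc]
              exacts [hpa, hpa, ⟨rfl, rfl⟩]
            · rcases hc' with rfl | rfl
              exacts [hpa, ⟨rfl, rfl⟩]
  | @start p i m t c' h hi hg hm hc =>
    right
    have hs := step_mk (x := c) (by rw [hst]; exact h) (bufStep_send c.buf i m)
    refine ⟨f ++ [(i, Dir.send, m)], _, hrun.append (Run.single hs), by rw [hst], ?_, Or.inr
      ⟨i, m, f.length, rfl, by simp, by simp, ?_, ⟨[], by simp [hbuf i hi]⟩, ?_⟩⟩
    · intro j hj
      by_cases hji : j = i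
      · subst hji; simp at hj
      · simp [hji] at hj ⊢; exact hbuf j hj
    · have := hrun.count_init i
      rw [hbuf i hi] at this
      rw [countOn_append Dir.recv, countOn_singleton]
      simp at this ⊢
      exact this.symm
    · refine ⟨f.length, (i, Dir.send, m), Or.inr ⟨rfl, ?_⟩, by simp, ?_⟩
      · rcases hc with rfl | rfl <;> simp
      · rcases hc with rfl | rfl
        exacts [(S.aut p).trans_sub _ h, ⟨rfl, rfl⟩]
  | @exch p q i m t u c' h h' hi hc =>
    right
    have hs := step_mk (x := c) (by rw [hst]; exact h) (bufStep_send c.buf i m)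
    have hs' := step_mk (x := ⟨Function.update c.state p t, Function.update c.buf i (c.buf i ++ [m])⟩)
      (by rw [hst]; exact h') (bufStep_recv (i := i) (m := m) (t := []) (by simp [hbuf i hi]))
    refine ⟨f ++ [(i, Dir.send, m), (i, Dir.recv, m)], _,
      hrun.append (Run.cons hs (Run.single hs')), by rw [hst], ?_, ?_⟩
    · intro j hj
      by_cases hji : j = i
      · subst hji; simp
      · simp [hji]; exact hbuf j hj
    · rcases hcase with ⟨hm, hg⟩ | ⟨j, n, s, hg, hfull, hs, hcnt, ⟨u, hu⟩, hmk⟩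
      · left
        simp only [ExchMark, hm] at hc
        simp at hc
        exact ⟨hc, hg⟩
      · right
        have hsl := (List.getElem?_eq_some_iff.mp hs).1
        -- The buffer of the marked send is recorded as nonempty, so no exchange takes place on it
        -- and its first message stays.
        have hji : j ≠ i := by rintro rfl; rw [hi] at hfull; cases hfull
        refine ⟨j, n, s, hg, hfull, getElem?_append_some hs _, ?_, ⟨u, by simp [hji, hu]⟩, ?_⟩
        · rw [List.take_append_of_le_length hsl.le, hcnt, countOn_append]
          simp [countOn, hji.symm]
        · rcases hc with rfl | ⟨hc, hc'⟩
          · exact hmk.append _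
          · have hpa : (i, Dir.send, m) ∈ (S.aut p).actions := (S.aut p).trans_sub _ h
            have hqa : (i, Dir.recv, m) ∈ (S.aut q).actions := (S.aut q).trans_sub _ h'
            -- The buffer was empty, so the two new actions match each other and following passes
            -- between them in both directions.
            have hmt : IsMatch (f ++ [(i, Dir.send, m), (i, Dir.recv, m)]) (f.length + 0)
                (f.length + 1) := by
              refine ⟨i, m, by simp, by simp, ?_⟩
              have := hrun.count_init i
              rw [hbuf i hi] at this
              rw [List.take_length_add_append, List.take_length_add_append, countOn_append,
                countOn_append, ← this]
              simp [countOn]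
            have h0 : x.mark.Uses S (i, Dir.send, m) ∨ x.mark.Uses S (i, Dir.recv, m) := by
              rcases hc with hc | hc | hc | hc | hc | hc <;> rw [hc]
              exacts [Or.inl hpa, Or.inl hpa, Or.inl ⟨rfl, rfl⟩, Or.inr hqa, Or.inr hqa,
                Or.inr ⟨rfl, rfl⟩]
            have h1 : S.Follows (f ++ [(i, Dir.send, m), (i, Dir.recv, m)]) s (f.length + 0) := by
              rcases h0 with h0 | h0
              · exact hmk.follows (by simp) h0
              · exact (hmk.follows (n := 1) (by simp) h0).back hmt
            have h2 := h1.fwd hmt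
            rcases hc' with rfl | rfl | rfl | rfl
            · exact MarkedBy.of_follows h1 rfl hpa
            · exact MarkedBy.of_follows h1 rfl ⟨rfl, rfl⟩
            · exact MarkedBy.of_follows h2 rfl hqa
            · exact MarkedBy.of_follows h2 rfl ⟨rfl, rfl⟩
  | @recv p i m t h hg hm =>
    left
    refine ⟨rfl, ?_⟩
    rcases hcase with ⟨hm', -⟩ | ⟨j, n, s, hg', hfull, hs, hcnt, ⟨u, hu⟩, k, a, hk, hka, hown⟩
    · rw [hm] at hm'; cases hm'
    · rw [hg] at hg'
      simp only [Option.some.injEq, Prod.mk.injEq] at hg'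
      obtain ⟨rfl, rfl⟩ := hg'
      have hst' := step_mk (x := c) (by rw [hst]; exact h) (bufStep_recv hu)
      rw [hm] at hown
      rcases hk with hk | ⟨-, hk⟩
      · exact not_greedy_of_follows (hrun.append (Run.single hst')) hs hcnt hk hka
          ⟨p, hown, (S.aut p).trans_sub _ h⟩
      · exact absurd hm (hk p)

theorem Found.sound {x : S.Node} (h : S.Found x) : x.mark = .bad ∧ ¬ S.Greedy ∨ S.Sound x := by
  induction h with
  | refl =>
    exact Or.inr ⟨[], S.initConfig, Run.nil _, rfl, fun _ _ => rfl, Or.inl ⟨rfl, rfl⟩⟩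
  | tail _ hs ih =>
    rcases ih with ⟨hm, hG⟩ | h
    -- The mark `bad` is never left.
    · refine Or.inl ⟨?_, hG⟩
      cases hs with
      | lone h hc => simp only [LoneMark, hm] at hc; simpa using hc
      | start h hi hg hm' => rw [hm] at hm'; cases hm'
      | exch h h' hi hc => simp only [ExchMark, hm] at hc; simpa using hc
      | recv h hg hm' => rfl
    · exact hs.sound h

/-- A system is greedy if and only if the search finds no violation. -/
theorem greedy_iff : S.Greedy ↔ ¬ ∃ x : S.Node, S.Found x ∧ x.mark = .bad := by
  refine ⟨?_, fun h => greedy_of_not_found fun x hx hm => h ⟨x, hx, hm⟩⟩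
  rintro hG ⟨x, hx, hm⟩
  rcases hx.sound with ⟨-, h⟩ | ⟨f, c, -, -, -, ⟨h, -⟩ | ⟨i, m, s, -, -, -, -, -, j, a, -, -, h⟩⟩
  · exact h hG
  · rw [hm] at h; cases h
  · rw [hm] at h; exact h

end Violation

end System

end FIFO

namespace RAM

/-! ### Assignments coded by sums of powers of two -/

section Assign

variable {V : Type} [Fintype V] [DecidableEq V]

/-- The code of an assignment of elements to slots. -/
def assignCode (a : V → ℕ) : ℕ := ∑ z, 2 ^ a z

theorem testBit_sum {a : V → ℕ} (s : Finset V) (ha : Set.InjOn a s) (e : ℕ) :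
    (∑ z ∈ s, 2 ^ a z).testBit e = true ↔ ∃ z ∈ s, a z = e := by
  induction s using Finset.induction_on generalizing e with
  | empty => simp
  | insert z s hz ih =>
    have ih := ih (ha.mono (by simp))
    have h0 : (∑ z ∈ s, 2 ^ a z).testBit (a z) = false := by
      rw [Bool.eq_false_iff, ne_eq, ih]
      rintro ⟨y, hy, h⟩
      have := ha (by simp [hy]) (by simp) h
      exact hz (this ▸ hy)
    rw [Finset.sum_insert hz, add_comm, testBit_add_two_pow h0, Bool.or_eq_true, ih]
    simp [eq_comm, or_comm]

/-- Here `D z` is the set of elements reserved for the slot `z`. As these sets are disjoint, one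
digit tells whether a slot holds a given element. -/
theorem testBit_assignCode {D : V → ℕ → Prop} (hD : ∀ z z' e, D z e → D z' e → z = z')
    {a : V → ℕ} (ha : ∀ z, D z (a z)) {z : V} {e : ℕ} (he : D z e) :
    (assignCode a).testBit e = true ↔ a z = e := by
  rw [assignCode, testBit_sum _ fun x _ y _ h => hD x y _ (ha x) (by rw [h]; exact ha y)]
  constructor
  · rintro ⟨y, -, hy⟩
    rw [← hD y z e (hy ▸ ha y) he, hy]
  · exact fun h => ⟨z, by simp, h⟩

/-- The new element belongs to the same slot as the old one. Once the old one is removed, the slot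
is vacant and the second test of `swap` succeeds. -/
theorem swap_assignCode {D : V → ℕ → Prop} (hD : ∀ z z' e, D z e → D z' e → z = z')
    {a : V → ℕ} (ha : ∀ z, D z (a z)) {z : V} {f t : ℕ} (hf : D z f) (ht : D z t) :
    swap f t (assignCode a) =
      if a z = f then some (assignCode (Function.update a z t)) else none := by
  rw [swap]
  by_cases h : a z = f
  · have h1 := (testBit_assignCode hD ha hf).mpr h
    have h2 : ((assignCode a - 2 ^ f).testBit t) = false := by
      rw [testBit_sub_two_pow h1, Bool.and_eq_false_iff, Bool.eq_false_iff, ne_eq,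
        testBit_assignCode hD ha ht, h]
      simp
      tauto
    rw [if_pos h1, if_pos h, h2]
    simp only [Bool.false_eq_true, if_false, Option.some.injEq]
    rw [assignCode, assignCode, ← Finset.add_sum_erase _ _ (Finset.mem_univ z),
      ← Finset.add_sum_erase _ (fun y => 2 ^ Function.update a z t y) (Finset.mem_univ z), h,
      Nat.add_sub_cancel_left, add_comm]
    simp only [Function.update_self]
    congr 1
    refine Finset.sum_congr rfl fun y hy => ?_
    rw [Function.update_of_ne (Finset.ne_of_mem_erase hy)]
  · rw [if_neg h, if_neg]
    rwa [testBit_assignCode hD ha hf]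

theorem assignCode_lt {a : V → ℕ} (hi : Function.Injective a) {U : ℕ} (ha : ∀ z, a z < U) :
    assignCode a < 2 ^ U := by
  refine Nat.lt_pow_two_of_testBit _ fun e he => ?_
  rw [assignCode, Bool.eq_false_iff, ne_eq, testBit_sum _ hi.injOn]
  rintro ⟨z, -, rfl⟩
  exact absurd (ha z) (by omega)

end Assign

end RAM

namespace FIFO

namespace System

open RAM

/-! ### Codes of nodes -/

/-- The sum of the values at smaller indices. -/
def offset {k : ℕ} (L : Fin k → ℕ) (p : Fin k) : ℕ := ∑ q ∈ Finset.Iio p, L q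

theorem offset_add_le {k : ℕ} (L : Fin k → ℕ) {p q : Fin k} (h : p < q) :
    offset L p + L p ≤ offset L q := by
  rw [offset, offset, ← Finset.sum_insert (s := Finset.Iio p) (by simp) (f := L) |>.trans
    (add_comm _ _)]
  refine Finset.sum_le_sum_of_subset fun r hr => ?_
  simp at hr ⊢
  omega

theorem offset_add_le_sum {k : ℕ} (L : Fin k → ℕ) (p : Fin k) :
    offset L p + L p ≤ ∑ q, L q := by
  rw [offset, ← Finset.sum_insert (s := Finset.Iio p) (by simp) (f := L) |>.trans (add_comm _ _)]
  exact Finset.sum_le_sum_of_subset (Finset.subset_univ _)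

variable {k b v : ℕ} {S : System (Fin k) (Fin b) (Fin v)}

/-- A node, with the two parts of the goal separated. -/
structure Raw (S : System (Fin k) (Fin b) (Fin v)) where
  state : (p : Fin k) → Fin (S.aut p).numStates
  full : Fin b → Bool
  -- One element for each pair of a buffer and a message would make the number of elements grow with
  -- `b * v`.
  gbuf : Option (Fin b)
  gmsg : Option (Fin v)
  mark : Mark (Fin k) (Fin b)

/-- Separate the two parts of the goal. -/
def Node.raw (x : S.Node) : S.Raw :=
  ⟨x.state, x.full, x.goal.map Prod.fst, x.goal.map Prod.snd, x.mark⟩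

/-- The first state of a process in the common numbering of all states. -/
def base (S : System (Fin k) (Fin b) (Fin v)) (p : Fin k) : ℕ :=
  offset (fun p => (S.aut p).numStates) p

/-- The element for a state of a process. -/
def stateElem (S : System (Fin k) (Fin b) (Fin v)) (p : Fin k) (q : Fin (S.aut p).numStates) : ℕ :=
  16 * (S.base p + q) + 8

/-- The element for the filling of a buffer. -/
def fullElem (i : Fin b) (β : Bool) : ℕ := if β then 16 * i + 1 else 16 * i

/-- The element for the buffer of the goal. -/
def gbufElem : Option (Fin b) → ℕ
  | none => 9
  | some i => 16 * i + 2

/-- The element for the message of the goal. -/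
def gmsgElem : Option (Fin v) → ℕ
  | none => 10
  | some m => 16 * m + 3

/-- The element for the mark. -/
def markElem : Mark (Fin k) (Fin b) → ℕ
  | .none => 11
  | .bad => 12
  | .moved p => 16 * p + 4
  | .fresh p => 16 * p + 5
  | .snd i => 16 * i + 6
  | .rcv i => 16 * i + 7

/-- The elements for a slot. -/
def SlotElem (S : System (Fin k) (Fin b) (Fin v)) : Fin k ⊕ Fin b ⊕ Fin 3 → ℕ → Prop
  | .inl p, e => ∃ q, e = S.stateElem p q
  | .inr (.inl i), e => ∃ β, e = fullElem i β
  | .inr (.inr 0), e => ∃ o : Option (Fin b), e = gbufElem o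
  | .inr (.inr 1), e => ∃ o : Option (Fin v), e = gmsgElem o
  | .inr (.inr 2), e => ∃ c : Mark (Fin k) (Fin b), e = markElem c

/-- The elements of a node. -/
def Raw.elem (x : S.Raw) : Fin k ⊕ Fin b ⊕ Fin 3 → ℕ
  | .inl p => S.stateElem p (x.state p)
  | .inr (.inl i) => fullElem i (x.full i)
  | .inr (.inr 0) => gbufElem x.gbuf
  | .inr (.inr 1) => gmsgElem x.gmsg
  | .inr (.inr 2) => markElem x.mark

/-- The code of a node. -/
def Raw.code (x : S.Raw) : ℕ := assignCode x.elem

theorem Raw.slotElem (x : S.Raw) (z) : S.SlotElem z (x.elem z) := by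
  rcases z with p | i | j
  · exact ⟨_, rfl⟩
  · exact ⟨_, rfl⟩
  · fin_cases j
    exacts [⟨_, rfl⟩, ⟨_, rfl⟩, ⟨_, rfl⟩]

/-- A number that determines the kind of slot. -/
def slotTag : Fin k ⊕ Fin b ⊕ Fin 3 → ℕ → Prop
  | .inl _, e => e % 16 = 8
  | .inr (.inl _), e => e % 16 < 2
  | .inr (.inr 0), e => e % 16 = 2 ∨ e % 16 = 9
  | .inr (.inr 1), e => e % 16 = 3 ∨ e % 16 = 10
  | .inr (.inr 2), e => e % 16 ∈ [4, 5, 6, 7, 11, 12]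

theorem SlotElem.tag {z : Fin k ⊕ Fin b ⊕ Fin 3} {e : ℕ} (h : S.SlotElem z e) : slotTag z e := by
  rcases z with p | i | j
  · obtain ⟨q, rfl⟩ := h
    simp only [slotTag, stateElem]; omega
  · obtain ⟨β, rfl⟩ := h
    simp only [slotTag, fullElem]; split_ifs <;> omega
  · fin_cases j
    · obtain ⟨o, rfl⟩ := h
      change gbufElem o % 16 = 2 ∨ gbufElem o % 16 = 9
      rcases o with _ | o
      · exact Or.inr rfl
      · left; simp only [gbufElem]; omega
    · obtain ⟨o, rfl⟩ := h
      change gmsgElem o % 16 = 3 ∨ gmsgElem o % 16 = 10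
      rcases o with _ | o
      · exact Or.inr rfl
      · left; simp only [gmsgElem]; omega
    · obtain ⟨c, rfl⟩ := h
      change markElem c % 16 ∈ [4, 5, 6, 7, 11, 12]
      cases c <;> simp [markElem, Nat.add_mod]

/-- The residue modulo `16` determines the kind of slot; the residues `9` to `12` are reserved for
the elements without index. Within a kind the quotient determines the buffer, and for states the
process, whose states occupy an interval of the common numbering. -/
theorem SlotElem.unique (z z' : Fin k ⊕ Fin b ⊕ Fin 3) (e : ℕ) (h : S.SlotElem z e)
    (h' : S.SlotElem z' e) : z = z' := by
  have ht := h.tag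
  have ht' := h'.tag
  rcases z with p | i | j <;> rcases z' with p' | i' | j'
  · obtain ⟨q, rfl⟩ := h
    obtain ⟨q', h'⟩ := h'
    simp only [stateElem] at h'
    rcases lt_trichotomy p p' with hp | rfl | hp
    · have := offset_add_le (fun p => (S.aut p).numStates) hp
      simp only [base] at h'
      omega
    · rfl
    · have := offset_add_le (fun p => (S.aut p).numStates) hp
      simp only [base] at h'
      omega
  · simp only [slotTag] at ht ht'; omega
  · fin_cases j' <;> simp [slotTag] at ht ht' <;> omega
  · simp only [slotTag] at ht ht'; omega
  · obtain ⟨β, rfl⟩ := h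
    obtain ⟨β', h'⟩ := h'
    have : i = i' := by
      simp only [fullElem] at h'
      split_ifs at h' <;> omega
    rw [this]
  · fin_cases j' <;> simp [slotTag] at ht ht' <;> omega
  · fin_cases j <;> simp [slotTag] at ht ht' <;> omega
  · fin_cases j <;> simp [slotTag] at ht ht' <;> omega
  · fin_cases j <;> fin_cases j' <;> simp [slotTag] at ht ht' <;> first | rfl | omega

theorem stateElem_inj {p : Fin k} {q q' : Fin (S.aut p).numStates} :
    S.stateElem p q = S.stateElem p q' ↔ q = q' := by
  refine ⟨fun h => ?_, fun h => h ▸ rfl⟩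
  simp only [stateElem] at h
  omega

theorem fullElem_inj {i : Fin b} {β β' : Bool} : fullElem i β = fullElem i β' ↔ β = β' := by
  cases β <;> cases β' <;> simp [fullElem]

theorem gbufElem_inj {o o' : Option (Fin b)} : gbufElem o = gbufElem o' ↔ o = o' := by
  refine ⟨fun h => ?_, fun h => h ▸ rfl⟩
  cases o <;> cases o' <;> simp only [gbufElem] at h
  · rfl
  · omega
  · omega
  · congr 1; omega

theorem gmsgElem_inj {o o' : Option (Fin v)} : gmsgElem o = gmsgElem o' ↔ o = o' := by
  refine ⟨fun h => ?_, fun h => h ▸ rfl⟩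
  cases o <;> cases o' <;> simp only [gmsgElem] at h
  · rfl
  · omega
  · omega
  · congr 1; omega

theorem markElem_inj {c c' : Mark (Fin k) (Fin b)} : markElem c = markElem c' ↔ c = c' := by
  refine ⟨fun h => ?_, fun h => h ▸ rfl⟩
  cases c <;> cases c' <;> simp only [markElem] at h <;>
    first | rfl | (exfalso; omega) | (congr 1; omega)

theorem Raw.swap_eq (x : S.Raw) {z : Fin k ⊕ Fin b ⊕ Fin 3} {f t : ℕ} (hf : S.SlotElem z f)
    (ht : S.SlotElem z t) : swap f t x.code =
      if x.elem z = f then some (assignCode (Function.update x.elem z t)) else none :=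
  swap_assignCode SlotElem.unique x.slotElem hf ht

theorem Raw.swap_state (x : S.Raw) (p : Fin k) (q q' : Fin (S.aut p).numStates) :
    swap (S.stateElem p q) (S.stateElem p q') x.code = if x.state p = q then
      some (Raw.code (S := S) { x with state := Function.update x.state p q' }) else none := by
  rw [x.swap_eq (z := .inl p) ⟨_, rfl⟩ ⟨_, rfl⟩]
  simp only [Raw.elem, stateElem_inj]
  congr 3
  funext z
  rcases z with r | i | j
  · by_cases hr : r = p
    · subst hr; simp [Raw.elem]
    · simp [Raw.elem, hr]
  · simp [Raw.elem]
  · fin_cases j <;> simp [Raw.elem]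

theorem Raw.swap_full (x : S.Raw) (i : Fin b) (β β' : Bool) :
    swap (fullElem i β) (fullElem i β') x.code = if x.full i = β then
      some (Raw.code (S := S) { x with full := Function.update x.full i β' }) else none := by
  rw [x.swap_eq (z := .inr (.inl i)) ⟨_, rfl⟩ ⟨_, rfl⟩]
  simp only [Raw.elem, fullElem_inj]
  congr 3
  funext z
  rcases z with r | j | j
  · simp [Raw.elem]
  · by_cases hr : j = i
    · subst hr; simp [Raw.elem]
    · simp [Raw.elem, hr]
  · fin_cases j <;> simp [Raw.elem]

theorem Raw.swap_gbuf (x : S.Raw) (o o' : Option (Fin b)) :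
    swap (gbufElem o) (gbufElem o') x.code = if x.gbuf = o then
      some (Raw.code (S := S) { x with gbuf := o' }) else none := by
  rw [x.swap_eq (z := .inr (.inr 0)) ⟨_, rfl⟩ ⟨_, rfl⟩]
  simp only [Raw.elem, gbufElem_inj]
  congr 3
  funext z
  rcases z with r | j | j
  · simp [Raw.elem]
  · simp [Raw.elem]
  · fin_cases j <;> simp [Raw.elem]

theorem Raw.swap_gmsg (x : S.Raw) (o o' : Option (Fin v)) :
    swap (gmsgElem o) (gmsgElem o') x.code = if x.gmsg = o then
      some (Raw.code (S := S) { x with gmsg := o' }) else none := by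
  rw [x.swap_eq (z := .inr (.inr 1)) ⟨_, rfl⟩ ⟨_, rfl⟩]
  simp only [Raw.elem, gmsgElem_inj]
  congr 3
  funext z
  rcases z with r | j | j
  · simp [Raw.elem]
  · simp [Raw.elem]
  · fin_cases j <;> simp [Raw.elem]

theorem Raw.swap_mark (x : S.Raw) (c c' : Mark (Fin k) (Fin b)) :
    swap (markElem c) (markElem c') x.code = if x.mark = c then
      some (Raw.code (S := S) { x with mark := c' }) else none := by
  rw [x.swap_eq (z := .inr (.inr 2)) ⟨_, rfl⟩ ⟨_, rfl⟩]
  simp only [Raw.elem, markElem_inj]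
  congr 3
  funext z
  rcases z with r | j | j
  · simp [Raw.elem]
  · simp [Raw.elem]
  · fin_cases j <;> simp [Raw.elem]

theorem Raw.testBit_bad (x : S.Raw) : x.code.testBit 12 = true ↔ x.mark = .bad := by
  rw [Raw.code, testBit_assignCode SlotElem.unique x.slotElem (z := .inr (.inr 2)) (e := 12)
    ⟨.bad, rfl⟩]
  exact markElem_inj (c' := .bad)

end System

end FIFO

namespace FIFO

namespace System

open RAM

/-! ### Rules and steps of the search -/

section Rules

variable {k b v : ℕ} {S : System (Fin k) (Fin b) (Fin v)}

theorem apply_ite_cons {f t c d e : ℕ} {r : Rule} {P : Prop} [Decidable P]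
    (h : swap f t c = if P then some e else none) :
    Rule.apply ((f, t) :: r) c = some d ↔ P ∧ Rule.apply r e = some d := by
  rw [Rule.apply, h]
  by_cases hP : P <;> simp [hP]

theorem Raw.apply_state (x : S.Raw) (p : Fin k) (q q' : Fin (S.aut p).numStates) (r : Rule)
    (d : ℕ) : Rule.apply ((S.stateElem p q, S.stateElem p q') :: r) x.code = some d ↔
      x.state p = q ∧ Rule.apply r (Raw.code (S := S)
        { x with state := Function.update x.state p q' }) = some d :=
  apply_ite_cons (x.swap_state p q q')

theorem Raw.apply_full (x : S.Raw) (i : Fin b) (β β' : Bool) (r : Rule) (d : ℕ) :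
    Rule.apply ((fullElem i β, fullElem i β') :: r) x.code = some d ↔
      x.full i = β ∧ Rule.apply r (Raw.code (S := S)
        { x with full := Function.update x.full i β' }) = some d :=
  apply_ite_cons (x.swap_full i β β')

theorem Raw.apply_gbuf (x : S.Raw) (o o' : Option (Fin b)) (r : Rule) (d : ℕ) :
    Rule.apply ((gbufElem o, gbufElem o') :: r) x.code = some d ↔
      x.gbuf = o ∧ Rule.apply r (Raw.code (S := S) { x with gbuf := o' }) = some d :=
  apply_ite_cons (x.swap_gbuf o o')

theorem Raw.apply_gmsg (x : S.Raw) (o o' : Option (Fin v)) (r : Rule) (d : ℕ) :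
    Rule.apply ((gmsgElem o, gmsgElem o') :: r) x.code = some d ↔
      x.gmsg = o ∧ Rule.apply r (Raw.code (S := S) { x with gmsg := o' }) = some d :=
  apply_ite_cons (x.swap_gmsg o o')

theorem Raw.apply_mark (x : S.Raw) (c c' : Mark (Fin k) (Fin b)) (r : Rule) (d : ℕ) :
    Rule.apply ((markElem c, markElem c') :: r) x.code = some d ↔
      x.mark = c ∧ Rule.apply r (Raw.code (S := S) { x with mark := c' }) = some d :=
  apply_ite_cons (x.swap_mark c c')

theorem apply_nil (c d : ℕ) : Rule.apply [] c = some d ↔ d = c := by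
  simp [Rule.apply, eq_comm]

theorem Raw.lone_iff (x : S.Raw) (p : Fin k) (q q' : Fin (S.aut p).numStates) (i : Fin b) (d : ℕ) :
    (∃ r ∈ loneTmpl (S.stateElem p q) (S.stateElem p q') (fullElem i false) (fullElem i true)
      (markElem (k := k) (b := b) (.moved p)) (markElem (k := k) (b := b) (.fresh p))
      (markElem (k := k) (b := b) (.snd i)), Rule.apply r x.code = some d) ↔
    x.state p = q ∧ ∃ c, LoneMark p i x.mark c ∧
      d = Raw.code (S := S) { x with
        state := Function.update x.state p q'
        full := Function.update x.full i true
        mark := c } := by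
  simp only [loneTmpl, List.flatMap_cons, List.flatMap_nil, List.append_nil, List.map_cons,
    List.map_nil, List.mem_append, List.mem_cons, List.not_mem_nil, or_false, or_and_right,
    exists_or, exists_eq_left, Raw.apply_state, Raw.apply_full, Raw.apply_mark, apply_nil,
    Function.update_self, Function.update_idem, true_and]
  obtain ⟨st, fl, gb, gm, mk⟩ := x
  simp only [LoneMark]
  -- The template has one group of rules for an empty buffer and one for a nonempty buffer; exactly
  -- one of them applies.
  cases hf : fl i
  all_goals
    simp only [hf, Bool.false_eq_true, reduceCtorEq, false_and, and_false, or_false, false_or,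
      true_and]
    constructor
    · rintro (⟨h, rfl⟩ | ⟨h, h', rfl⟩ | ⟨h, h', rfl⟩ | ⟨h, h', rfl⟩ | ⟨h, h', rfl⟩ | ⟨h, h', rfl⟩ |
        ⟨h, h', rfl⟩)
      · exact ⟨h, _, Or.inl rfl, rfl⟩
      all_goals exact ⟨h, _, Or.inr ⟨by simp [h'], by simp⟩, rfl⟩
    · rintro ⟨h, c, rfl | ⟨h' | h' | h', rfl | rfl⟩, rfl⟩ <;> simp [*]

theorem Raw.start_iff (x : S.Raw) (p : Fin k) (q q' : Fin (S.aut p).numStates) (i : Fin b)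
    (m : Fin v) (d : ℕ) :
    (∃ r ∈ startTmpl (S.stateElem p q) (S.stateElem p q') (fullElem i false) (fullElem i true)
      (gbufElem (some i)) (gmsgElem (some m)) (gbufElem (b := b) none) (gmsgElem (v := v) none)
      (markElem (k := k) (b := b) .none) (markElem (k := k) (b := b) (.fresh p))
      (markElem (k := k) (b := b) (.snd i)), Rule.apply r x.code = some d) ↔
    x.state p = q ∧ x.full i = false ∧ x.gbuf = none ∧ x.gmsg = none ∧ x.mark = .none ∧
      ∃ c, (c = .fresh p ∨ c = .snd i) ∧ d = Raw.code (S := S)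
        ⟨Function.update x.state p q', Function.update x.full i true, some i, some m, c⟩ := by
  simp only [startTmpl, List.map_cons,
    List.map_nil, List.mem_append, List.mem_cons, List.not_mem_nil, or_false, or_and_right,
    exists_or, exists_eq_left, Raw.apply_state, Raw.apply_full, Raw.apply_mark, Raw.apply_gbuf,
    Raw.apply_gmsg, apply_nil]
  tauto

theorem Raw.exch_iff (x : S.Raw) (p p₂ : Fin k) (q q' : Fin (S.aut p).numStates)
    (q₂ q₂' : Fin (S.aut p₂).numStates) (i : Fin b) (d : ℕ) :
    (∃ r ∈ exchTmpl (S.stateElem p q) (S.stateElem p q') (S.stateElem p₂ q₂) (S.stateElem p₂ q₂')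
      (fullElem i false) (markElem (k := k) (b := b) (.moved p))
      (markElem (k := k) (b := b) (.fresh p)) (markElem (k := k) (b := b) (.snd i))
      (markElem (k := k) (b := b) (.moved p₂)) (markElem (k := k) (b := b) (.fresh p₂))
      (markElem (k := k) (b := b) (.rcv i)), Rule.apply r x.code = some d) ↔
    x.state p = q ∧ Function.update x.state p q' p₂ = q₂ ∧ x.full i = false ∧
      ∃ c, ExchMark p p₂ i x.mark c ∧ d = Raw.code (S := S) { x with
        state := Function.update (Function.update x.state p q') p₂ q₂'
        mark := c } := by
  have hup : x.full i = false → Function.update x.full i false = x.full := fun h => by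
    rw [← h, Function.update_eq_self]
  simp only [exchTmpl, List.flatMap_cons, List.flatMap_nil, List.append_nil, List.map_cons,
    List.map_nil, List.mem_append, List.mem_cons, List.not_mem_nil, or_false, or_and_right,
    exists_or, exists_eq_left, Raw.apply_state, Raw.apply_full, Raw.apply_mark, apply_nil,
    Function.update_self, Function.update_idem, true_and, List.cons_append, List.nil_append]
  constructor
  · intro h
    have h1 : x.state p = q ∧ Function.update x.state p q' p₂ = q₂ ∧ x.full i = false := by
      tauto
    rw [hup h1.2.2] at h
    refine ⟨h1.1, h1.2.1, h1.2.2, ?_⟩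
    rcases h with h | h
    · exact ⟨x.mark, Or.inl rfl, h.2.2.2⟩
    · simp only [h1, true_and] at h
      -- These are the `6 * 4` pairs of a mark used by the exchange and a mark passed on.
      rcases h with h | h | h | h | h | h | h | h | h | h | h | h | h | h | h | h | h | h | h | h |
        h | h | h | h
      all_goals exact ⟨_, Or.inr ⟨by simp [h.1], by simp⟩, h.2⟩
  · rintro ⟨h1, h2, h3, c, hc, h4⟩
    rw [hup h3]
    simp only [h1, h2, h3, true_and]
    rcases hc with rfl | ⟨hc, hc'⟩
    · left; exact h4
    · right
      rcases hc with hc | hc | hc | hc | hc | hc <;> rcases hc' with rfl | rfl | rfl | rfl <;>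
        simp [hc, h4]

theorem Raw.recv_iff (x : S.Raw) (p : Fin k) (q q' : Fin (S.aut p).numStates) (i : Fin b)
    (m : Fin v) (d : ℕ) :
    (∃ r ∈ recvTmpl (S.stateElem p q) (S.stateElem p q') (gbufElem (some i)) (gmsgElem (some m))
      (markElem (k := k) (b := b) (.moved p)) (markElem (k := k) (b := b) .bad),
      Rule.apply r x.code = some d) ↔
    x.state p = q ∧ x.gbuf = some i ∧ x.gmsg = some m ∧ x.mark = .moved p ∧
      d = Raw.code (S := S)
        ⟨Function.update x.state p q', x.full, some i, some m, .bad⟩ := by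
  simp only [recvTmpl, List.mem_cons, List.not_mem_nil, or_false, exists_eq_left, Raw.apply_state,
    Raw.apply_mark, Raw.apply_gbuf, Raw.apply_gmsg, apply_nil, Function.update_self,
    Function.update_idem, true_and]

/-- The number that codes the kind of an action. -/
def dirCode : Dir → ℕ
  | .send => 0
  | .recv => 1

/-- The record of a transition. -/
def transRec (S : System (Fin k) (Fin b) (Fin v)) (p : Fin k)
    (t : Fin (S.aut p).numStates × Action (Fin b) (Fin v) × Fin (S.aut p).numStates) : Rec :=
  ⟨dirCode t.2.1.2.1, p, S.base p + t.1, t.2.1.1, t.2.1.2.2, S.base p + t.2.2⟩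

/-- The record of an initial state. -/
def initRec (S : System (Fin k) (Fin b) (Fin v)) (p : Fin k) : Rec :=
  ⟨2, p, S.base p + (S.aut p).init, 0, 0, 0⟩

/-- The list consists of the records of the system. -/
def RecList (S : System (Fin k) (Fin b) (Fin v)) (rs : List Rec) : Prop :=
  ∀ t, t ∈ rs ↔ (∃ p, t = S.initRec p) ∨ ∃ p, ∃ u ∈ (S.aut p).trans, t = S.transRec p u

/-- Rules and steps correspond at codes of nodes. Nothing is claimed about other numbers, and none
of them is reached from the code of a node. -/
theorem rules_iff {rs : List Rec} (hrs : S.RecList rs) (x : S.Node) (d : ℕ) :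
    (∃ r ∈ rulesOf rs, Rule.apply r x.raw.code = some d) ↔
      ∃ y, S.NodeStep x y ∧ d = y.raw.code := by
  constructor
  · rintro ⟨r, hr, hd⟩
    obtain ⟨t, ht, hr⟩ := List.mem_flatMap.mp hr
    rcases (hrs t).mp ht with ⟨p, rfl⟩ | ⟨p, ⟨q, ⟨i, di, m⟩, q'⟩, hu, rfl⟩
    · simp [Rec.rules, initRec] at hr
    cases di with
    | send =>
      simp only [Rec.rules, transRec, dirCode, if_true, List.mem_append] at hr
      rcases hr with hr | hr
      · rcases List.mem_append.mp hr with hr | hr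
        · obtain ⟨h1, c, hc, rfl⟩ := (x.raw.lone_iff p q q' i d).mp ⟨r, hr, hd⟩
          exact ⟨_, NodeStep.lone (by rw [← h1] at hu; exact hu) hc, rfl⟩
        · obtain ⟨h1, h2, h3, h4, h5, c, hc, rfl⟩ := (x.raw.start_iff p q q' i m d).mp ⟨r, hr, hd⟩
          have hg : x.goal = none := by simpa [Node.raw] using h3
          exact ⟨_, NodeStep.start (by rw [← h1] at hu; exact hu) h2 hg h5 hc, rfl⟩
      · obtain ⟨t₂, ht₂, hr⟩ := List.mem_flatMap.mp hr
        rw [Rec.exchRules] at hr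
        split_ifs at hr with hcond
        · rcases (hrs t₂).mp ht₂ with ⟨p₂, rfl⟩ | ⟨p₂, ⟨q₂, ⟨i₂, di₂, m₂⟩, q₂'⟩, hu₂, rfl⟩
          · simp [initRec] at hcond
          · cases di₂ with
            | send => simp [transRec, dirCode] at hcond
            | recv =>
              obtain ⟨-, hi, hm⟩ := hcond
              obtain rfl : i₂ = i := Fin.ext hi
              obtain rfl : m₂ = m := Fin.ext hm
              obtain ⟨h1, h2, h3, c, hc, rfl⟩ :=
                (x.raw.exch_iff p p₂ q q' q₂ q₂' i₂ d).mp ⟨r, hr, hd⟩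
              exact ⟨_, NodeStep.exch (by rw [← h1] at hu; exact hu)
                (by rw [← h2] at hu₂; exact hu₂) h3 hc, rfl⟩
        · simp at hr
    | recv =>
      simp only [Rec.rules, transRec, dirCode, one_ne_zero, if_false, if_true] at hr
      obtain ⟨h1, h2, h3, h4, rfl⟩ := (x.raw.recv_iff p q q' i m d).mp ⟨r, hr, hd⟩
      have hg : x.goal = some (i, m) := by
        rcases hx : x.goal with _ | ⟨i', m'⟩
        · simp [Node.raw, hx] at h2
        · simp [Node.raw, hx] at h2 h3
          rw [h2, h3]
      refine ⟨_, NodeStep.recv (by rw [← h1] at hu; exact hu) hg h4, ?_⟩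
      simp [Node.raw, hg]
  · rintro ⟨y, h, rfl⟩
    have hmem : ∀ {p u}, u ∈ (S.aut p).trans → ∀ {r}, r ∈ (S.transRec p u).rules rs →
        r ∈ rulesOf rs := fun hu r hr =>
      List.mem_flatMap.mpr ⟨_, (hrs _).mpr (Or.inr ⟨_, _, hu, rfl⟩), hr⟩
    cases h with
    | @lone p i m t c h hc =>
      obtain ⟨r, hr, hd⟩ := (x.raw.lone_iff p (x.state p) t i _).mpr ⟨rfl, c, hc, rfl⟩
      refine ⟨r, hmem h ?_, hd⟩
      rw [Rec.rules, if_pos (show (S.transRec p _).kind = 0 from rfl)]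
      exact List.mem_append_left _ (List.mem_append_left _ hr)
    | @start p i m t c h hi hg hm hc =>
      obtain ⟨r, hr, hd⟩ := (x.raw.start_iff p (x.state p) t i m _).mpr
        ⟨rfl, hi, by simp [Node.raw, hg], by simp [Node.raw, hg], hm, c, hc, rfl⟩
      refine ⟨r, hmem h ?_, hd⟩
      rw [Rec.rules, if_pos (show (S.transRec p _).kind = 0 from rfl)]
      exact List.mem_append_left _ (List.mem_append_right _ hr)
    | @exch p q i m t u c h h' hi hc =>
      obtain ⟨r, hr, hd⟩ := (x.raw.exch_iff p q (x.state p) t _ u i _).mpr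
        ⟨rfl, rfl, hi, c, hc, rfl⟩
      refine ⟨r, hmem h ?_, hd⟩
      rw [Rec.rules, if_pos (show (S.transRec p _).kind = 0 from rfl)]
      refine List.mem_append_right _ (List.mem_flatMap.mpr
        ⟨_, (hrs _).mpr (Or.inr ⟨_, _, h', rfl⟩), ?_⟩)
      rw [Rec.exchRules, if_pos ⟨rfl, rfl, rfl⟩]
      exact hr
    | @recv p i m t h hg hm =>
      obtain ⟨r, hr, hd⟩ := (x.raw.recv_iff p (x.state p) t i m _).mpr
        ⟨rfl, by simp [Node.raw, hg], by simp [Node.raw, hg], hm, rfl⟩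
      refine ⟨r, hmem h ?_, ?_⟩
      · rw [Rec.rules, if_neg (by simp [transRec, dirCode]),
          if_pos (show (S.transRec p _).kind = 1 from rfl)]
        exact hr
      · rw [hd]
        simp [Node.raw, hg]

theorem ruleReach_iff {rs : List Rec} (hrs : S.RecList rs) (d : ℕ) :
    RuleReach (rulesOf rs) (S.initNode).raw.code d ↔ ∃ x, S.Found x ∧ d = x.raw.code := by
  constructor
  · intro h
    induction h with
    | refl => exact ⟨_, Relation.ReflTransGen.refl, rfl⟩
    | tail _ h ih =>
      obtain ⟨x, hx, rfl⟩ := ih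
      obtain ⟨y, hy, rfl⟩ := (rules_iff hrs x _).mp h
      exact ⟨y, hx.tail hy, rfl⟩
  · rintro ⟨x, hx, rfl⟩
    induction hx with
    | refl => exact Relation.ReflTransGen.refl
    | tail _ h ih => exact ih.tail ((rules_iff hrs _ _).mpr ⟨_, h, rfl⟩)

theorem exists_ruleReach_bad_iff {rs : List Rec} (hrs : S.RecList rs) :
    (∃ c, RuleReach (rulesOf rs) (S.initNode).raw.code c ∧ c.testBit 12 = true) ↔ ¬ S.Greedy := by
  rw [greedy_iff, not_not]
  constructor
  · rintro ⟨c, hc, hb⟩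
    obtain ⟨x, hx, rfl⟩ := (ruleReach_iff hrs c).mp hc
    exact ⟨x, hx, x.raw.testBit_bad.mp hb⟩
  · rintro ⟨x, hx, hb⟩
    exact ⟨_, (ruleReach_iff hrs _).mpr ⟨x, hx, rfl⟩, x.raw.testBit_bad.mpr hb⟩

end Rules

end System

end FIFO

namespace RAM

/-! ### Bounds for the rules -/

theorem loneTmpl_valid {S G F B P P' X U : ℕ} (hS : S < U) (hG : G < U) (hF : F < U) (hB : B < U)
    (hP : P < U) (hP' : P' < U) (hX : X < U) : ∀ r ∈ loneTmpl S G F B P P' X, Rule.Valid U r := by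
  intro r hr
  simp only [loneTmpl, List.mem_flatMap, List.mem_cons, List.mem_map] at hr
  obtain ⟨fb, hfb, hr⟩ := hr
  have h1 : fb.1 < U ∧ fb.2 < U := by
    simp at hfb; rcases hfb with rfl | rfl <;> simp [*]
  rcases hr with rfl | ⟨c, hc, rfl⟩
  · simp [Rule.Valid, *]
  · have h2 : c.1 < U ∧ c.2 < U := by
      simp at hc; rcases hc with rfl | rfl | rfl | rfl | rfl | rfl <;> simp [*]
    simp [Rule.Valid, *]

theorem startTmpl_valid {S G F B TI TM n₁ n₂ n₃ P' X U : ℕ} (hS : S < U) (hG : G < U) (hF : F < U)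
    (hB : B < U) (hTI : TI < U) (hTM : TM < U) (h₁ : n₁ < U) (h₂ : n₂ < U) (h₃ : n₃ < U)
    (hP' : P' < U) (hX : X < U) :
    ∀ r ∈ startTmpl S G F B TI TM n₁ n₂ n₃ P' X, Rule.Valid U r := by
  intro r hr
  simp only [startTmpl, List.mem_map] at hr
  obtain ⟨c, hc, rfl⟩ := hr
  have h2 : c < U := by simp at hc; rcases hc with rfl | rfl <;> assumption
  simp [Rule.Valid, *]

theorem exchTmpl_valid {S G S₂ G₂ F P P' X P₂ P₂' Y U : ℕ} (hS : S < U) (hG : G < U) (hS₂ : S₂ < U)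
    (hG₂ : G₂ < U) (hF : F < U) (hP : P < U) (hP' : P' < U) (hX : X < U) (hP₂ : P₂ < U)
    (hP₂' : P₂' < U) (hY : Y < U) :
    ∀ r ∈ exchTmpl S G S₂ G₂ F P P' X P₂ P₂' Y, Rule.Valid U r := by
  intro r hr
  rw [exchTmpl, List.mem_cons, List.mem_map] at hr
  rcases hr with rfl | ⟨c, hc, rfl⟩
  · simp [Rule.Valid, *]
  · obtain ⟨a, ha, hc⟩ := List.mem_flatMap.mp hc
    obtain ⟨e, he, rfl⟩ := List.mem_map.mp hc
    have h1 : a < U := by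
      simp at ha; rcases ha with rfl | rfl | rfl | rfl | rfl | rfl <;> assumption
    have h2 : e < U := by
      simp at he; rcases he with rfl | rfl | rfl | rfl <;> assumption
    simp [Rule.Valid, *]

theorem rulesOf_valid {rs : List Rec} {U : ℕ} (hU : 12 < U)
    (h : ∀ t ∈ rs, 16 * t.src + 8 < U ∧ 16 * t.tgt + 8 < U ∧ 16 * t.proc + 5 < U ∧
      16 * t.buf + 7 < U ∧ 16 * t.msg + 3 < U) : ∀ r ∈ rulesOf rs, r.Valid U := by
  intro r hr
  obtain ⟨t, ht, hr⟩ := List.mem_flatMap.mp hr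
  obtain ⟨h1, h2, h3, h4, h5⟩ := h t ht
  rw [Rec.rules] at hr
  split_ifs at hr
  · rcases List.mem_append.mp hr with hr | hr
    · rcases List.mem_append.mp hr with hr | hr
      · exact loneTmpl_valid h1 h2 (by omega) (by omega) (by omega) (by omega) (by omega) r hr
      · exact startTmpl_valid h1 h2 (by omega) (by omega) (by omega) (by omega) (by omega)
          (by omega) (by omega) (by omega) (by omega) r hr
    · obtain ⟨t₂, ht₂, hr⟩ := List.mem_flatMap.mp hr
      obtain ⟨g1, g2, g3, g4, g5⟩ := h t₂ ht₂
      rw [Rec.exchRules] at hr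
      split_ifs at hr
      · exact exchTmpl_valid h1 h2 g1 g2 (by omega) (by omega) (by omega) (by omega) (by omega)
          (by omega) (by omega) r hr
      · simp at hr
  · rw [Rec.recvRules, recvTmpl, List.mem_singleton] at hr
    subst hr
    have e1 : 16 * t.buf + 2 < U := by omega
    have e2 : 16 * t.proc + 4 < U := by omega
    simp [Rule.Valid, *]
  · simp at hr

theorem length_flatMap_le {α β : Type} (l : List α) (f : α → List β) (n : ℕ)
    (h : ∀ a ∈ l, (f a).length ≤ n) : (l.flatMap f).length ≤ l.length * n := by
  induction l with
  | nil => simp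
  | cons a l ih =>
    have h1 := h a (by simp)
    have h2 := ih fun x hx => h x (by simp [hx])
    simp only [List.flatMap_cons, List.length_append, List.length_cons]
    rw [add_mul]
    omega

/-- A send gives `14 + 2` rules of its own and at most `25` for each possible partner. The pairing
of two transitions makes the number of rules quadratic, whence the `2` in the exponent of the time
bound. -/
theorem length_rulesOf_le (rs : List Rec) :
    (rulesOf rs).length ≤ rs.length * (16 + rs.length * 25) := by
  refine length_flatMap_le _ _ _ fun t _ => ?_
  rw [Rec.rules]
  split_ifs
  · rw [List.length_append]
    have h1 : t.sendRules.length = 16 := rfl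
    have h2 := length_flatMap_le rs t.exchRules 25 fun t₂ _ => by
      rw [Rec.exchRules]
      split_ifs
      · exact le_of_eq rfl
      · simp
    omega
  · have : t.recvRules.length = 1 := rfl
    omega
  · simp

end RAM

namespace FIFO

namespace System

open RAM

/-! ### Records of a coded system -/

theorem sum_map_range (n : ℕ) (f : ℕ → ℕ) :
    ((List.range n).map f).sum = ∑ x ∈ Finset.range n, f x := by
  induction n with
  | zero => simp
  | succ n ih => simp [List.range_succ, Finset.sum_range_succ, ih]

theorem offset_zero {k : ℕ} (L : Fin (k + 1) → ℕ) : offset L 0 = 0 := by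
  simp [offset]

theorem offset_succ {k : ℕ} (L : Fin (k + 1) → ℕ) (p : Fin k) :
    offset L p.succ = L 0 + offset (fun q => L q.succ) p := by
  have h : ∀ {k : ℕ} (L : Fin k → ℕ) (p : Fin k), offset L p = ∑ q, if q < p then L q else 0 := by
    intro k L p
    rw [offset, ← Finset.sum_filter]
    congr 1
    ext q
    simp
  rw [h, h, Fin.sum_univ_succ]
  simp

theorem mem_recsFrom {k : ℕ} (D : Fin k → AutData) (p o : ℕ) (t : Rec) :
    t ∈ recsFrom p o (List.ofFn D) ↔
      ∃ j : Fin k, t ∈ (D j).recs (p + j) (o + offset (fun j => (D j).numStates) j) := by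
  induction k generalizing p o with
  | zero => simp [recsFrom]
  | succ k ih =>
    rw [List.ofFn_succ, recsFrom, List.mem_append, ih, Fin.exists_fin_succ, offset_zero]
    simp only [offset_succ, Fin.val_zero, add_zero, Fin.val_succ]
    simp only [add_assoc, add_comm 1]

theorem sum_map_recsFrom {k : ℕ} (D : Fin k → AutData) (p o : ℕ) (g : Rec → ℕ) :
    ((recsFrom p o (List.ofFn D)).map g).sum = ∑ j : Fin k,
      (((D j).recs (p + j) (o + offset (fun j => (D j).numStates) j)).map g).sum := by
  induction k generalizing p o with
  | zero => simp [recsFrom]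
  | succ k ih =>
    rw [List.ofFn_succ, recsFrom, List.map_append, List.sum_append, ih, Fin.sum_univ_succ,
      offset_zero]
    simp only [offset_succ, Fin.val_zero, add_zero, Fin.val_succ]
    simp only [add_assoc, add_comm 1]

/-! ### From the input word to records and codes -/

section Input

variable {k b v : ℕ} {S : System (Fin k) (Fin b) (Fin v)}

/-- The data of a transition. -/
def transData {n : ℕ} (t : Fin n × Action (Fin b) (Fin v) × Fin n) : ℕ × ℕ × ℕ × ℕ × ℕ :=
  (t.1, t.2.1.1, dirCode t.2.1.2.1, t.2.1.2.2, t.2.2)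

/-- The data describe the automaton. -/
def Describes (D : AutData) (A : Automaton (Fin b) (Fin v)) : Prop :=
  D.numStates = A.numStates ∧ D.init = A.init ∧ ∃ lt, Lists lt A.trans ∧ D.trans = lt.map transData

theorem exists_describes {A : Automaton (Fin b) (Fin v)} {w : List ℕ} (h : CodesAutomaton A w) :
    ∃ D : AutData, D.code = w ∧ Describes D A := by
  obtain ⟨lm, lb, la, lt, -, -, -, ht, rfl⟩ := h
  refine ⟨⟨A.numStates, A.init, lm.map Fin.val, lb.map Fin.val,
    la.map fun a => (a.1, dirCode a.2.1, a.2.2), lt.map transData⟩, ?_, rfl, rfl, lt, ht, rfl⟩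
  have h1 : ∀ a : Action (Fin b) (Fin v), codeAction a = [a.1.val, dirCode a.2.1, a.2.2.val] := by
    rintro ⟨i, d, m⟩
    cases d <;> rfl
  have h2 : ∀ t : Fin A.numStates × Action (Fin b) (Fin v) × Fin A.numStates, codeTrans t =
      [t.1.val, t.2.1.1.val, dirCode t.2.1.2.1, t.2.1.2.2.val, t.2.2.val] := by
    intro t
    rw [codeTrans, h1]
    rfl
  simp only [AutData.code, List.length_map, List.flatMap_map, transData]
  have h3 : codeAction (b := b) (v := v) = fun a => [a.1.val, dirCode a.2.1, a.2.2.val] := funext h1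
  have h4 : codeTrans (n := A.numStates) (b := b) (v := v) = fun t =>
    [t.1.val, t.2.1.1.val, dirCode t.2.1.2.1, t.2.1.2.2.val, t.2.2.val] := funext h2
  simp only [h3, h4, List.append_assoc, List.cons_append, List.nil_append]

theorem exists_data {w : List ℕ} (h : CodesSystem S w) : ∃ D : Fin k → AutData,
    w = [k, b, v] ++ (List.ofFn D).flatMap AutData.code ∧ ∀ p, Describes (D p) (S.aut p) := by
  obtain ⟨c, hc, rfl⟩ := h
  choose D hD hD' using fun p => exists_describes (hc p)
  refine ⟨D, ?_, hD'⟩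
  rw [List.flatMap, List.map_ofFn]
  congr 3
  funext p
  exact (hD p).symm

variable {D : Fin k → AutData}

theorem Describes.length {D : AutData} {A : Automaton (Fin b) (Fin v)} (h : Describes D A) :
    D.trans.length = A.trans.card := by
  classical
  obtain ⟨-, -, lt, ⟨hn, hm⟩, h⟩ := h
  rw [h, List.length_map, ← List.toFinset_card_of_nodup hn]
  congr 1
  ext t
  rw [List.mem_toFinset, hm]

theorem base_eq (hD : ∀ p, Describes (D p) (S.aut p)) (p : Fin k) :
    offset (fun j => (D j).numStates) p = S.base p := by
  rw [base]
  congr 1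
  funext q
  exact (hD q).1

theorem mem_recs_iff (hD : ∀ p, Describes (D p) (S.aut p)) (p : Fin k) (t : Rec) :
    t ∈ (D p).recs p (S.base p) ↔ t = S.initRec p ∨ ∃ u ∈ (S.aut p).trans, t = S.transRec p u := by
  obtain ⟨-, hi, lt, ⟨-, hm⟩, h⟩ := hD p
  rw [AutData.recs, List.mem_cons, hi, h, List.map_map, List.mem_map]
  refine or_congr Iff.rfl ⟨?_, ?_⟩
  · rintro ⟨u, hu, rfl⟩
    exact ⟨u, (hm u).mp hu, rfl⟩
  · rintro ⟨u, hu, rfl⟩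
    exact ⟨u, (hm u).mpr hu, rfl⟩

theorem recList (hD : ∀ p, Describes (D p) (S.aut p)) :
    S.RecList (recsFrom 0 0 (List.ofFn D)) := by
  intro t
  rw [mem_recsFrom]
  simp only [zero_add, base_eq hD, mem_recs_iff hD]
  rw [exists_or]

theorem length_recs (hD : ∀ p, Describes (D p) (S.aut p)) :
    (recsFrom 0 0 (List.ofFn D)).length = ∑ p, (1 + (S.aut p).trans.card) := by
  have := sum_map_recsFrom D 0 0 fun _ => 1
  rw [List.map_const', List.sum_replicate, smul_eq_mul, mul_one] at this
  rw [this]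
  refine Finset.sum_congr rfl fun p _ => ?_
  rw [List.map_const', List.sum_replicate, smul_eq_mul, mul_one, AutData.recs, List.length_cons,
    List.length_map, (hD p).length, add_comm]

/-- Among the records of a process only that of the initial state has kind `2`, so the sum over
records has one nonzero term for each process. -/
theorem initSum_eq (hD : ∀ p, Describes (D p) (S.aut p)) :
    initSum (recsFrom 0 0 (List.ofFn D)) b = S.initNode.raw.code := by
  have h1 : ((List.range b).map fun x => 2 ^ (16 * x)).sum = ∑ i : Fin b, 2 ^ (16 * i.val) := by
    rw [← Finset.sum_range fun x => 2 ^ (16 * x), sum_map_range]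
  rw [initSum, sum_map_recsFrom, h1, Raw.code, assignCode, Fintype.sum_sum_type,
    Fintype.sum_sum_type, Fin.sum_univ_three]
  have h2 : ∀ p, (((D p).recs (0 + p) (0 + offset (fun j => (D j).numStates) p)).map fun t =>
      if 2 ≤ t.kind then 2 ^ (16 * t.src + 8) else 0).sum =
        2 ^ (S.initNode.raw.elem (.inl p)) := by
    intro p
    obtain ⟨-, hi, lt, -, h⟩ := hD p
    rw [zero_add, zero_add, base_eq hD, AutData.recs, hi, h]
    simp only [List.map_cons, List.map_map, le_refl, if_true, List.sum_cons]
    rw [List.sum_eq_zero]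
    · rfl
    · intro n hn
      obtain ⟨u, -, rfl⟩ := List.mem_map.mp hn
      obtain ⟨q, ⟨i, d, m⟩, q'⟩ := u
      cases d <;> rfl
  simp only [h2]
  have h3 : ∀ i : Fin b, S.initNode.raw.elem (.inr (.inl i)) = 16 * i.val := fun _ => rfl
  have h4 : S.initNode.raw.elem (.inr (.inr 0)) = 9 := rfl
  have h5 : S.initNode.raw.elem (.inr (.inr 1)) = 10 := rfl
  have h6 : S.initNode.raw.elem (.inr (.inr 2)) = 11 := rfl
  simp only [h3, h4, h5, h6]
  ring

theorem Raw.elem_lt (x : S.Raw) (z) :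
    x.elem z < elemBound k b v (∑ p, (S.aut p).numStates) := by
  rw [elemBound]
  rcases z with p | i | j
  · have := offset_add_le_sum (fun p => (S.aut p).numStates) p
    have h2 := (x.state p).2
    simp only [Raw.elem, stateElem, base]
    omega
  · simp only [Raw.elem, fullElem]
    split_ifs <;> omega
  · fin_cases j
    · change gbufElem x.gbuf < _
      rcases x.gbuf with _ | i <;> simp only [gbufElem] <;> omega
    · change gmsgElem x.gmsg < _
      rcases x.gmsg with _ | i <;> simp only [gmsgElem] <;> omega
    · change markElem x.mark < _
      rcases x.mark with _ | _ | _ | _ | _ | _ <;> simp only [markElem] <;> omega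

theorem Raw.code_lt (x : S.Raw) :
    x.code < 2 ^ elemBound k b v (∑ p, (S.aut p).numStates) :=
  assignCode_lt (fun z z' h => SlotElem.unique z z' _ (x.slotElem z) (by
    rw [h]; exact x.slotElem z')) x.elem_lt

theorem rec_bounds {rs : List Rec} (h : S.RecList rs) : ∀ t ∈ rs,
    16 * t.src + 8 < elemBound k b v (∑ p, (S.aut p).numStates) ∧
    16 * t.tgt + 8 < elemBound k b v (∑ p, (S.aut p).numStates) ∧
    16 * t.proc + 5 < elemBound k b v (∑ p, (S.aut p).numStates) ∧
    16 * t.buf + 7 < elemBound k b v (∑ p, (S.aut p).numStates) ∧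
    16 * t.msg + 3 < elemBound k b v (∑ p, (S.aut p).numStates) := by
  intro t ht
  simp only [elemBound]
  rcases (h t).mp ht with ⟨p, rfl⟩ | ⟨p, u, -, rfl⟩
  · have := offset_add_le_sum (fun p => (S.aut p).numStates) p
    have h2 := (S.aut p).init.2
    simp only [initRec, base]
    omega
  · have := offset_add_le_sum (fun p => (S.aut p).numStates) p
    have h2 := u.1.2
    have h3 := u.2.2.2
    have h4 := u.2.1.1.2
    have h5 := u.2.1.2.2.2
    simp only [transRec, base]
    omega

theorem greedy_of_no_actions (h : b = 0 ∨ v = 0) : S.Greedy := by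
  rintro e -
  rcases e with _ | ⟨⟨i, d, m⟩, e⟩
  · exact ⟨[], fun j k ⟨i, m, h, _⟩ => by simp at h, CausalEquiv.refl []⟩
  · have := i.2
    have := m.2
    omega

/-! ### The number of nodes -/

/-- Forget the names in a mark. -/
def Mark.toSum : Mark (Fin k) (Fin b) → (Fin k ⊕ Fin k) ⊕ (Fin b ⊕ Fin b) ⊕ Bool
  | .none => .inr (.inr false)
  | .bad => .inr (.inr true)
  | .moved p => .inl (.inl p)
  | .fresh p => .inl (.inr p)
  | .snd i => .inr (.inl (.inl i))
  | .rcv i => .inr (.inl (.inr i))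

/-- A node as a tuple. -/
def Node.toProd (x : S.Node) : ((p : Fin k) → Fin (S.aut p).numStates) × (Fin b → Bool) ×
    Option (Fin b × Fin v) × ((Fin k ⊕ Fin k) ⊕ (Fin b ⊕ Fin b) ⊕ Bool) :=
  (x.state, x.full, x.goal, x.mark.toSum)

theorem Node.toProd_injective : Function.Injective (Node.toProd (S := S)) := by
  rintro ⟨s, f, g, c⟩ ⟨s', f', g', c'⟩ h
  simp only [Node.toProd, Prod.mk.injEq] at h
  obtain ⟨rfl, rfl, rfl, h⟩ := h
  have : c = c' := by
    cases c <;> cases c' <;> simp [Mark.toSum] at h ⊢ <;> exact h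
  rw [this]

noncomputable instance : Fintype S.Node := Fintype.ofInjective _ Node.toProd_injective

/-- The last factor is linear in `k` and `b` because a node remembers one resource and not the set
of all resources touched by followers. -/
theorem card_node_le : Fintype.card S.Node ≤
    (∏ p, (S.aut p).numStates) * (2 ^ b * ((b * v + 1) * (2 * k + 2 * b + 2))) := by
  refine (Fintype.card_le_of_injective _ Node.toProd_injective).trans (le_of_eq ?_)
  simp only [Fintype.card_prod, Fintype.card_pi, Fintype.card_fin, Fintype.card_bool,
    Fintype.card_option, Fintype.card_sum, Finset.prod_const, Finset.card_univ]
  ring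

theorem length_le_of_ruleReach {rs : List Rec} (hrs : S.RecList rs) (Q : List ℕ) (hQ : Q.Nodup)
    (h : ∀ c ∈ Q, RuleReach (rulesOf rs) S.initNode.raw.code c) :
    Q.length ≤ Fintype.card S.Node := by
  classical
  rw [← List.toFinset_card_of_nodup hQ]
  refine (Finset.card_le_card (t := Finset.univ.image fun x : S.Node => x.raw.code)
    fun c hc => ?_).trans Finset.card_image_le
  obtain ⟨x, -, rfl⟩ := (ruleReach_iff hrs c).mp (h c (List.mem_toFinset.mp hc))
  exact Finset.mem_image_of_mem _ (Finset.mem_univ x)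

end Input

end System

end FIFO

/-! ### The running time -/

/-- The marks contribute a factor `k` to the number of nodes, which is absorbed here without raising
the exponent of `n`. For each `p` the factor `L p` is split off and the other factors are bounded by
`n`; the split factors add up to at most `n`. -/
theorem card_mul_prod_le {k n : ℕ} (L : Fin k → ℕ) (h : ∑ p, L p ≤ n) :
    k * ∏ p, L p ≤ n ^ k := by
  classical
  rcases k with _ | k
  · simp
  have h1 : ∀ p, ∏ q ∈ Finset.univ.erase p, L q ≤ n ^ k := fun p => by
    refine (Finset.prod_le_pow_card _ _ n fun q _ =>
      (Finset.single_le_sum (fun _ _ => Nat.zero_le _) (Finset.mem_univ q)).trans h).trans ?_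
    simp
  calc (k + 1) * ∏ p, L p = ∑ p : Fin (k + 1), L p * ∏ q ∈ Finset.univ.erase p, L q := by
        rw [Finset.sum_congr rfl fun p _ => Finset.mul_prod_erase _ L (Finset.mem_univ p)]
        simp
    _ ≤ ∑ p : Fin (k + 1), L p * n ^ k := Finset.sum_le_sum fun p _ => Nat.mul_le_mul_left _ (h1 p)
    _ = (∑ p, L p) * n ^ k := by rw [Finset.sum_mul]
    _ ≤ n * n ^ k := Nat.mul_le_mul_right _ h
    _ = n ^ (k + 1) := by ring

/-- All polynomial quantities are compared with `Y = n * n * b * v`, which also bounds the cost of a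
node up to a constant. Nodes times cost gives `b ^ 3 * v ^ 2 * 2 ^ b * n ^ (k + 2)`, so the
exponents `5` and `4` leave room. -/
theorem timeBound_le {k b v n m R L N M G : ℕ} (hk : 1 ≤ k) (hb : 1 ≤ b) (hv : 1 ≤ v)
    (hm : m ≤ n) (hR : R ≤ n) (hkR : k ≤ R) (hL : L ≤ n) (hM : M ≤ R * (16 + R * 25))
    (hN : N ≤ G * (2 ^ b * ((b * v + 1) * (2 * k + 2 * b + 2)))) (hG : k * G ≤ n ^ k) :
    RAM.timeBound k b m R (RAM.elemBound k b v L) N M + 20 ≤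
      150000 * (b ^ 5 * v ^ 4 * 2 ^ b * n ^ (k + 2)) := by
  have hkn : k ≤ n := hkR.trans hR
  have hn : 1 ≤ n := hk.trans hkn
  set U := RAM.elemBound k b v L with hU
  set Y := n * n * b * v with hY
  have hY1 : 1 ≤ Y := by rw [hY]; exact Nat.mul_pos (by positivity) hv
  have hnY : n * n ≤ Y := by
    rw [hY, mul_assoc]
    exact Nat.le_mul_of_pos_right _ (by positivity)
  have hn1 : n ≤ n * n := Nat.le_mul_of_pos_right _ hn
  have hbY : b ≤ Y := by
    rw [hY, mul_right_comm]; exact Nat.le_mul_of_pos_left _ (by positivity)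
  have hvY : v ≤ Y := Nat.le_mul_of_pos_left _ (by positivity)
  -- Each of the five summands in `elemBound` is at most `Y`, and `80 = 16 * 5`.
  have hUY : U ≤ 80 * Y := by rw [hU, RAM.elemBound]; omega
  have hRR : R * R ≤ n * n := Nat.mul_le_mul hR hR
  have hMY : M ≤ 41 * Y := by
    have : R * (16 + R * 25) = 16 * R + 25 * (R * R) := by ring
    omega
  -- The constant is `15 * 80 + 250 * 41 + 40`.
  have hper : U * 15 + M * 250 + 40 ≤ 11490 * Y := by omega
  have hNX : N ≤ 12 * (n ^ k * 2 ^ b * (b ^ 2 * v)) := by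
    have h1 : b * v + 1 ≤ 2 * (b * v) := by
      have := Nat.mul_pos hb hv
      omega
    have h2 : 2 * k + 2 * b + 2 ≤ 6 * (k * b) := by
      have h3 : k ≤ k * b := Nat.le_mul_of_pos_right _ hb
      have h4 : b ≤ k * b := Nat.le_mul_of_pos_left _ hk
      omega
    calc N ≤ G * (2 ^ b * ((b * v + 1) * (2 * k + 2 * b + 2))) := hN
      _ ≤ G * (2 ^ b * ((2 * (b * v)) * (6 * (k * b)))) := by gcongr
      _ = 12 * ((k * G) * 2 ^ b * (b ^ 2 * v)) := by ring
      _ ≤ 12 * (n ^ k * 2 ^ b * (b ^ 2 * v)) := by gcongr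
  set X := b ^ 5 * v ^ 4 * 2 ^ b * n ^ (k + 2) with hX
  have hNper : N * (U * 15 + M * 250 + 40) ≤ 137880 * X := by
    calc N * (U * 15 + M * 250 + 40)
        ≤ (12 * (n ^ k * 2 ^ b * (b ^ 2 * v))) * (11490 * Y) := Nat.mul_le_mul hNX hper
      _ = 137880 * (b ^ 3 * v ^ 2 * 2 ^ b * n ^ (k + 2)) := by rw [hY]; ring
      _ ≤ 137880 * X := by
        rw [hX]
        gcongr <;> first | assumption | norm_num
  have hYX : Y ≤ X := by
    calc Y = b ^ 1 * v ^ 1 * 1 * n ^ 2 := by rw [hY]; ring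
      _ ≤ b ^ 5 * v ^ 4 * 2 ^ b * n ^ (k + 2) := by
        gcongr <;> first | assumption | exact Nat.one_le_two_pow | omega
  have h1 : k * (m * 31 + 70) ≤ 101 * Y := by
    calc k * (m * 31 + 70) ≤ n * (n * 31 + 70 * n) := by gcongr; omega
      _ = 101 * (n * n) := by ring
      _ ≤ 101 * Y := by gcongr
  have h2 : R * (R * 580 + 460) ≤ 1040 * Y := by
    calc R * (R * 580 + 460) ≤ n * (n * 580 + 460 * n) := by gcongr; omega
      _ = 1040 * (n * n) := by ring
      _ ≤ 1040 * Y := by gcongr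
  rw [RAM.timeBound]
  omega

/-! ### Conclusion -/

namespace FIFO

namespace System

open RAM

theorem decides {k b v : ℕ} (S : System (Fin k) (Fin b) (Fin v)) {w : List ℕ}
    (h : CodesSystem S w) :
    Tri decideProg (initState w) (150000 * max 1 (b ^ 5 * v ^ 4 * 2 ^ b * S.size ^ (k + 2)))
      (fun u => (¬ S.Greedy ∧ u.reg 0 = 0) ∨ (¬ ¬ S.Greedy ∧ u.reg 0 = 1)) := by
  obtain ⟨D, rfl, hD⟩ := exists_data h
  have hsize : ∑ p, (S.aut p).numStates + ∑ p, (S.aut p).trans.card = S.size := by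
    rw [← Finset.sum_add_distrib]; rfl
  have hL : ∑ p, (S.aut p).numStates = ((List.ofFn D).map AutData.numStates).sum := by
    rw [List.map_ofFn, List.sum_ofFn]
    exact Finset.sum_congr rfl fun p _ => (hD p).1.symm
  have hpos : k ≤ ∑ p, (S.aut p).numStates := by
    calc k = ∑ _p : Fin k, 1 := by simp
      _ ≤ _ := Finset.sum_le_sum fun p _ => (S.aut p).init.pos
  have hlen := length_recs hD
  rw [Finset.sum_add_distrib, Finset.sum_const, Finset.card_univ, Fintype.card_fin, smul_eq_mul,
    mul_one] at hlen
  have hrs := recList hD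
  have hm : ∀ E ∈ List.ofFn D, E.trans.length ≤ S.size := by
    intro E hE
    obtain ⟨p, rfl⟩ := (List.mem_ofFn' _ _).mp hE
    rw [(hD p).length]
    have := Finset.single_le_sum (f := fun p => (S.aut p).trans.card)
      (fun _ _ => Nat.zero_le _) (Finset.mem_univ p)
    omega
  refine (decideProg_spec (P := ¬ S.Greedy) (k := k) (b := b) (v := v) rfl
    (fun h0 hG => hG (greedy_of_no_actions h0)) fun hb hv s hw h1 h2 h3 h4 h5 h6 h7 =>
    (decideBody_spec (k := k) (m := S.size) rfl rfl hL rfl hw (by simp) h1 h2 h3 h4 h5 h6 h7 hm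
      (fun t ht => (rec_bounds hrs t ht).1) (rulesOf_valid (by simp only [elemBound]; omega)
        (rec_bounds hrs)) (by rw [initSum_eq hD]; exact Raw.code_lt _)
      (by rw [initSum_eq hD]; exact length_le_of_ruleReach hrs)).weaken fun u hu => ?_).mono ?_
    fun u hu => hu
  · rwa [initSum_eq hD, exists_ruleReach_bad_iff hrs] at hu
  · split_ifs with h0
    · have : 1 ≤ max 1 (b ^ 5 * v ^ 4 * 2 ^ b * S.size ^ (k + 2)) := le_max_left _ _
      omega
    · rw [not_or] at h0
      -- There is a buffer, hence a process using it, so `1 ≤ k`.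
      obtain ⟨p, -⟩ := S.buffers_cover ⟨0, by omega⟩
      refine (timeBound_le (n := S.size) (G := ∏ p, (S.aut p).numStates) p.pos (by omega) (by omega)
        le_rfl (by omega) (by omega) (by omega) (length_rulesOf_le _) card_node_le
        (card_mul_prod_le _ (by omega))).trans (Nat.mul_le_mul_left _ (le_max_right _ _))

end System

end FIFO

theorem mainTheorem1 :
    ∃ (prog : RAM.Prog) (C : ℕ),
      ∀ (k b v : ℕ) (S : FIFO.System (Fin k) (Fin b) (Fin v)) (w : List ℕ),
        FIFO.CodesSystem S w →
        ∃ (t : ℕ) (u : RAM.State),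
          RAM.Runs prog (RAM.initState w) t u ∧
          ((S.Greedy ∧ u.reg 0 = 1) ∨ (¬ S.Greedy ∧ u.reg 0 = 0)) ∧
          t ≤ C * max 1 (b ^ 5 * v ^ 4 * 2 ^ b * S.size ^ (k + 2)) := by
  refine ⟨RAM.decideProg, 150000, fun k b v S w h => ?_⟩
  obtain ⟨t, u, hr, ht, hu⟩ := S.decides h
  exact ⟨t, u, hr, hu.symm.imp (And.imp_left not_not.mp) id, ht⟩
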